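/- **Setting.** Let $N\in\mathbb N$, let $t,t_N$ be algebraically independent (Case A), $R=\mathbb C[t^{\pm1},t_N^{\pm1}]$, $K=\mathbb C(t,t_N)$, and $[p]=(t^p-t^{-p})/(t-t^{-1})$. Let $\mathcal H$ be the Iwahori–Hecke algebra of type $B_N$ over $R$, generated by $T_1,\dots,T_N$ with $(T_i-t)(T_i+t^{-1})=0$ for $i<N$, $(T_N-t_N)(T_N+t_N^{-1})=0$, and the braid relations of type $B_N$ (order $3$ between $i,i+1$ for $i\le N-2$, order $4$ between $N-1,N$, commutation otherwise). Its bar involution is the ring automorphism with $T_i\mapsto T_i^{-1}$, $t\mapsto t^{-1}$, $t_N\mapsto t_N^{-1}$, fixing $\mathbb C$. Let $\mathcal M^+$ be the free $R$-module with basis $m_\alpha$, $\alpha\in\{1,2\}^N$, with the $\mathcal H$-action: for $i<N$, $T_im_\alpha$ equals $t\,m_\alpha$ if $\alpha_i=\alpha_{i+1}$, $m_{s_i\alpha}$ if $\alpha_i<\alpha_{i+1}$, and $m_{s_i\alpha}+(t-t^{-1})m_\alpha$ if $\alpha_i>\alpha_{i+1}$; $T_Nm_\alpha$ equals $m_{s_N\alpha}$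 if $\alpha_N=1$ and $m_{s_N\alpha}+(t_N-t_N^{-1})m_\alpha$ if $\alpha_N=2$. Here $s_i$ ($i<N$) exchanges the letters $i,i+1$ and $s_N$ changes the last letter. For $\alpha\in\{1,2\}^N$ let $h_\alpha(i)$ be the number of letters $1$ minus the number of letters $2$ among $\alpha_1,\dots,\alpha_i$, and let $$\lambda^+(\alpha)=\{(i,j)\in\mathbb Z^2: 0<i\le N,\ |j|\le i,\ i+j-1\text{ even},\ j>h_\alpha(i)\}.$$ For factors $x_{i,j}$ indexed by these boxes, $\overleftarrow{\prod}_{(i,j)\in\lambda^+(\alpha)}x_{i,j}$ is the product in which the boxes on the diagonals $i-j=1,3,5,\dots$ are taken from right to left, and within a diagonal $i$ increases from left to right. Put $w^+(\alpha)=\overleftarrow{\prod}s_i$ in the Coxeter group of type $B_N$ and $T_{w^+(\alpha)}=\overleftarrow{\prod}T_i$, so that $m_\alpha=T_{w^+(\alpha)}m_{1\dots1}$. Write $\alpha\le\beta$ if $w^+(\alpha)\le w^+(\beta)$ in the strong Bruhat order. The bar involution of $\mathcal M^+$ is the semilinear map with $\overline{m_\alpha}=\overline{T_{w^+(\alpha)}}\,m_{1\dots1}$.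 The *Kazhdan–Lusztig basis* $(C^{A,+}_\beta)_\beta$ is the unique $R$-basis of $\mathcal M^+$ such that $\overline{C_\beta^{A,+}}=C_\beta^{A,+}$ and $C_\beta^{A,+}=\sum_{\alpha\le\beta}c_{\alpha,\beta}m_\alpha$ with $c_{\beta,\beta}=1$ and, for $\alpha\ne\beta$, $c_{\alpha,\beta}$ in the $\mathbb Z$-span of the monomials $t^at_N^b$ with $a<0$, or $a=0$ and $b<0$. Define $r_{i,j}=\max(r_{i-1,j-1},r_{i+1,j-1})+1$ for $(i,j)\in\lambda^+(\alpha)$ and $r_{i,j}=0$ otherwise. For $p\ge1$ define operators on $K\otimes_R\mathcal M^+$ by $$T_i(p)=T_i+\frac{t^{-p}}{[p]}\quad(1\le i\le N-1),\qquad T_N(p)=T_N-t_N+\frac{[\lceil p/2\rceil]}{[p]}\left(t_Nt^{\lfloor p/2\rfloor}+t_N^{-1}t^{-\lfloor p/2\rfloor}\right).$$ **Theorem.** The Kazhdan–Lusztig basis $(C_\alpha^{A,+})_\alpha$ of $\mathcal M^+$ exists and is unique, and for every $\alpha\in\{1,2\}^N$ the factorized element $$\widetilde{C_\alpha}:=\overleftarrow{\prod_{(i,j)\in\lambda^+(\alpha)}}T_i(r_{i,j})\;m_{1\dots1}\in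 K\otimes_R\mathcal M^+$$ is equal to (the image of) $C_\alpha^{A,+}$. -/

import Mathlib

noncomputable section

namespace KLFactor

/-! ### The ground ring and its bar involution -/

/-- The Laurent polynomial ring `ℂ[t^±1, t_N^±1]`, with monomial basis indexed by the pairs of
exponents `(i, j)` of `t ^ i * t_N ^ j`; the two parameters are algebraically independent. -/
abbrev LaurentRing : Type := AddMonoidAlgebra ℂ (ℤ × ℤ)

/-- Its field of fractions `ℂ(t, t_N)`. -/
abbrev RatField : Type := FractionRing LaurentRing

/-- The Laurent monomial with exponents `e`, as a unit. -/
def monomialUnit (e : ℤ × ℤ) : LaurentRingˣ where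
  val := AddMonoidAlgebra.single e 1
  inv := AddMonoidAlgebra.single (-e) 1
  val_inv := by
    rw [AddMonoidAlgebra.single_mul_single, add_neg_cancel, one_mul, AddMonoidAlgebra.one_def]
  inv_val := by
    rw [AddMonoidAlgebra.single_mul_single, neg_add_cancel, one_mul, AddMonoidAlgebra.one_def]

/-- The parameter `t`. -/
def tPar : LaurentRingˣ := monomialUnit (1, 0)

/-- The parameter `t_N`. -/
def tNPar : LaurentRingˣ := monomialUnit (0, 1)

/-- The bar involution of the ground ring: `t ↦ t⁻¹`, `t_N ↦ t_N⁻¹`, identity on `ℂ`. -/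
def barRing : LaurentRing →ₐ[ℂ] LaurentRing :=
  (AddMonoidAlgebra.domCongr ℂ ℂ (AddEquiv.neg (ℤ × ℤ))).toAlgHom

theorem barRing_monomialUnit (e : ℤ × ℤ) :
    barRing (monomialUnit e : LaurentRing) = ((monomialUnit e)⁻¹ : LaurentRingˣ) := by
  simp [barRing, monomialUnit, Units.inv_mk]

/-- `ℤ(Γ₋)`: integral combinations of the monomials that are smaller than `1` in the
lexicographic order, i.e. of the `t ^ i * t_N ^ j` with `i < 0`, or `i = 0` and `j < 0`. -/
def negSpan : AddSubgroup LaurentRing :=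
  AddSubgroup.closure
    {x | ∃ i j : ℤ, (i < 0 ∨ (i = 0 ∧ j < 0)) ∧ x = ((tPar ^ i * tNPar ^ j : LaurentRingˣ))}

/-! ### Binary strings, the Hecke action on the module `M⁺`

Generators are indexed by `Fin N`: the index `i` stands for the generator number `i + 1`, so
that the last index is the special node `N`. -/

/-- Binary strings of length `N`; the value `0` stands for the letter `1`, and the value `1` for
the letter `2`. -/
abbrev BinString (N : ℕ) : Type := Fin N → Fin 2

/-- The string `1…1`. -/
def allOnes (N : ℕ) : BinString N := fun _ => 0

/-- The action of the simple reflections on strings: exchange two adjacent letters, or change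
the last letter. -/
def simpleAct {N : ℕ} (i : Fin N) (α : BinString N) : BinString N :=
  if h : (i : ℕ) + 1 < N then α ∘ Equiv.swap i ⟨i + 1, h⟩
  else Function.update α i (1 - α i)

/-- The Hecke parameter of a node: `t`, except for the last node, where it is `t_N`. -/
def nodePar {A : Type} [CommRing A] (t tN : Aˣ) {N : ℕ} (i : Fin N) : Aˣ :=
  if (i : ℕ) + 1 < N then t else tN

/-- The free module on the `m_α`; the element `m_α` is `Finsupp.single α 1`. -/
abbrev StringModule (A : Type) [CommRing A] (N : ℕ) : Type := BinString N →₀ A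

/-- The vector `T_i m_α` of `M⁺`. -/
def genOnBasis {A : Type} [CommRing A] (t tN : Aˣ) {N : ℕ} (i : Fin N) (α : BinString N) :
    StringModule A N :=
  if h : (i : ℕ) + 1 < N then
    if α i = α ⟨i + 1, h⟩ then Finsupp.single α (t : A)
    else if α i < α ⟨i + 1, h⟩ then Finsupp.single (simpleAct i α) 1
    else Finsupp.single (simpleAct i α) 1 + Finsupp.single α ((t : A) - ((t⁻¹ : Aˣ) : A))
  else
    if α i = 0 then Finsupp.single (simpleAct i α) 1
    else Finsupp.single (simpleAct i α) 1 + Finsupp.single α ((tN : A) - ((tN⁻¹ : Aˣ) : A))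

/-- The operator `T_i` on `M⁺`. -/
def genOp {A : Type} [CommRing A] (t tN : Aˣ) {N : ℕ} (i : Fin N) :
    Module.End A (StringModule A N) :=
  Finsupp.linearCombination A (genOnBasis t tN i)

/-! ### The Iwahori–Hecke algebra of type `B_N` and its bar involution -/

/-- The defining relations of the Hecke algebra. -/
inductive HeckeRel (N : ℕ) :
    FreeAlgebra LaurentRing (Fin N) → FreeAlgebra LaurentRing (Fin N) → Prop
  | quadratic (i : Fin N) :
      HeckeRel N
        ((FreeAlgebra.ι LaurentRing i - algebraMap LaurentRing _ (nodePar tPar tNPar i)) *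
          (FreeAlgebra.ι LaurentRing i +
            algebraMap LaurentRing _ ((nodePar tPar tNPar i)⁻¹ : LaurentRingˣ)))
        0
  | commute (i j : Fin N) (h : (i : ℕ) + 1 < j) :
      HeckeRel N
        (FreeAlgebra.ι LaurentRing i * FreeAlgebra.ι LaurentRing j)
        (FreeAlgebra.ι LaurentRing j * FreeAlgebra.ι LaurentRing i)
  | braid (i j : Fin N) (h : (j : ℕ) = i + 1) (hj : (j : ℕ) + 1 < N) :
      HeckeRel N
        (FreeAlgebra.ι LaurentRing i * FreeAlgebra.ι LaurentRing j * FreeAlgebra.ι LaurentRing i)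
        (FreeAlgebra.ι LaurentRing j * FreeAlgebra.ι LaurentRing i * FreeAlgebra.ι LaurentRing j)
  | braidLast (i j : Fin N) (h : (j : ℕ) = i + 1) (hj : (j : ℕ) + 1 = N) :
      HeckeRel N
        (FreeAlgebra.ι LaurentRing i * FreeAlgebra.ι LaurentRing j *
          FreeAlgebra.ι LaurentRing i * FreeAlgebra.ι LaurentRing j)
        (FreeAlgebra.ι LaurentRing j * FreeAlgebra.ι LaurentRing i *
          FreeAlgebra.ι LaurentRing j * FreeAlgebra.ι LaurentRing i)

/-- The Iwahori–Hecke algebra of type `B_N`. -/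
def Hecke (N : ℕ) : Type := RingQuot (HeckeRel N)

instance (N : ℕ) : Ring (Hecke N) := inferInstanceAs (Ring (RingQuot (HeckeRel N)))

instance (N : ℕ) : Algebra LaurentRing (Hecke N) :=
  inferInstanceAs (Algebra LaurentRing (RingQuot (HeckeRel N)))

/-- The quotient map from the free algebra. -/
def heckeMk (N : ℕ) : FreeAlgebra LaurentRing (Fin N) →ₐ[LaurentRing] Hecke N :=
  RingQuot.mkAlgHom LaurentRing (HeckeRel N)

theorem heckeMk_rel {N : ℕ} {x y : FreeAlgebra LaurentRing (Fin N)} (h : HeckeRel N x y) :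
    heckeMk N x = heckeMk N y :=
  RingQuot.mkAlgHom_rel LaurentRing h

/-- The generator `T_i` of the Hecke algebra. -/
def heckeGen {N : ℕ} (i : Fin N) : Hecke N :=
  heckeMk N (FreeAlgebra.ι LaurentRing i)

theorem heckeGen_quadratic {N : ℕ} (i : Fin N) :
    (heckeGen i - algebraMap LaurentRing (Hecke N) (nodePar tPar tNPar i)) *
      (heckeGen i +
        algebraMap LaurentRing (Hecke N) ((nodePar tPar tNPar i)⁻¹ : LaurentRingˣ)) = 0 := by
  have h := heckeMk_rel (HeckeRel.quadratic i)
  rw [map_mul, map_sub, map_add, AlgHom.commutes, AlgHom.commutes, map_zero] at h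
  exact h

theorem quadratic_inverse {R H : Type} [CommRing R] [Ring H] [Algebra R H] (q : Rˣ) (x : H)
    (h : (x - algebraMap R H q) * (x + algebraMap R H (q⁻¹ : Rˣ)) = 0) :
    x * (x - algebraMap R H ((q : R) - (q⁻¹ : Rˣ))) = 1 ∧
      (x - algebraMap R H ((q : R) - (q⁻¹ : Rˣ))) * x = 1 := by
  have hq : algebraMap R H q * algebraMap R H (q⁻¹ : Rˣ) = 1 := by
    rw [← map_mul, Units.mul_inv, map_one]
  have c1 := Algebra.commutes (q : R) x
  have c2 := Algebra.commutes ((q⁻¹ : Rˣ) : R) x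
  rw [sub_mul, mul_add, mul_add, hq, c1] at h
  constructor
  · rw [map_sub, mul_sub, mul_sub]
    have : x * x - (x * algebraMap R H q - x * algebraMap R H (q⁻¹ : Rˣ)) - 1 = 0 := by
      rw [← h]; abel
    exact sub_eq_zero.mp this
  · rw [map_sub, sub_mul, sub_mul, c1, c2]
    have : x * x - (x * algebraMap R H q - x * algebraMap R H (q⁻¹ : Rˣ)) - 1 = 0 := by
      rw [← h]; abel
    exact sub_eq_zero.mp this

/-- The generator `T_i` as a unit; its inverse is `T_i - (q - q⁻¹)` with `q` the parameter of
the node. -/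
def heckeUnit {N : ℕ} (i : Fin N) : (Hecke N)ˣ where
  val := heckeGen i
  inv := heckeGen i - algebraMap LaurentRing (Hecke N)
    ((nodePar tPar tNPar i : LaurentRing) - ((nodePar tPar tNPar i)⁻¹ : LaurentRingˣ))
  val_inv := (quadratic_inverse _ _ (heckeGen_quadratic i)).1
  inv_val := (quadratic_inverse _ _ (heckeGen_quadratic i)).2

theorem heckeUnit_commute {N : ℕ} (i j : Fin N) (h : (i : ℕ) + 1 < j) :
    heckeUnit i * heckeUnit j = heckeUnit j * heckeUnit i := by
  have h := heckeMk_rel (HeckeRel.commute i j h)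
  simp only [map_mul] at h
  exact Units.ext h

theorem heckeUnit_braid {N : ℕ} (i j : Fin N) (h : (j : ℕ) = i + 1) (hj : (j : ℕ) + 1 < N) :
    heckeUnit i * heckeUnit j * heckeUnit i = heckeUnit j * heckeUnit i * heckeUnit j := by
  have h := heckeMk_rel (HeckeRel.braid i j h hj)
  simp only [map_mul] at h
  exact Units.ext h

theorem heckeUnit_braidLast {N : ℕ} (i j : Fin N) (h : (j : ℕ) = i + 1)
    (hj : (j : ℕ) + 1 = N) :
    heckeUnit i * heckeUnit j * heckeUnit i * heckeUnit j =
      heckeUnit j * heckeUnit i * heckeUnit j * heckeUnit i := by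
  have h := heckeMk_rel (HeckeRel.braidLast i j h hj)
  simp only [map_mul] at h
  exact Units.ext h

/-- The Hecke algebra, with the algebra structure twisted by the bar involution of the ground
ring. -/
def TwistedHecke (N : ℕ) : Type := Hecke N

instance (N : ℕ) : Ring (TwistedHecke N) := inferInstanceAs (Ring (Hecke N))

instance (N : ℕ) : Algebra LaurentRing (TwistedHecke N) :=
  RingHom.toAlgebra' (S := TwistedHecke N)
    ((algebraMap LaurentRing (Hecke N)).comp barRing.toRingHom)
    (fun c x => Algebra.commutes (A := Hecke N) (barRing c) x)

theorem algebraMap_twisted (N : ℕ) (c : LaurentRing) :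
    algebraMap LaurentRing (TwistedHecke N) c = algebraMap LaurentRing (Hecke N) (barRing c) :=
  rfl

theorem barRing_nodePar {N : ℕ} (i : Fin N) :
    barRing (nodePar tPar tNPar i : LaurentRing) =
        ((nodePar tPar tNPar i)⁻¹ : LaurentRingˣ) ∧
      barRing ((nodePar tPar tNPar i)⁻¹ : LaurentRingˣ) =
        (nodePar tPar tNPar i : LaurentRing) := by
  have key : ∀ e, barRing ((monomialUnit e)⁻¹ : LaurentRingˣ) = (monomialUnit e : LaurentRing) := by
    intro e
    simp [barRing, monomialUnit, Units.inv_mk]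
  unfold nodePar
  split
  · exact ⟨barRing_monomialUnit _, key _⟩
  · exact ⟨barRing_monomialUnit _, key _⟩

/-- The images `T_i ↦ T_i⁻¹` of the generators. -/
def barFree (N : ℕ) : FreeAlgebra LaurentRing (Fin N) →ₐ[LaurentRing] TwistedHecke N :=
  FreeAlgebra.lift LaurentRing
    (fun i => (((heckeUnit i)⁻¹ : (Hecke N)ˣ) : Hecke N))

theorem barFree_ι {N : ℕ} (i : Fin N) :
    barFree N (FreeAlgebra.ι LaurentRing i) = (((heckeUnit i)⁻¹ : (Hecke N)ˣ) : Hecke N) :=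
  FreeAlgebra.lift_ι_apply _ _

theorem barFree_rel (N : ℕ) ⦃x y : FreeAlgebra LaurentRing (Fin N)⦄ (h : HeckeRel N x y) :
    barFree N x = barFree N y := by
  cases h with
  | quadratic i =>
    rw [map_mul, map_sub, map_add, AlgHom.commutes, AlgHom.commutes, barFree_ι, map_zero,
      algebraMap_twisted, algebraMap_twisted, (barRing_nodePar i).1, (barRing_nodePar i).2]
    have hq := heckeGen_quadratic i
    have e1 : (((heckeUnit i)⁻¹ : (Hecke N)ˣ) : Hecke N) = heckeGen i -
      algebraMap LaurentRing (Hecke N)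
        ((nodePar tPar tNPar i : LaurentRing) - ((nodePar tPar tNPar i)⁻¹ : LaurentRingˣ)) := rfl
    rw [e1]
    have c : ∀ (a b x : Hecke N), (x - a) * (x + b) = 0 → a * x = x * a → b * x = x * b →
        a * b = b * a → (x - (a - b) - b) * (x - (a - b) + a) = 0 := by
      intro a b x h h1 h2 h3
      rw [← h]
      simp only [sub_mul, mul_sub, mul_add, h1, h2, h3]
      abel
    have := c _ _ _ hq (Algebra.commutes _ _) (Algebra.commutes _ _) (Algebra.commutes _ _)
    rw [← map_sub] at this
    exact this
  | commute i j h =>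
    rw [map_mul, map_mul, barFree_ι, barFree_ι]
    have := congrArg (fun u : (Hecke N)ˣ => ((u⁻¹ : (Hecke N)ˣ) : Hecke N))
      (heckeUnit_commute i j h)
    simp only [mul_inv_rev, Units.val_mul] at this
    exact this.symm
  | braid i j h hj =>
    simp only [map_mul, barFree_ι]
    have := congrArg (fun u : (Hecke N)ˣ => ((u⁻¹ : (Hecke N)ˣ) : Hecke N))
      (heckeUnit_braid i j h hj)
    simp only [mul_inv_rev, Units.val_mul, ← mul_assoc] at this
    exact this
  | braidLast i j h hj =>
    simp only [map_mul, barFree_ι]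
    have := congrArg (fun u : (Hecke N)ˣ => ((u⁻¹ : (Hecke N)ˣ) : Hecke N))
      (heckeUnit_braidLast i j h hj)
    simp only [mul_inv_rev, Units.val_mul, ← mul_assoc] at this
    exact this.symm

/-- The bar involution of the Hecke algebra: the ring endomorphism with `T_i ↦ T_i⁻¹` that
restricts to the bar involution on scalars. -/
def barHecke (N : ℕ) : Hecke N →+* Hecke N :=
  (RingQuot.liftAlgHom LaurentRing
    ⟨barFree N, barFree_rel N⟩ : Hecke N →ₐ[LaurentRing] TwistedHecke N).toRingHom

theorem barHecke_gen {N : ℕ} (i : Fin N) :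
    barHecke N (heckeGen i) = (((heckeUnit i)⁻¹ : (Hecke N)ˣ) : Hecke N) := by
  have h := RingQuot.liftAlgHom_mkAlgHom_apply LaurentRing (barFree N) (barFree_rel N)
    (FreeAlgebra.ι LaurentRing i)
  rw [barFree_ι] at h
  exact h

theorem barHecke_algebraMap {N : ℕ} (c : LaurentRing) :
    barHecke N (algebraMap LaurentRing (Hecke N) c) =
      algebraMap LaurentRing (Hecke N) (barRing c) :=
  (RingQuot.liftAlgHom LaurentRing
    ⟨barFree N, barFree_rel N⟩ : Hecke N →ₐ[LaurentRing] TwistedHecke N).commutes c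

/-! ### The Hecke module `M⁺` -/

theorem local_quadratic {A V : Type} [CommRing A] [AddCommGroup V] [Module A V] (t u : A)
    (htu : t * u = 1) (P : V →ₗ[A] V) (e : Fin 2 → Fin 2 → V)
    (hP : ∀ a b, P (e a b) = if a = b then t • e a b else if a < b then e b a
      else e b a + (t - u) • e a b) (a b : Fin 2) :
    P (P (e a b) + u • e a b) - t • (P (e a b) + u • e a b) = 0 := by
  fin_cases a <;> fin_cases b <;>
    simp [hP, map_add, map_smul] <;> match_scalars <;>
    first
      | ring1 | linear_combination htu | linear_combination -htu

theorem local_braid {A V : Type} [CommRing A] [AddCommGroup V] [Module A V] (t u : A)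
    (htu : t * u = 1) (P Q : V →ₗ[A] V) (e : Fin 2 → Fin 2 → Fin 2 → V)
    (hP : ∀ a b c, P (e a b c) = if a = b then t • e a b c else if a < b then e b a c
      else e b a c + (t - u) • e a b c)
    (hQ : ∀ a b c, Q (e a b c) = if b = c then t • e a b c else if b < c then e a c b
      else e a c b + (t - u) • e a b c) (a b c : Fin 2) :
    P (Q (P (e a b c))) = Q (P (Q (e a b c))) := by
  fin_cases a <;> fin_cases b <;> fin_cases c <;>
    simp [hP, hQ, map_add, map_smul] <;> match_scalars <;>
    first
      | ring1
      | linear_combination htu | linear_combination -htu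
      | linear_combination (t - u) * htu | linear_combination -(t - u) * htu

theorem local_braidLast {A V : Type} [CommRing A] [AddCommGroup V] [Module A V] (t u s v : A)
    (htu : t * u = 1) (P Q : V →ₗ[A] V) (e : Fin 2 → Fin 2 → V)
    (hP : ∀ a b, P (e a b) = if a = b then t • e a b else if a < b then e b a
      else e b a + (t - u) • e a b)
    (hQ : ∀ a b, Q (e a b) = if b = 0 then e a (1 - b)
      else e a (1 - b) + (s - v) • e a b) (a b : Fin 2) :
    P (Q (P (Q (e a b)))) = Q (P (Q (P (e a b)))) := by
  fin_cases a <;> fin_cases b <;>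
    simp [hP, hQ, map_add, map_smul] <;> match_scalars <;>
    first
      | ring1
      | linear_combination htu | linear_combination -htu
      | linear_combination (s - v) * htu | linear_combination -(s - v) * htu

theorem genOp_single {A : Type} [CommRing A] (t tN : Aˣ) {N : ℕ} (i : Fin N)
    (α : BinString N) : genOp t tN i (Finsupp.single α 1) = genOnBasis t tN i α := by
  simp [genOp]

theorem genOp_adjacent {A : Type} [CommRing A] (t tN : Aˣ) {N : ℕ} (i j : Fin N)
    (hij : (j : ℕ) = i + 1) (α β : BinString N) (h1 : β i = α j) (h2 : β j = α i)
    (h3 : ∀ k, k ≠ i → k ≠ j → β k = α k) :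
    genOp t tN i (Finsupp.single α 1) =
      if α i = α j then (t : A) • Finsupp.single α 1
      else if α i < α j then Finsupp.single β 1
      else Finsupp.single β 1 + ((t : A) - (t⁻¹ : Aˣ)) • Finsupp.single α 1 := by
  have hlt : (i : ℕ) + 1 < N := hij ▸ j.2
  have hj : (⟨i + 1, hlt⟩ : Fin N) = j := Fin.ext hij.symm
  have hs : simpleAct i α = β := by
    funext k
    simp only [simpleAct, hlt, dite_true, hj, Function.comp]
    by_cases hk : k = i
    · subst hk; rw [Equiv.swap_apply_left, h1]
    · by_cases hk' : k = j
      · subst hk'; rw [Equiv.swap_apply_right, h2]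
      · rw [Equiv.swap_apply_of_ne_of_ne hk hk', h3 k hk hk']
  rw [genOp_single]
  simp only [genOnBasis, hlt, dite_true, hj, hs, Finsupp.smul_single, smul_eq_mul, mul_one]

theorem genOp_last {A : Type} [CommRing A] (t tN : Aˣ) {N : ℕ} (i : Fin N)
    (hi : (i : ℕ) + 1 = N) (α β : BinString N) (h1 : β i = 1 - α i)
    (h3 : ∀ k, k ≠ i → β k = α k) :
    genOp t tN i (Finsupp.single α 1) =
      if α i = 0 then Finsupp.single β 1
      else Finsupp.single β 1 + ((tN : A) - (tN⁻¹ : Aˣ)) • Finsupp.single α 1 := by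
  have hlt : ¬ (i : ℕ) + 1 < N := by omega
  have hs : simpleAct i α = β := by
    funext k
    simp only [simpleAct, hlt, dite_false]
    by_cases hk : k = i
    · subst hk; rw [Function.update_self, h1]
    · rw [Function.update_of_ne hk, h3 k hk]
  rw [genOp_single]
  simp only [genOnBasis, hlt, dite_false, hs, Finsupp.smul_single, smul_eq_mul, mul_one]

theorem end_ext {A : Type} [CommRing A] {N : ℕ} {f g : Module.End A (StringModule A N)}
    (h : ∀ α, f (Finsupp.single α 1) = g (Finsupp.single α 1)) : f = g := by
  refine Finsupp.lhom_ext' fun α => LinearMap.ext_ring ?_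
  exact h α

theorem genOp_quadratic {A : Type} [CommRing A] (t tN : Aˣ) {N : ℕ} (i : Fin N) :
    (genOp t tN i - algebraMap A _ (nodePar t tN i : A)) *
      (genOp t tN i + algebraMap A _ (((nodePar t tN i)⁻¹ : Aˣ) : A)) = 0 := by
  refine end_ext fun α => ?_
  simp only [Module.End.mul_apply, LinearMap.sub_apply, LinearMap.add_apply,
    Module.algebraMap_end_apply, LinearMap.zero_apply]
  by_cases hi : (i : ℕ) + 1 < N
  · have hn : nodePar t tN i = t := by simp [nodePar, hi]
    rw [hn]
    set j : Fin N := ⟨i + 1, hi⟩ with hj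
    have hne : i ≠ j := by intro h; have := congrArg Fin.val h; simp [hj] at this
    have key := local_quadratic (t : A) (t⁻¹ : Aˣ) (Units.mul_inv t) (genOp t tN i)
      (fun a b => Finsupp.single (Function.update (Function.update α i a) j b) (1 : A))
      (by
        intro a b
        rw [genOp_adjacent t tN i j rfl _ (Function.update (Function.update α i b) j a)]
        · simp [hne]
        · simp [hne]
        · simp [hne]
        · intro k h1 h2; simp [h1, h2]) (α i) (α j)
    simpa using key
  · have hi' : (i : ℕ) + 1 = N := by have := i.2; omega
    have hn : nodePar t tN i = tN := by simp [nodePar, hi]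
    rw [hn]
    have htu := Units.mul_inv tN
    have key : ∀ a : Fin 2, genOp t tN i (Finsupp.single (Function.update α i a) 1) =
        if a = 0 then Finsupp.single (Function.update α i (1 - a)) (1 : A)
        else Finsupp.single (Function.update α i (1 - a)) 1 +
          ((tN : A) - (tN⁻¹ : Aˣ)) • Finsupp.single (Function.update α i a) 1 := by
      intro a
      rw [genOp_last t tN i hi' _ (Function.update α i (1 - a))]
      · simp
      · simp
      · intro k h1; simp [h1]
    have : α = Function.update α i (α i) := by simp
    rw [this]
    generalize α i = a
    fin_cases a <;> simp only [Fin.zero_eta, Fin.mk_one, key, map_add, map_smul, if_true,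
      sub_zero, sub_self, one_ne_zero, if_false] <;> match_scalars <;>
      first
        | ring1 | linear_combination htu | linear_combination -htu

theorem genOp_braid {A : Type} [CommRing A] (t tN : Aˣ) {N : ℕ} (i j : Fin N)
    (h : (j : ℕ) = i + 1) (hj : (j : ℕ) + 1 < N) :
    genOp t tN i * genOp t tN j * genOp t tN i = genOp t tN j * genOp t tN i * genOp t tN j := by
  refine end_ext fun α => ?_
  simp only [Module.End.mul_apply]
  set k : Fin N := ⟨j + 1, hj⟩ with hk
  have h1 : i ≠ j := by intro h; have := congrArg Fin.val h; omega
  have h2 : j ≠ k := by intro h; have := congrArg Fin.val h; simp [hk] at this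
  have h3 : i ≠ k := by intro h; have := congrArg Fin.val h; simp [hk] at this; omega
  have key := local_braid (t : A) (t⁻¹ : Aˣ) (Units.mul_inv t) (genOp t tN i) (genOp t tN j)
    (fun a b c => Finsupp.single
      (Function.update (Function.update (Function.update α i a) j b) k c) (1 : A))
    (by
      intro a b c
      rw [genOp_adjacent t tN i j h _
        (Function.update (Function.update (Function.update α i b) j a) k c)]
      · simp [h1, h2, h3]
      · simp [h1, h2, h3]
      · simp [h1, h2, h3]
      · intro l e1 e2; by_cases e3 : l = k <;> simp [e1, e2, e3])
    (by
      intro a b c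
      rw [genOp_adjacent t tN j k rfl _
        (Function.update (Function.update (Function.update α i a) j c) k b)]
      · simp [h2]
      · simp [h2]
      · simp [h2]
      · intro l e1 e2; by_cases e3 : l = i <;> simp [e1, e2, e3, h1, h3]) (α i) (α j) (α k)
  simpa using key

theorem genOp_braidLast {A : Type} [CommRing A] (t tN : Aˣ) {N : ℕ} (i j : Fin N)
    (h : (j : ℕ) = i + 1) (hj : (j : ℕ) + 1 = N) :
    genOp t tN i * genOp t tN j * genOp t tN i * genOp t tN j =
      genOp t tN j * genOp t tN i * genOp t tN j * genOp t tN i := by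
  refine end_ext fun α => ?_
  simp only [Module.End.mul_apply]
  have h1 : i ≠ j := by intro h; have := congrArg Fin.val h; omega
  have key := local_braidLast (t : A) (t⁻¹ : Aˣ) (tN : A) (tN⁻¹ : Aˣ) (Units.mul_inv t)
    (genOp t tN i) (genOp t tN j)
    (fun a b => Finsupp.single (Function.update (Function.update α i a) j b) (1 : A))
    (by
      intro a b
      rw [genOp_adjacent t tN i j h _ (Function.update (Function.update α i b) j a)]
      · simp [h1]
      · simp [h1]
      · simp [h1]
      · intro l e1 e2; simp [e1, e2])
    (by
      intro a b
      rw [genOp_last t tN j hj _ (Function.update (Function.update α i a) j (1 - b))]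
      · simp
      · simp
      · intro l e1; simp [e1]) (α i) (α j)
  simpa using key

theorem genOp_form {A : Type} [CommRing A] (t tN : Aˣ) {N : ℕ} (i : Fin N) :
    ∃ p q : BinString N → A,
      (∀ α, genOp t tN i (Finsupp.single α 1) =
        p α • Finsupp.single (simpleAct i α) 1 + q α • Finsupp.single α 1) ∧
      ∀ α β : BinString N, α i = β i → (∀ k : Fin N, (k : ℕ) = i + 1 → α k = β k) →
        p α = p β ∧ q α = q β := by
  by_cases hi : (i : ℕ) + 1 < N
  · refine ⟨fun α => if α i = α ⟨i + 1, hi⟩ then 0 else 1,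
      fun α => if α i = α ⟨i + 1, hi⟩ then (t : A) else if α i < α ⟨i + 1, hi⟩ then 0
        else (t : A) - (t⁻¹ : Aˣ), ?_, ?_⟩
    · intro α
      rw [genOp_single]
      simp only [genOnBasis, hi, dite_true]
      split_ifs <;> simp
    · intro α β h1 h2
      simp only [h1, h2 ⟨i + 1, hi⟩ rfl, and_self]
  · refine ⟨fun α => 1, fun α => if α i = 0 then 0 else (tN : A) - (tN⁻¹ : Aˣ), ?_, ?_⟩
    · intro α
      rw [genOp_single]
      simp only [genOnBasis, hi, dite_false]
      split_ifs <;> simp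
    · intro α β h1 h2
      simp only [h1, and_self]

theorem simpleAct_of_ne {N : ℕ} (i k : Fin N) (α : BinString N) (h1 : k ≠ i)
    (h2 : (k : ℕ) ≠ i + 1) : simpleAct i α k = α k := by
  unfold simpleAct
  split
  · simp only [Function.comp]
    rw [Equiv.swap_apply_of_ne_of_ne h1]
    intro h; exact h2 (congrArg Fin.val h)
  · simp [h1]

theorem simpleAct_comm {N : ℕ} (i j : Fin N) (h : (i : ℕ) + 1 < j) (α : BinString N) :
    simpleAct i (simpleAct j α) = simpleAct j (simpleAct i α) := by
  have hi : (i : ℕ) + 1 < N := h.trans j.2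
  have hij : i ≠ j := by intro e; have := congrArg Fin.val e; omega
  have hij' : (⟨i + 1, hi⟩ : Fin N) ≠ j := by intro e; have := congrArg Fin.val e; simp at this; omega
  funext k
  by_cases hk : k = i ∨ (k : ℕ) = i + 1
  · have e1 : simpleAct j (simpleAct i α) k = simpleAct i α k := by
      apply simpleAct_of_ne
      · rintro rfl; omega
      · omega
    rw [e1]
    simp only [simpleAct, hi, dite_true, Function.comp]
    have : ∀ l : Fin N, l = i ∨ (l : ℕ) = i + 1 → simpleAct j α l = α l := by
      intro l hl
      apply simpleAct_of_ne
      · rintro rfl; omega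
      · omega
    apply this
    rcases hk with rfl | hk
    · right; simp
    · left
      have : k = ⟨i + 1, hi⟩ := Fin.ext hk
      rw [this, Equiv.swap_apply_right]
  · push Not at hk
    rw [simpleAct_of_ne i k _ hk.1 hk.2]
    by_cases hj : (j : ℕ) + 1 < N
    · simp only [simpleAct, hi, hj, dite_true, Function.comp]
      congr 1
      symm
      apply Equiv.swap_apply_of_ne_of_ne
      · intro e
        have e' : k = Equiv.swap j ⟨j + 1, hj⟩ i := by rw [← e, Equiv.swap_apply_self]
        rw [Equiv.swap_apply_of_ne_of_ne hij (by intro e; have := congrArg Fin.val e; simp at this; omega)] at e'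
        exact hk.1 e'
      · intro e
        have e' : k = Equiv.swap j ⟨j + 1, hj⟩ ⟨i + 1, hi⟩ := by rw [← e, Equiv.swap_apply_self]
        rw [Equiv.swap_apply_of_ne_of_ne hij' (by intro e; have := congrArg Fin.val e; simp at this; omega)] at e'
        exact hk.2 (congrArg Fin.val e')
    · have e1 : simpleAct i α j = α j := simpleAct_of_ne i j α hij.symm (by omega)
      have e2 : simpleAct i α k = α k := simpleAct_of_ne i k α hk.1 hk.2
      simp only [simpleAct, hj, dite_false] at e1 e2 ⊢
      by_cases hkj : k = j
      · subst hkj; simp only [Function.update_self, e1]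
      · simp only [Function.update_of_ne hkj, e2]

theorem genOp_commute {A : Type} [CommRing A] (t tN : Aˣ) {N : ℕ} (i j : Fin N)
    (h : (i : ℕ) + 1 < j) : genOp t tN i * genOp t tN j = genOp t tN j * genOp t tN i := by
  obtain ⟨p, q, h1, h2⟩ := genOp_form t tN i
  obtain ⟨p', q', h1', h2'⟩ := genOp_form t tN j
  refine end_ext fun α => ?_
  have a1 := h2 (simpleAct j α) α
    (simpleAct_of_ne j i α (by rintro rfl; omega) (by omega))
    (fun k hk => simpleAct_of_ne j k α (by rintro rfl; omega) (by omega))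
  have a2 := h2' (simpleAct i α) α
    (simpleAct_of_ne i j α (by rintro rfl; omega) (by omega))
    (fun k hk => simpleAct_of_ne i k α (by rintro rfl; omega) (by omega))
  simp only [Module.End.mul_apply, h1, h1', map_add, map_smul, a1.1, a1.2, a2.1, a2.2,
    simpleAct_comm i j h]
  module

/-- The action of the Hecke algebra on `M⁺`, in which `T_i` acts by the operator `genOp`. -/
def heckeAction (N : ℕ) :
    Hecke N →ₐ[LaurentRing] Module.End LaurentRing (StringModule LaurentRing N) :=
  RingQuot.liftAlgHom LaurentRing
    ⟨FreeAlgebra.lift LaurentRing (genOp tPar tNPar), by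
      intro x y h
      cases h with
      | quadratic i =>
        rw [map_mul, map_sub, map_add, AlgHom.commutes, AlgHom.commutes,
          FreeAlgebra.lift_ι_apply, map_zero]
        exact genOp_quadratic tPar tNPar i
      | commute i j h =>
        simp only [map_mul, FreeAlgebra.lift_ι_apply]
        exact genOp_commute tPar tNPar i j h
      | braid i j h hj =>
        simp only [map_mul, FreeAlgebra.lift_ι_apply]
        exact genOp_braid tPar tNPar i j h hj
      | braidLast i j h hj =>
        simp only [map_mul, FreeAlgebra.lift_ι_apply]
        exact genOp_braidLast tPar tNPar i j h hj⟩

theorem heckeAction_gen {N : ℕ} (i : Fin N) :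
    heckeAction N (heckeGen i) = genOp tPar tNPar i := by
  refine (RingQuot.liftAlgHom_mkAlgHom_apply LaurentRing _ _ _).trans ?_
  exact FreeAlgebra.lift_ι_apply _ _

/-! ### Paths, shifted Ferrers diagrams and words -/

/-- The height at abscissa `i` of the path of `α`, which starts at the origin and has a step
`(1, 1)` for each letter `1` and a step `(1, -1)` for each letter `2`. -/
def pathHeight {N : ℕ} (α : BinString N) (i : ℤ) : ℤ :=
  ∑ k : Fin N, if ((k : ℕ) : ℤ) < i then (if α k = 0 then 1 else -1) else 0

/-- Membership of `(i, j)` in `S⁺(α)`, the set of centres of the boxes of `λ⁺(α)`. -/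
def IsBox {N : ℕ} (α : BinString N) (i j : ℤ) : Prop :=
  pathHeight α i < j ∧ 0 < i ∧ i ≤ N ∧ |j| ≤ i ∧ Even (i + j - 1)

open Classical in
/-- The boxes of `λ⁺(α)` in the order in which the factors of an ordered product over `λ⁺(α)`
are written, from left to right. A pair `(k, j)` stands for the box with centre `(k + 1, j)`.
The column number `c + 1` consists of the boxes on the diagonal `i - j = 2 c + 1`; in a product,
its factors are written with `i` increasing, and the factors of the first column come last, so
that the first column is the first to act. -/
def boxList {N : ℕ} (α : BinString N) : List (Fin N × ℤ) :=
  ((List.finRange N).reverse.flatMap fun c : Fin N =>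
    (List.finRange N).map fun k : Fin N => (k, ((k : ℕ) : ℤ) - 2 * ((c : ℕ) : ℤ))).filter
      fun b => IsBox α (((b.1 : ℕ) : ℤ) + 1) b.2

/-- The word `w⁺(α)`, the ordered product of the `s_i` over the boxes `(i, j)` of `λ⁺(α)`. -/
def word {N : ℕ} (α : BinString N) : List (Fin N) := (boxList α).map Prod.fst

/-- The Coxeter system of type `B_N`. -/
abbrev coxB (N : ℕ) : CoxeterSystem (CoxeterMatrix.B N) (CoxeterMatrix.B N).Group :=
  (CoxeterMatrix.B N).toCoxeterSystem

/-- The strong Bruhat order: `v ≤ w` if `v` is the product of a subexpression of a reduced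
expression of `w`. -/
def BruhatLE {N : ℕ} (v w : (CoxeterMatrix.B N).Group) : Prop :=
  ∃ ω : List (Fin N), (coxB N).IsReduced ω ∧ (coxB N).wordProd ω = w ∧
    ∃ ω' : List (Fin N), ω'.Sublist ω ∧ (coxB N).wordProd ω' = v

/-- The order on binary strings, `w⁺(α) ≤ w⁺(β)` in the Bruhat order. -/
def stringLE {N : ℕ} (α β : BinString N) : Prop :=
  BruhatLE ((coxB N).wordProd (word α)) ((coxB N).wordProd (word β))

/-! ### The Kazhdan–Lusztig basis of `M⁺` -/

/-- The element `T_{w⁺(α)}` of the Hecke algebra. -/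
def heckeWord {N : ℕ} (α : BinString N) : Hecke N := ((word α).map heckeGen).prod

/-- The bar involution of `M⁺`: it is semilinear, and it sends `m_α = T_{w⁺(α)} m_{1…1}` to
`bar (T_{w⁺(α)}) m_{1…1}`. -/
def barModule {N : ℕ} (x : StringModule LaurentRing N) : StringModule LaurentRing N :=
  x.sum fun α c =>
    barRing c • heckeAction N (barHecke N (heckeWord α)) (Finsupp.single (allOnes N) 1)

/-- The defining properties of the Kazhdan–Lusztig basis of `M⁺`: a basis of bar invariant
elements in which `C_β` is a combination of the `m_α` with `α ≤ β`, where `m_β` has the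
coefficient `1` and the other coefficients are in `ℤ(Γ₋)`. -/
structure IsKLBasis {N : ℕ} (C : BinString N → StringModule LaurentRing N) : Prop where
  linearIndependent : LinearIndependent LaurentRing C
  span_eq_top : Submodule.span LaurentRing (Set.range C) = ⊤
  bar_invariant : ∀ β, barModule (C β) = C β
  support_le : ∀ α β, C β α ≠ 0 → stringLE α β
  coeff_self : ∀ β, C β β = 1
  coeff_mem : ∀ α β, α ≠ β → C β α ∈ negSpan

/-! ### The factorized element -/

open Classical in
/-- The integers `r_{i,j}`. -/
def boxHeight {N : ℕ} (α : BinString N) (i j : ℤ) : ℕ :=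
  if _h : IsBox α i j then
    max (boxHeight α (i - 1) (j - 1)) (boxHeight α (i + 1) (j - 1)) + 1
  else 0
  termination_by (j + N).toNat
  decreasing_by
    all_goals
      obtain ⟨-, -, h1, h2, h3⟩ := _h
      have h4 := (abs_le.mp h2).1
      have h5 : j ≠ -(i : ℤ) := by
        rintro rfl
        obtain ⟨m, hm⟩ := h3
        omega
      omega

/-- The parameter `t`, in the field `ℂ(t, t_N)`. -/
def tK : RatFieldˣ := Units.map (algebraMap LaurentRing RatField : _ →* RatField) tPar

/-- The parameter `t_N`, in the field `ℂ(t, t_N)`. -/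
def tNK : RatFieldˣ := Units.map (algebraMap LaurentRing RatField : _ →* RatField) tNPar

/-- The `t`-deformed integer `[p]`. -/
def qInt (p : ℕ) : RatField :=
  ((tK : RatField) ^ p - (tK : RatField)⁻¹ ^ p) / ((tK : RatField) - (tK : RatField)⁻¹)

/-- The operator `T_i(p)` on `M⁺` with scalars extended to `ℂ(t, t_N)`; note that the natural
numbers `(p + 1) / 2` and `p / 2` are the ceiling and the floor of the half of `p`. -/
def factorOp {N : ℕ} (i : Fin N) (p : ℕ) : Module.End RatField (StringModule RatField N) :=
  if (i : ℕ) + 1 < N then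
    genOp tK tNK i + ((tK : RatField)⁻¹ ^ p / qInt p) • 1
  else
    genOp tK tNK i - (tNK : RatField) • 1 +
      (qInt ((p + 1) / 2) / qInt p *
        ((tNK : RatField) * (tK : RatField) ^ (p / 2) +
          (tNK : RatField)⁻¹ * (tK : RatField)⁻¹ ^ (p / 2))) • 1

/-- The factorized element: the ordered product of the `T_i(r_{i,j})` over the boxes `(i, j)` of
`λ⁺(α)`, applied to `m_{1…1}`. -/
def factorized {N : ℕ} (α : BinString N) : StringModule RatField N :=
  ((boxList α).map fun b => factorOp b.1 (boxHeight α (((b.1 : ℕ) : ℤ) + 1) b.2)).prod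
    (Finsupp.single (allOnes N) 1)

/-- The extension of scalars from `ℂ[t^±1, t_N^±1]` to `ℂ(t, t_N)`. -/
def extendScalars {N : ℕ} (x : StringModule LaurentRing N) : StringModule RatField N :=
  x.mapRange (algebraMap LaurentRing RatField) (map_zero _)

end KLFactor

end

noncomputable section

namespace KLFactor

/-! ### Link patterns

A letter `1` is encoded by `false` and a letter `2` by `true`. -/

/-! Write `E_i = T_i - q_i`, where `q_i` is the parameter of the node `i` (`shiftOp`). Read a string
as a word of parentheses, the letter 1 opening and the letter 2 closing, and match them. Each string
`δ` then gives a linear form on `M⁺` (`pairing`), whose value at `m_γ` is a product over the link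
pattern of `δ` (`linkCoeff`): an arc is read in `γ` as `1…2` with weight `1` or as `2…1` with weight
`-t⁻¹`; an unmatched 2 is kept; an unmatched 1 is kept with weight `1`, or read as 2 with weight
`-t_N⁻¹` or `t⁻¹t_N`, alternately from the right end. With these weights the forms carry an action
of the one-boundary Temperley–Lieb algebra: composing the form of `δ` with `E_i` gives a scalar,
possibly `0` and always bar invariant, times the form of one string, which for `i < N` can be chosen
with a peak `12` at `i`.

The matrix of the forms is unitriangular for the area between the path and that of `1…1`, and its
other entries are in `ℤ(Γ₋)`. The dual basis (`dualBasis`) therefore exists over the Laurent ring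
and has the same two properties. The semilinear map that fixes it commutes with all `E_i`, because
the scalars are bar invariant, and it fixes `m_{1…1}`; hence it is the bar involution. So the dual
basis is bar invariant. It is the only candidate: the pairings of a Kazhdan–Lusztig element differ
from Kronecker deltas by bar invariant elements of `ℤ(Γ₋)`, and these are `0`.

It remains to see that the factorized element of `α` pairs to `1` with `α` and to `0` with every
other string (`isDual_factorProd`). This goes by induction on the area. Some run of letters 2 in `α`
can be peeled off: `α = σ 2^b 1^c 2^c τ` arises from `σ 1^c 2^b 2^c τ`, or `α = σ 2^b 1^c` arises
from `σ 1^c 1^b`, where `σ` consists of letters 1 or ends in `1^b`. The product for `α` is a product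
over a block of boxes applied to that of the smaller string. Three facts determine the result. The
block cannot reach outside its own positions, because an arc leaving them would have to pass over
`1^b` or `2^c`. All `E_k` inside the block annihilate the result, by the recursions of the scalars
in `T_i(p)`, so only strings sorted as `2…2 1…1` in the block survive. In a final block too few
letters 2 are excluded, because a row whose contents start at `1` kills the patterns with a long end
of letters 1. The pairing with `α` itself is `1` by comparing leading terms for the area.

The Bruhat condition comes from expanding the factorized product over subwords of `w⁺(α)`. That word
is reduced, since the Coxeter group acts on strings, a generator raises the area by at most one, and
the word raises it from `0` to its own length. -/

/-- The height reached by a path that starts at the height `h`, if it never gets below `0`. -/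
def endHeight : ℕ → List Bool → Option ℕ
  | h, [] => some h
  | h, false :: w => endHeight (h + 1) w
  | h + 1, true :: w => endHeight h w
  | 0, true :: _ => none

/-- The weight of a flipped unmatched letter `1`, according to the parity of its rank. -/
def rayPar {A : Type} [CommRing A] (t s : Aˣ) (b : Bool) : A :=
  if b then (t⁻¹ : Aˣ) * s else -(s⁻¹ : Aˣ)

/-- The product of the weights of the unmatched letters `1`, last letter first. -/
def rayWeight {A : Type} [CommRing A] (t s : Aˣ) : Bool → List Bool → A
  | _, [] => 1
  | b, f :: S => (if f then rayPar t s b else 1) * rayWeight t s (!b) S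

/-- The coefficient of the string `γ` in the vector of the link pattern of the string `δ`; the
first argument records, for the letters `1` of `δ` that wait for a partner, whether `γ` flips
them. -/
def linkCoeff {A : Type} [CommRing A] (t s : Aˣ) : List Bool → List Bool → List Bool → A
  | S, [], [] => rayWeight t s false S
  | S, false :: δ, g :: γ => linkCoeff t s (g :: S) δ γ
  | f :: S, true :: δ, g :: γ =>
    if g = f then 0 else (if f then -((t⁻¹ : Aˣ) : A) else 1) * linkCoeff t s S δ γ
  | [], true :: δ, g :: γ => if g then linkCoeff t s [] δ γ else 0
  | _, [], _ :: _ => 0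
  | _, _ :: _, [] => 0

/-- For `h = 0`, the letter 2 found here is the partner of a letter 1 placed directly in front of
`v`, and `w` is the balanced word between them. -/
theorem exists_excursion_of_endHeight_eq_none (h : ℕ) (v : List Bool) (hv : endHeight h v = none) :
    ∃ w v', v = w ++ true :: v' ∧ endHeight h w = some 0 := by
  induction v generalizing h with
  | nil => simp [endHeight] at hv
  | cons a v ih =>
    cases a with
    | false =>
      obtain ⟨w, v', rfl, h2⟩ := ih (h + 1) (by simpa [endHeight] using hv)
      exact ⟨false :: w, v', rfl, by simpa [endHeight] using h2⟩
    | true =>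
      cases h with
      | zero => exact ⟨[], v, rfl, rfl⟩
      | succ h =>
        obtain ⟨w, v', rfl, h2⟩ := ih h (by simpa [endHeight] using hv)
        exact ⟨true :: w, v', rfl, by simpa [endHeight] using h2⟩

theorem endHeight_append (h : ℕ) (u v : List Bool) :
    endHeight h (u ++ v) = (endHeight h u).bind fun k => endHeight k v := by
  induction u generalizing h with
  | nil => simp [endHeight]
  | cons a u ih =>
    cases a with
    | false => simp [endHeight, ih]
    | true =>
      cases h with
      | zero => simp [endHeight]
      | succ h => simp [endHeight, ih]

theorem endHeight_add (h k m : ℕ) (u : List Bool) (hu : endHeight h u = some m) :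
    endHeight (h + k) u = some (m + k) := by
  induction u generalizing h with
  | nil => simp_all [endHeight]
  | cons a u ih =>
    cases a with
    | false =>
      have := ih (h + 1) (by simpa [endHeight] using hu)
      simpa [endHeight, add_right_comm] using this
    | true =>
      cases h with
      | zero => simp [endHeight] at hu
      | succ h =>
        have := ih h (by simpa [endHeight] using hu)
        rw [add_right_comm]
        simpa [endHeight] using this

theorem count_of_endHeight (h m : ℕ) (u : List Bool) (hu : endHeight h u = some m) :
    m + u.count true = h + u.count false := by
  induction u generalizing h with
  | nil => simp_all [endHeight]
  | cons a u ih =>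
    cases a with
    | false =>
      have := ih (h + 1) (by simpa [endHeight] using hu)
      simp; omega
    | true =>
      cases h with
      | zero => simp [endHeight] at hu
      | succ h =>
        have := ih h (by simpa [endHeight] using hu)
        simp; omega

theorem count_le_of_endHeight_append (u v : List Bool) (h : endHeight 0 (u ++ v) ≠ none) :
    u.count true ≤ u.count false := by
  rw [endHeight_append] at h
  obtain ⟨m, hm⟩ : ∃ m, endHeight 0 u = some m := by
    cases hh : endHeight 0 u with
    | none => simp [hh] at h
    | some m => exact ⟨m, rfl⟩
  have := count_of_endHeight 0 m u hm
  omega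

theorem count_le_of_endHeight_suffix (u v : List Bool) (h : endHeight 0 (u ++ v) = some 0) :
    v.count false ≤ v.count true := by
  have h1 := count_le_of_endHeight_append u v (by simp [h])
  have h2 := count_of_endHeight 0 0 _ h
  simp only [List.count_append] at h2
  omega

/-! ### Local relations between the coefficients of link patterns -/

section

variable {A : Type} [CommRing A] (t s : Aˣ)

/-- Such a word never closes a letter below `X` on the stack, so the rest of the data enters only
through the remaining coefficient. All locality statements come from this one. -/
theorem linkCoeff_excursion (w γw : List Bool) (hl : γw.length = w.length) (X : List Bool) (m : ℕ)
    (hw : endHeight X.length w = some m) :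
    ∃ (c : A) (Y : List Bool), Y.length = m ∧ ∀ S v γ,
      linkCoeff t s (X ++ S) (w ++ v) (γw ++ γ) = c * linkCoeff t s (Y ++ S) v γ := by
  induction w generalizing X γw with
  | nil =>
    obtain rfl : γw = [] := by simpa using hl
    refine ⟨1, X, by simpa [endHeight] using hw, fun S v γ => by simp⟩
  | cons a w ih =>
    obtain ⟨g, γw, rfl⟩ := List.exists_cons_of_ne_nil (l := γw) (by rintro rfl; simp at hl)
    have hl' : γw.length = w.length := by simpa using hl
    cases a with
    | false =>
      obtain ⟨c, Y, h1, h2⟩ := ih γw hl' (g :: X) (by simpa [endHeight] using hw)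
      exact ⟨c, Y, h1, fun S v γ => by simpa [linkCoeff] using h2 S v γ⟩
    | true =>
      cases X with
      | nil => simp [endHeight] at hw
      | cons f X =>
        obtain ⟨c, Y, h1, h2⟩ := ih γw hl' X (by simpa [endHeight] using hw)
        refine ⟨if g = f then 0 else (if f then -((t⁻¹ : Aˣ) : A) else 1) * c, Y, h1,
          fun S v γ => ?_⟩
        simp only [List.cons_append, linkCoeff, h2]
        split_ifs <;> ring

theorem linkCoeff_dyck (w γw : List Bool) (hl : γw.length = w.length)
    (hw : endHeight 0 w = some 0) :
    ∃ c : A, ∀ S v γ, linkCoeff t s S (w ++ v) (γw ++ γ) = c * linkCoeff t s S v γ := by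
  obtain ⟨c, Y, h1, h2⟩ := linkCoeff_excursion t s w γw hl [] 0 hw
  obtain rfl : Y = [] := by simpa using h1
  exact ⟨c, fun S v γ => by simpa using h2 S v γ⟩

/-- The letters behind a prefix see of it only the flags of its open letters, so a relation at two
neighbouring letters need only be checked for an arbitrary stack. -/
theorem linkCoeff_prefix (u γu S : List Bool) (hl : γu.length = u.length) :
    ∃ (c : A) (S' : List Bool), ∀ v γ,
      linkCoeff t s S (u ++ v) (γu ++ γ) = c * linkCoeff t s S' v γ := by
  induction u generalizing S γu with
  | nil =>
    obtain rfl : γu = [] := by simpa using hl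
    exact ⟨1, S, fun v γ => by simp⟩
  | cons a u ih =>
    obtain ⟨g, γu, rfl⟩ := List.exists_cons_of_ne_nil (l := γu) (by rintro rfl; simp at hl)
    have hl' : γu.length = u.length := by simpa using hl
    cases a with
    | false =>
      obtain ⟨c, S', h⟩ := ih γu (g :: S) hl'
      exact ⟨c, S', fun v γ => by simpa [linkCoeff] using h v γ⟩
    | true =>
      cases S with
      | nil =>
        obtain ⟨c, S', h⟩ := ih γu [] hl'
        refine ⟨if g then c else 0, S', fun v γ => ?_⟩
        simp only [List.cons_append, linkCoeff, h]
        split_ifs <;> ring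
      | cons f S =>
        obtain ⟨c, S', h⟩ := ih γu S hl'
        refine ⟨if g = f then 0 else (if f then -((t⁻¹ : Aˣ) : A) else 1) * c, S',
          fun v γ => ?_⟩
        simp only [List.cons_append, linkCoeff, h]
        split_ifs <;> ring

/-- Either some letter `1` of `u` is the partner of a letter `2` that follows `u`, or all the
letters `1` of `u` have their partner in `u`. -/
theorem exists_partner_or (u : List Bool) :
    (∃ u' w, u = u' ++ false :: w ∧ endHeight 0 w = some 0) ∨
      ∀ γu : List Bool, γu.length = u.length → ∃ c : A, ∀ v γ,
        linkCoeff t s [] (u ++ v) (γu ++ γ) = c * linkCoeff t s [] v γ := by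
  induction hn : u.length using Nat.strong_induction_on generalizing u with
  | _ n ih =>
  rcases List.eq_nil_or_concat u with rfl | ⟨u', a, rfl⟩
  · right
    intro γu hl
    obtain rfl : γu = [] := by simp at hn; subst hn; simpa using hl
    exact ⟨1, fun v γ => by simp⟩
  · rw [List.concat_eq_append] at *
    have hn' : u'.length + 1 = n := by simpa using hn
    cases a with
    | false => exact Or.inl ⟨u', [], rfl, rfl⟩
    | true =>
      rcases ih u'.length (by omega) u' rfl with ⟨u0, w, rfl, hw⟩ | h
      · have hd : endHeight 0 (false :: w ++ [true]) = some 0 := by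
          have := endHeight_add 0 1 0 w hw
          simp only [zero_add] at this
          simp [endHeight, endHeight_append, this]
        rcases ih u0.length (by simp at hn'; omega) u0 rfl with ⟨u1, w1, rfl, hw1⟩ | h
        · left
          refine ⟨u1, w1 ++ (false :: w ++ [true]), by simp, ?_⟩
          rw [endHeight_append, hw1]
          simpa using hd
        · right
          intro γu hl
          obtain ⟨c1, h1⟩ := h (γu.take u0.length) (by simp at hl hn' ⊢; omega)
          obtain ⟨c2, h2⟩ := linkCoeff_dyck t s (false :: w ++ [true]) (γu.drop u0.length)
            (by simp at hl hn' ⊢; omega) hd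
          refine ⟨c1 * c2, fun v γ => ?_⟩
          have e : γu ++ γ = γu.take u0.length ++ (γu.drop u0.length ++ γ) := by
            rw [← List.append_assoc, List.take_append_drop]
          have e' : u0 ++ false :: w ++ [true] ++ v = u0 ++ (false :: w ++ [true] ++ v) := by simp
          rw [e, e', h1, h2, mul_assoc]
      · right
        intro γu hl
        rcases List.eq_nil_or_concat γu with rfl | ⟨γ', g, rfl⟩
        · simp at hl; omega
        rw [List.concat_eq_append] at *
        obtain ⟨c, hc⟩ := h γ' (by simp at hl; omega)
        refine ⟨if g then c else 0, fun v γ => ?_⟩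
        rw [List.append_assoc, List.append_assoc, hc]
        simp only [List.cons_append, List.nil_append, linkCoeff]
        split_ifs <;> ring

/-- The effect of the operator `T_i - t` on the coefficients of a vector, seen as a function of the
letters `i` and `i + 1`. -/
def swapLocal (φ : Bool → Bool → A) (a b : Bool) : A :=
  if a = b then 0 else if a then φ false true - (t⁻¹ : Aˣ) * φ true false
  else φ true false - t * φ false true

/-- The effect of the operator `T_N - t_N` on the coefficients of a vector, seen as a function of
the last letter. -/
def flipLocal (φ : Bool → A) (a : Bool) : A :=
  if a then φ false - (s⁻¹ : Aˣ) * φ true else φ true - s * φ false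

theorem swapLocal_const_mul (c : A) (φ : Bool → Bool → A) (a b : Bool) :
    swapLocal t (fun x y => c * φ x y) a b = c * swapLocal t φ a b := by
  unfold swapLocal; split_ifs <;> ring

theorem flipLocal_const_mul (c : A) (φ : Bool → A) (a : Bool) :
    flipLocal s (fun x => c * φ x) a = c * flipLocal s φ a := by
  unfold flipLocal; split_ifs <;> ring

theorem units_mul_inv' : (t : A) * (t⁻¹ : Aˣ) = 1 := t.mul_inv

/-- An arc joining the two letters takes values in the ratio `1 : -t⁻¹` on `12` and `21`. It closes
to a loop. -/
theorem linkCoeff_peak (S v γ : List Bool) (a b : Bool) :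
    swapLocal t (fun x y => linkCoeff t s S (false :: true :: v) (x :: y :: γ)) a b =
      -((t : A) + (t⁻¹ : Aˣ)) * linkCoeff t s S (false :: true :: v) (a :: b :: γ) := by
  have h := units_mul_inv' t
  cases a <;> cases b <;> simp [swapLocal, linkCoeff] <;>
    first | ring1 | linear_combination -(linkCoeff t s S v γ) * h

theorem rayWeight_append_false (S : List Bool) (b : Bool) :
    rayWeight t s b (S ++ [false]) = rayWeight t s b S := by
  induction S generalizing b with
  | nil => simp [rayWeight]
  | cons f S ih => simp [rayWeight, ih]

/-- An unflipped unmatched 1 has weight `1`, and the partner of an unflipped 1 must be read as 2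
with weight `1`, exactly like an unmatched 2. This covers the empty stack in `linkCoeff_valley`. -/
theorem linkCoeff_append_false (S v γ : List Bool) :
    linkCoeff t s (S ++ [false]) v γ = linkCoeff t s S v γ := by
  induction v generalizing S γ with
  | nil =>
    cases γ with
    | nil =>
      simp only [linkCoeff]
      exact rayWeight_append_false t s S false
    | cons g γ => simp [linkCoeff]
  | cons a v ih =>
    cases γ with
    | nil => cases a <;> cases S <;> simp [linkCoeff]
    | cons g γ =>
      cases a with
      | false => simpa [linkCoeff] using ih (g :: S) γ
      | true =>
        cases S with
        | nil =>
          have := ih [] γ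
          cases g <;> simp [linkCoeff]
        | cons f S => simp [linkCoeff, ih]

theorem linkCoeff_valley (S v γ : List Bool) (a b : Bool) :
    swapLocal t (fun x y => linkCoeff t s S (true :: false :: v) (x :: y :: γ)) a b =
      linkCoeff t s S (false :: true :: v) (a :: b :: γ) := by
  have h := units_mul_inv' t
  cases S with
  | nil =>
    have := linkCoeff_append_false t s [] v γ
    simp only [List.nil_append] at this
    cases a <;> cases b <;> simp [swapLocal, linkCoeff, this]
  | cons f S =>
    cases f <;> cases a <;> cases b <;> simp [swapLocal, linkCoeff]

/-- Two unmatched letters 2 must both be read as 2, while `swapLocal` only uses the values at `12`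
and `21`. -/
theorem linkCoeff_down_free (v γ : List Bool) (a b : Bool) :
    swapLocal t (fun x y => linkCoeff t s [] (true :: true :: v) (x :: y :: γ)) a b = 0 := by
  cases a <;> cases b <;> simp [swapLocal, linkCoeff]

/-- The operator puts an arc on its two letters and connects their former partners: the opening
partner of the first 2 becomes the closing end of the arc of the second one, or an unmatched 2. -/
theorem linkCoeff_down_bound (S w v γw γ : List Bool) (hw : endHeight 0 w = some 0)
    (hl : γw.length = w.length) (g a b : Bool) :
    swapLocal t (fun x y => linkCoeff t s S (false :: (w ++ true :: true :: v))
        (g :: (γw ++ x :: y :: γ))) a b =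
      linkCoeff t s S (true :: (w ++ false :: true :: v)) (g :: (γw ++ a :: b :: γ)) := by
  obtain ⟨c, hc⟩ := linkCoeff_dyck t s w γw hl hw
  have h := units_mul_inv' t
  cases S with
  | nil =>
    cases g <;> cases a <;> cases b <;> simp [swapLocal, linkCoeff, hc] <;>
      first | ring1 | linear_combination (c * linkCoeff t s [] v γ) * h
  | cons f S =>
    cases f <;> cases g <;> cases a <;> cases b <;> simp [swapLocal, linkCoeff, hc] <;>
      first | ring1 | linear_combination (c * linkCoeff t s S v γ) * h

theorem linkCoeff_up_bound (S w v γw γ : List Bool) (hw : endHeight 0 w = some 0)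
    (hl : γw.length = w.length) (g a b : Bool) :
    swapLocal t (fun x y => linkCoeff t s S (false :: false :: (w ++ true :: v))
        (x :: y :: (γw ++ g :: γ))) a b =
      linkCoeff t s S (false :: true :: (w ++ false :: v)) (a :: b :: (γw ++ g :: γ)) := by
  obtain ⟨c, hc⟩ := linkCoeff_dyck t s w γw hl hw
  have h := units_mul_inv' t
  cases g <;> cases a <;> cases b <;> simp [swapLocal, linkCoeff, hc] <;>
      first | ring1 | linear_combination (c * linkCoeff t s (false :: S) v γ) * h

/-- The weight that appears when two neighbouring unmatched letters `1` are joined. -/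
def joinWeight (n : ℕ) : A :=
  if Even n then (t : A) * (s⁻¹ : Aˣ) + (t⁻¹ : Aˣ) * s else -((s : A) + (s⁻¹ : Aˣ))

/-- The two joined letters have neighbouring ranks, hence one weight of each kind. Which comes first
depends only on the number `Y.length` of unmatched letters to their right. -/
theorem rayWeight_join (Y S : List Bool) (b : Bool) :
    rayWeight t s b (Y ++ false :: true :: S) - t * rayWeight t s b (Y ++ true :: false :: S) =
      (if xor b (decide (Even Y.length)) then joinWeight t s 0 else joinWeight t s 1) *
        rayWeight t s b (Y ++ S) := by
  have h := units_mul_inv' t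
  induction Y generalizing b with
  | nil =>
    cases b <;> simp [rayWeight, rayPar, joinWeight]
    · ring
    · linear_combination -(s : A) * rayWeight t s true S * h
  | cons f Y ih =>
    have h1 := ih (!b)
    have e : (xor (!b) (decide (Even Y.length))) = xor b (decide (Even (f :: Y).length)) := by
      simp only [List.length_cons, Nat.even_add_one, decide_not]
      cases b <;> simp
    rw [e] at h1
    simp only [List.cons_append, rayWeight] 
    linear_combination (if f then rayPar t s b else 1) * h1

theorem linkCoeff_up_free (S v γ : List Bool) (hl : γ.length = v.length) (n : ℕ)
    (hv : endHeight 0 v = some n) (a b : Bool) :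
    swapLocal t (fun x y => linkCoeff t s S (false :: false :: v) (x :: y :: γ)) a b =
      joinWeight t s n * linkCoeff t s S (false :: true :: v) (a :: b :: γ) := by
  obtain ⟨c, Y, h1, h2⟩ := linkCoeff_excursion t s v γ hl [] n hv
  have h3 := fun S => h2 S [] []
  simp only [List.append_nil, List.nil_append] at h3
  have h := units_mul_inv' t
  have key := rayWeight_join t s Y S false
  have e : (if xor false (decide (Even Y.length)) then joinWeight t s 0 else joinWeight t s 1) =
      joinWeight t s n := by
    rw [h1]
    by_cases hn : Even n <;> simp [joinWeight, hn]
  rw [e] at key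
  cases a <;> cases b <;> simp [swapLocal, linkCoeff, h3]
  · linear_combination c * key
  · linear_combination -c * (t⁻¹ : Aˣ) * key -
      c * rayWeight t s false (Y ++ true :: false :: S) * h

/-- Cutting the arc that ends at the last letter leaves two unmatched letters 1 of the ranks one and
two from the right; the weight `-t⁻¹` of the flipped arc splits as the product of the two ray
weights up to the factor `t_N`. -/
theorem linkCoeff_last_true (S : List Bool) (a : Bool) :
    flipLocal s (fun x => linkCoeff t s S [true] [x]) a = linkCoeff t s S [false] [a] := by
  have h := units_mul_inv' s
  rcases S with _ | ⟨f, S⟩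
  · cases a <;> simp [flipLocal, linkCoeff, rayWeight, rayPar]
  · cases f <;> cases a <;> simp [flipLocal, linkCoeff, rayWeight, rayPar] <;>
      first | ring1 | linear_combination -((t⁻¹ : Aˣ) * rayWeight t s false S) * h

theorem linkCoeff_last_false (S : List Bool) (a : Bool) :
    flipLocal s (fun x => linkCoeff t s S [false] [x]) a =
      -((s : A) + (s⁻¹ : Aˣ)) * linkCoeff t s S [false] [a] := by
  have h := units_mul_inv' s
  cases a <;> simp [flipLocal, linkCoeff, rayWeight, rayPar] <;>
      first | ring1 | linear_combination -(rayWeight t s true S) * h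

end


/-! ### Strings as lists of letters, and the linear forms of link patterns -/

/-- The letters of a string. -/
def letters {N : ℕ} (α : BinString N) : List Bool := List.ofFn fun k => decide (α k = 1)

/-- The string with the given letters. -/
def ofLetters (N : ℕ) (l : List Bool) : BinString N := fun k => if l.getD k false then 1 else 0

theorem length_letters {N : ℕ} (α : BinString N) : (letters α).length = N := by simp [letters]

theorem ofLetters_letters {N : ℕ} (α : BinString N) : ofLetters N (letters α) = α := by
  funext k
  have : (letters α).getD k false = decide (α k = 1) := by
    simp [letters]
  simp only [ofLetters, this]
  generalize α k = a
  fin_cases a <;> simp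

theorem letters_ofLetters {N : ℕ} (l : List Bool) (hl : l.length = N) :
    letters (ofLetters N l) = l := by
  refine List.ext_getElem (by simp [letters, hl]) fun k h1 h2 => ?_
  simp [letters, ofLetters, h2]

theorem letters_injective {N : ℕ} : Function.Injective (letters (N := N)) := fun α β h => by
  rw [← ofLetters_letters α, h, ofLetters_letters]

theorem letters_allOnes (N : ℕ) : letters (allOnes N) = List.replicate N false := by
  simp [letters, allOnes, List.ofFn_const]

theorem ofLetters_replicate (N : ℕ) : ofLetters N (List.replicate N false) = allOnes N := by
  rw [← letters_allOnes, ofLetters_letters]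

theorem getD_length_append (u v : List Bool) (a : Bool) : (u ++ a :: v).getD u.length false = a := by
  simp

theorem getD_length_append' (u v : List Bool) (a b : Bool) :
    (u ++ a :: b :: v).getD (u.length + 1) false = b := by
  simp

theorem getD_swap (u v : List Bool) (a b : Bool) (k : ℕ) (h1 : k ≠ u.length)
    (h2 : k ≠ u.length + 1) :
    (u ++ a :: b :: v).getD k false = (u ++ b :: a :: v).getD k false := by
  induction u generalizing k with
  | nil =>
    match k with
    | 0 => simp at h1
    | 1 => simp at h2
    | k + 2 => simp
  | cons c u ih =>
    match k with
    | 0 => simp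
    | k + 1 =>
      have := ih k (by simpa using h1) (by simpa using h2)
      simpa using this

theorem getD_flip (u : List Bool) (a b : Bool) (k : ℕ) (h1 : k ≠ u.length) :
    (u ++ [a]).getD k false = (u ++ [b]).getD k false := by
  induction u generalizing k with
  | nil =>
    match k with
    | 0 => simp at h1
    | k + 1 => simp
  | cons c u ih =>
    match k with
    | 0 => simp
    | k + 1 =>
      have := ih k (by simpa using h1)
      simpa using this

/-- The basis vector of the string with the given letters. -/
def basisVec (A : Type) [CommRing A] (N : ℕ) (l : List Bool) : StringModule A N :=
  Finsupp.single (ofLetters N l) 1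

section

variable {A : Type} [CommRing A] (t s : Aˣ) {N : ℕ}

/-- The operator `T_i - q_i` on `M⁺`, where `q_i` is the parameter of the node `i`. -/
def shiftOp (k : ℕ) : Module.End A (StringModule A N) :=
  if h : k < N then genOp t s ⟨k, h⟩ - (nodePar t s (⟨k, h⟩ : Fin N) : A) • 1 else 0

theorem genOp_basisVec_swap (u v : List Bool) (a b : Bool) (hl : (u ++ a :: b :: v).length = N)
    (h : u.length < N) :
    genOp t s (⟨u.length, h⟩ : Fin N) (basisVec A N (u ++ a :: b :: v)) =
      if a = b then (t : A) • basisVec A N (u ++ a :: b :: v)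
      else if a = false then basisVec A N (u ++ b :: a :: v)
      else basisVec A N (u ++ b :: a :: v) +
        ((t : A) - (t⁻¹ : Aˣ)) • basisVec A N (u ++ a :: b :: v) := by
  have h' : u.length + 1 < N := by simp at hl; omega
  have e1 : ∀ a b, ofLetters N (u ++ a :: b :: v) ⟨u.length, h⟩ = if a then 1 else 0 := by
    intro a b
    simp only [ofLetters, getD_length_append]
  have e2 : ∀ a b, ofLetters N (u ++ a :: b :: v) ⟨u.length + 1, h'⟩ = if b then 1 else 0 := by
    intro a b
    simp only [ofLetters, getD_length_append']
  rw [basisVec, genOp_adjacent t s ⟨u.length, h⟩ ⟨u.length + 1, h'⟩ rfl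
    (ofLetters N (u ++ a :: b :: v)) (ofLetters N (u ++ b :: a :: v))
    (by rw [e1, e2]) (by rw [e1, e2])
    (by
      intro k h1 h2
      simp only [ofLetters]
      rw [getD_swap u v b a k (fun e => h1 (Fin.ext e)) (fun e => h2 (Fin.ext e))])]
  rw [e1, e2]
  cases a <;> cases b <;> simp [basisVec]

theorem genOp_basisVec_flip (u : List Bool) (a : Bool) (hl : (u ++ [a]).length = N)
    (h : u.length < N) :
    genOp t s (⟨u.length, h⟩ : Fin N) (basisVec A N (u ++ [a])) =
      if a = false then basisVec A N (u ++ [true])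
      else basisVec A N (u ++ [false]) + ((s : A) - (s⁻¹ : Aˣ)) • basisVec A N (u ++ [a]) := by
  have e1 : ∀ a, ofLetters N (u ++ [a]) ⟨u.length, h⟩ = if a then 1 else 0 := by
    intro a
    simp only [ofLetters, getD_length_append]
  rw [basisVec, genOp_last t s ⟨u.length, h⟩ (by simpa using hl)
    (ofLetters N (u ++ [a])) (ofLetters N (u ++ [!a]))
    (by rw [e1, e1]; cases a <;> simp)
    (by
      intro k h1
      simp only [ofLetters]
      rw [getD_flip u (!a) a k (fun e => h1 (Fin.ext e))])]
  rw [e1]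
  cases a <;> simp [basisVec]

theorem nodePar_of_lt (k : Fin N) (h : (k : ℕ) + 1 < N) : nodePar t s k = t := by
  simp [nodePar, h]

theorem nodePar_of_eq (k : Fin N) (h : (k : ℕ) + 1 = N) : nodePar t s k = s := by
  simp [nodePar, h]

theorem shiftOp_basisVec_swap (u v : List Bool) (a b : Bool)
    (hl : (u ++ a :: b :: v).length = N) :
    shiftOp t s u.length (basisVec A N (u ++ a :: b :: v)) =
      if a = b then 0
      else if a = false then basisVec A N (u ++ b :: a :: v) -
        (t : A) • basisVec A N (u ++ a :: b :: v)
      else basisVec A N (u ++ b :: a :: v) -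
        ((t⁻¹ : Aˣ) : A) • basisVec A N (u ++ a :: b :: v) := by
  have h : u.length < N := by simp at hl; omega
  rw [shiftOp, dif_pos h, LinearMap.sub_apply, genOp_basisVec_swap t s u v a b hl h,
    nodePar_of_lt t s _ (by simp at hl ⊢; omega)]
  simp only [LinearMap.smul_apply, Module.End.one_apply]
  split_ifs <;> module

theorem shiftOp_basisVec_flip (u : List Bool) (a : Bool) (hl : (u ++ [a]).length = N) :
    shiftOp t s u.length (basisVec A N (u ++ [a])) =
      if a = false then basisVec A N (u ++ [true]) - (s : A) • basisVec A N (u ++ [a])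
      else basisVec A N (u ++ [false]) - ((s⁻¹ : Aˣ) : A) • basisVec A N (u ++ [a]) := by
  have h : u.length < N := by simp at hl; omega
  rw [shiftOp, dif_pos h, LinearMap.sub_apply, genOp_basisVec_flip t s u a hl h,
    nodePar_of_eq t s _ (by simpa using hl)]
  simp only [LinearMap.smul_apply, Module.End.one_apply]
  split_ifs <;> module

/-- The pairing of a vector with the vector of a link pattern. -/
def pairing (δ : List Bool) : StringModule A N →ₗ[A] A :=
  Finsupp.linearCombination A fun γ => linkCoeff t s [] δ (letters γ)

theorem pairing_basisVec (δ l : List Bool) (hl : l.length = N) :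
    pairing t s δ (basisVec A N l) = linkCoeff t s [] δ l := by
  simp [pairing, basisVec, letters_ofLetters l hl]

theorem linearMap_ext_basisVec {V : Type} [AddCommGroup V] [Module A V]
    {f g : StringModule A N →ₗ[A] V}
    (h : ∀ l : List Bool, l.length = N → f (basisVec A N l) = g (basisVec A N l)) : f = g := by
  refine Finsupp.lhom_ext' fun α => LinearMap.ext_ring ?_
  have := h (letters α) (length_letters α)
  rwa [basisVec, ofLetters_letters] at this

/-- `swapLocal` is the transpose of the operator on functions of two letters, so an identity of
coefficients becomes an identity of linear forms. -/
theorem pairing_shiftOp_of_swapLocal (δ δ' : List Bool) (k : ℕ) (hk : k + 1 < N) (c : A)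
    (h : ∀ u v a b, u.length = k → (u ++ a :: b :: v).length = N →
      swapLocal t (fun x y => linkCoeff t s [] δ (u ++ x :: y :: v)) a b =
        c * linkCoeff t s [] δ' (u ++ a :: b :: v)) (Z : StringModule A N) :
    pairing t s δ (shiftOp t s k Z) = c * pairing t s δ' Z := by
  suffices e : (pairing t s δ).comp (shiftOp t s k) = c • pairing (N := N) t s δ' by
    simpa using LinearMap.congr_fun e Z
  refine linearMap_ext_basisVec fun l hl => ?_
  obtain ⟨u, a, b, v, rfl, hu⟩ : ∃ u a b v, l = u ++ a :: b :: v ∧ u.length = k := by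
    refine ⟨l.take k, l[k], l[k + 1], l.drop (k + 2), ?_, by simp; omega⟩
    simp
  subst hu
  have e0 := h u v a b rfl hl
  have hl' : ∀ a b, (u ++ a :: b :: v).length = N := by intro a b; simpa using hl
  simp only [LinearMap.comp_apply, LinearMap.smul_apply, smul_eq_mul]
  rw [shiftOp_basisVec_swap t s u v a b hl, pairing_basisVec _ _ _ _ hl, ← e0]
  cases a <;> cases b <;> simp [swapLocal, pairing_basisVec _ _ _ _ (hl' _ _)]

theorem pairing_shiftOp_of_flipLocal (δ δ' : List Bool) (k : ℕ) (hk : k + 1 = N) (c : A)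
    (h : ∀ u a, u.length = k →
      flipLocal s (fun x => linkCoeff t s [] δ (u ++ [x])) a =
        c * linkCoeff t s [] δ' (u ++ [a])) (Z : StringModule A N) :
    pairing t s δ (shiftOp t s k Z) = c * pairing t s δ' Z := by
  suffices e : (pairing t s δ).comp (shiftOp t s k) = c • pairing (N := N) t s δ' by
    simpa using LinearMap.congr_fun e Z
  refine linearMap_ext_basisVec fun l hl => ?_
  obtain ⟨u, a, rfl, hu⟩ : ∃ u a, l = u ++ [a] ∧ u.length = k := by
    have h0 : l.drop (k + 1) = [] := List.drop_eq_nil_of_le (by omega)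
    have h1 : l = l.take k ++ l[k] :: l.drop (k + 1) := by simp
    rw [h0] at h1
    exact ⟨l.take k, l[k], h1, by simp; omega⟩
  subst hu
  have e0 := h u a rfl
  have hl' : ∀ a, (u ++ [a]).length = N := by intro a; simpa using hl
  simp only [LinearMap.comp_apply, LinearMap.smul_apply, smul_eq_mul]
  rw [shiftOp_basisVec_flip t s u a hl, pairing_basisVec _ _ _ _ hl, ← e0]
  cases a <;> simp [flipLocal, pairing_basisVec _ _ _ _ (hl' _)]

variable (Z : StringModule A N)

theorem swapLocal_prefix (u v v' : List Bool) (a b a' b' : Bool) (c : A)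
    (h : ∀ S γ a₀ b₀, γ.length = v.length →
      swapLocal t (fun x y => linkCoeff t s S (a :: b :: v) (x :: y :: γ)) a₀ b₀ =
        c * linkCoeff t s S (a' :: b' :: v') (a₀ :: b₀ :: γ))
    (hl : (u ++ a :: b :: v).length = N) :
    pairing t s (u ++ a :: b :: v) (shiftOp t s u.length Z) =
      c * pairing t s (u ++ a' :: b' :: v') Z := by
  refine pairing_shiftOp_of_swapLocal t s _ _ _ (by simp at hl; omega) c ?_ Z
  intro u' γ a₀ b₀ hu hl'
  obtain ⟨c', S', hp⟩ := linkCoeff_prefix t s u u' [] hu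
  simp only [hp, swapLocal_const_mul]
  rw [h S' γ a₀ b₀ (by simp at hl hl'; omega)]
  ring

theorem pairing_shiftOp_peak (u v : List Bool) (hl : (u ++ false :: true :: v).length = N) :
    pairing t s (u ++ false :: true :: v) (shiftOp t s u.length Z) =
      -((t : A) + (t⁻¹ : Aˣ)) * pairing t s (u ++ false :: true :: v) Z :=
  swapLocal_prefix t s Z u v v _ _ _ _ _
    (fun S γ a b _ => linkCoeff_peak t s S v γ a b) hl

theorem pairing_shiftOp_valley (u v : List Bool) (hl : (u ++ true :: false :: v).length = N) :
    pairing t s (u ++ true :: false :: v) (shiftOp t s u.length Z) =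
      pairing t s (u ++ false :: true :: v) Z := by
  rw [swapLocal_prefix t s Z u v v _ _ false true 1
    (fun S γ a b _ => by rw [linkCoeff_valley, one_mul]) hl, one_mul]

theorem pairing_shiftOp_up_free (u v : List Bool) (n : ℕ) (hv : endHeight 0 v = some n)
    (hl : (u ++ false :: false :: v).length = N) :
    pairing t s (u ++ false :: false :: v) (shiftOp t s u.length Z) =
      joinWeight t s n * pairing t s (u ++ false :: true :: v) Z :=
  swapLocal_prefix t s Z u v v _ _ _ _ _
    (fun S γ a b h => linkCoeff_up_free t s S v γ h n hv a b) hl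

theorem pairing_shiftOp_up_bound (u w v : List Bool) (hw : endHeight 0 w = some 0)
    (hl : (u ++ false :: false :: (w ++ true :: v)).length = N) :
    pairing t s (u ++ false :: false :: (w ++ true :: v)) (shiftOp t s u.length Z) =
      pairing t s (u ++ false :: true :: (w ++ false :: v)) Z := by
  rw [swapLocal_prefix t s Z u (w ++ true :: v) (w ++ false :: v) _ _ false true 1 ?_ hl, one_mul]
  intro S γ a b h
  obtain ⟨γw, g, γ', rfl, hlw⟩ : ∃ γw g γ', γ = γw ++ g :: γ' ∧ γw.length = w.length := by
    have h' : w.length < γ.length := by simp at h; omega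
    exact ⟨γ.take w.length, γ[w.length], γ.drop (w.length + 1), by simp, by simp; omega⟩
  rw [linkCoeff_up_bound t s S w v γw γ' hw hlw, one_mul]

theorem pairing_shiftOp_down_bound (u w v : List Bool) (hw : endHeight 0 w = some 0)
    (hl : (u ++ false :: (w ++ true :: true :: v)).length = N) :
    pairing t s (u ++ false :: (w ++ true :: true :: v)) (shiftOp t s (u.length + 1 + w.length) Z) =
      pairing t s (u ++ true :: (w ++ false :: true :: v)) Z := by
  rw [pairing_shiftOp_of_swapLocal t s _ (u ++ true :: (w ++ false :: true :: v)) _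
    (by simp at hl; omega) 1 ?_ Z, one_mul]
  intro γu γ a b hu hl'
  obtain ⟨γ1, g, γw, rfl, h1⟩ : ∃ γ1 g γw, γu = γ1 ++ g :: γw ∧ γ1.length = u.length := by
    have h' : u.length < γu.length := by omega
    exact ⟨γu.take u.length, γu[u.length], γu.drop (u.length + 1), by simp, by simp; omega⟩
  have hlw : γw.length = w.length := by simp at hu; omega
  obtain ⟨c', S', hp⟩ := linkCoeff_prefix t s u γ1 [] h1
  simp only [List.append_assoc, List.cons_append, hp, swapLocal_const_mul]
  rw [linkCoeff_down_bound t s S' w v γw γ hw hlw, one_mul]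

theorem pairing_shiftOp_down (u v : List Bool) (hl : (u ++ true :: true :: v).length = N) :
    (∃ u' w, u = u' ++ false :: w ∧ endHeight 0 w = some 0 ∧
      ∀ Z : StringModule A N, pairing t s (u ++ true :: true :: v) (shiftOp t s u.length Z) =
        pairing t s (u' ++ true :: (w ++ false :: true :: v)) Z) ∨
      ∀ Z : StringModule A N,
        pairing t s (u ++ true :: true :: v) (shiftOp t s u.length Z) = 0 := by
  rcases exists_partner_or t s u with ⟨u', w, rfl, hw⟩ | h
  · left
    refine ⟨u', w, rfl, hw, fun Z => ?_⟩
    have := pairing_shiftOp_down_bound t s Z u' w v hw (by simpa using hl)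
    simpa [add_assoc, add_comm 1] using this
  · right
    intro Z
    rw [pairing_shiftOp_of_swapLocal t s _ [] _ (by simp at hl; omega) 0 ?_ Z, zero_mul]
    intro γu γ a b hu hl'
    obtain ⟨c, hc⟩ := h γu hu
    simp only [hc, swapLocal_const_mul]
    rw [linkCoeff_down_free]
    simp

theorem pairing_shiftOp_last_true (u : List Bool) (hl : (u ++ [true]).length = N) :
    pairing t s (u ++ [true]) (shiftOp t s u.length Z) = pairing t s (u ++ [false]) Z := by
  rw [pairing_shiftOp_of_flipLocal t s _ (u ++ [false]) _ (by simpa using hl) 1 ?_ Z, one_mul]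
  intro γu a hu
  obtain ⟨c', S', hp⟩ := linkCoeff_prefix t s u γu [] hu
  simp only [hp, flipLocal_const_mul]
  rw [linkCoeff_last_true, one_mul]

theorem pairing_shiftOp_last_false (u : List Bool) (hl : (u ++ [false]).length = N) :
    pairing t s (u ++ [false]) (shiftOp t s u.length Z) =
      -((s : A) + (s⁻¹ : Aˣ)) * pairing t s (u ++ [false]) Z := by
  refine pairing_shiftOp_of_flipLocal t s _ (u ++ [false]) _ (by simpa using hl) _ ?_ Z
  intro γu a hu
  obtain ⟨c', S', hp⟩ := linkCoeff_prefix t s u γu [] hu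
  simp only [hp, flipLocal_const_mul]
  rw [linkCoeff_last_false]
  ring

end


/-! ### Area and unitriangularity -/

/-- The number of boxes between the path of a string and the path of `1…1`. -/
def area : List Bool → ℕ
  | [] => 0
  | true :: l => l.length + 1 + area l
  | false :: l => area l

theorem area_append (u v : List Bool) : area (u ++ v) = area u + u.count true * v.length + area v := by
  induction u with
  | nil => simp [area]
  | cons a u ih =>
    cases a with
    | false => simp [area, ih]
    | true => simp [area, ih]; ring

theorem area_replicate_false (n : ℕ) : area (List.replicate n false) = 0 := by
  induction n with
  | zero => rfl
  | succ n ih => simpa [List.replicate_succ, area] using ih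

section

variable {A : Type} [CommRing A] (t s : Aˣ) {N : ℕ}

theorem rayWeight_of_notMem (S : List Bool) (hS : true ∉ S) (b : Bool) :
    rayWeight t s b S = 1 := by
  induction S generalizing b with
  | nil => rfl
  | cons f S ih =>
    simp only [List.mem_cons, not_or] at hS
    cases f
    · simp [rayWeight, ih hS.2]
    · simp at hS

theorem linkCoeff_self (S δ : List Bool) (hS : true ∉ S) : linkCoeff t s S δ δ = 1 := by
  induction δ generalizing S with
  | nil => simpa [linkCoeff] using rayWeight_of_notMem t s S hS false
  | cons a δ ih =>
    cases a with
    | false => simpa [linkCoeff] using ih (false :: S) (by simpa using hS)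
    | true =>
      cases S with
      | nil => simpa [linkCoeff] using ih [] hS
      | cons f S =>
        cases f
        · simpa [linkCoeff] using ih S (by simpa using hS)
        · simp at hS

/-- A flipped open letter on the stack has already raised the area of `γ`; its partner, read as 1,
loses at most `δ.length`. The last summand pays for these pending losses. -/
theorem area_le_of_linkCoeff_ne_zero (S δ γ : List Bool) (h : linkCoeff t s S δ γ ≠ 0) :
    γ.length = δ.length ∧ area δ ≤ area γ + S.count true * δ.length := by
  induction δ generalizing S γ with
  | nil =>
    cases γ with
    | nil => simp [area]
    | cons g γ => simp [linkCoeff] at h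
  | cons a δ ih =>
    cases γ with
    | nil => cases a <;> cases S <;> simp [linkCoeff] at h
    | cons g γ =>
      cases a with
      | false =>
        obtain ⟨h1, h2⟩ := ih (g :: S) γ (by simpa [linkCoeff] using h)
        refine ⟨by simp [h1], ?_⟩
        cases g
        · simp [area] at h2 ⊢; nlinarith
        · simp [area, h1] at h2 ⊢; nlinarith
      | true =>
        cases S with
        | nil =>
          cases g
          · simp [linkCoeff] at h
          · obtain ⟨h1, h2⟩ := ih [] γ (by simpa [linkCoeff] using h)
            simp [area, h1] at h2 ⊢; omega
        | cons f S =>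
          have hg : g ≠ f := by rintro rfl; simp [linkCoeff] at h
          have h0 : linkCoeff t s S δ γ ≠ 0 := by
            intro e; simp [linkCoeff, e] at h
          obtain ⟨h1, h2⟩ := ih S γ h0
          refine ⟨by simp [h1], ?_⟩
          cases f <;> cases g <;> simp [area, h1] at h2 hg ⊢ <;> nlinarith

theorem area_lt_of_linkCoeff_ne_zero (S δ γ : List Bool) (hS : true ∉ S)
    (h : linkCoeff t s S δ γ ≠ 0) (hne : γ ≠ δ) : area δ < area γ := by
  induction δ generalizing S γ with
  | nil =>
    cases γ with
    | nil => simp at hne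
    | cons g γ => simp [linkCoeff] at h
  | cons a δ ih =>
    cases γ with
    | nil => cases a <;> cases S <;> simp [linkCoeff] at h
    | cons g γ =>
      cases a with
      | false =>
        cases g
        · exact ih (false :: S) γ (by simpa using hS) (by simpa [linkCoeff] using h)
            (by simpa using hne)
        · obtain ⟨h1, h2⟩ := area_le_of_linkCoeff_ne_zero t s (true :: S) δ γ
            (by simpa [linkCoeff] using h)
          have : S.count true = 0 := List.count_eq_zero.2 hS
          simp [area, this, h1] at h2 ⊢; omega
      | true =>
        have hlen := (area_le_of_linkCoeff_ne_zero t s S _ _ h).1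
        cases S with
        | nil =>
          cases g
          · simp [linkCoeff] at h
          · have := ih [] γ hS (by simpa [linkCoeff] using h) (by simpa using hne)
            simp [area] at hlen ⊢; omega
        | cons f S =>
          cases f
          · cases g
            · simp [linkCoeff] at h
            · have := ih S γ (by simpa using hS) (by simpa [linkCoeff] using h) (by simpa using hne)
              simp [area] at hlen ⊢; omega
          · simp at hS

theorem pairing_eq_sum (δ : List Bool) (Z : StringModule A N) :
    pairing t s δ Z = ∑ γ : BinString N, Z γ * linkCoeff t s [] δ (letters γ) := by
  rw [pairing, Finsupp.linearCombination_apply, Finsupp.sum_fintype]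
  · simp
  · simp

/-- The vectors of the link patterns separate the vectors of `M⁺`. -/
theorem eq_zero_of_pairing (Z : StringModule A N)
    (h : ∀ δ : List Bool, δ.length = N → pairing t s δ Z = 0) : Z = 0 := by
  by_contra hZ
  -- Choose `α` of maximal area in the support. All other strings in the form of `α` have larger
  -- area, so the pairing with `α` is the single coefficient `Z α`.
  obtain ⟨α, hα, hmax⟩ := Z.support.exists_max_image (fun γ => area (letters γ))
    (by simpa [Finsupp.support_nonempty_iff] using hZ)
  apply Finsupp.mem_support_iff.1 hα
  have := h (letters α) (length_letters α)
  rw [pairing_eq_sum, Finset.sum_eq_single α] at this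
  · simpa [linkCoeff_self] using this
  · intro γ _ hγ
    by_contra hne
    have h1 := area_lt_of_linkCoeff_ne_zero t s [] (letters α) (letters γ) (by simp)
      (right_ne_zero_of_mul hne) (fun e => hγ (letters_injective e))
    have h2 := hmax γ (Finsupp.mem_support_iff.2 (left_ne_zero_of_mul hne))
    omega
  · simp

/-- The operator `T_i - t` maps link patterns to multiples of link patterns with a peak at `i`. -/
theorem pairing_shiftOp_cases (δ : List Bool) (hδ : δ.length = N) (k : ℕ) (hk : k + 1 < N) :
    ∃ (c : A) (u v : List Bool), u.length = k ∧ (u ++ false :: true :: v).length = N ∧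
      (∀ Z : StringModule A N,
        pairing t s δ (shiftOp t s k Z) = c * pairing t s (u ++ false :: true :: v) Z) ∧
      (c = 0 ∨ δ = u ++ false :: true :: v ∨ δ = u ++ true :: false :: v ∨
        (∃ u' w, u = u' ++ true :: w ∧ endHeight 0 w = some 0 ∧
          δ = u' ++ false :: (w ++ true :: true :: v)) ∨
        (∃ w v', v = w ++ false :: v' ∧ endHeight 0 w = some 0 ∧
          δ = u ++ false :: false :: (w ++ true :: v')) ∨
        (endHeight 0 v ≠ none ∧ δ = u ++ false :: false :: v)) := by
  obtain ⟨u, a, b, v, rfl, rfl⟩ : ∃ u a b v, δ = u ++ a :: b :: v ∧ u.length = k := by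
    refine ⟨δ.take k, δ[k], δ[k + 1], δ.drop (k + 2), ?_, by simp; omega⟩
    simp
  have hl : ∀ a b, (u ++ a :: b :: v).length = N := by intro a b; simpa using hδ
  cases a <;> cases b
  -- For two letters 1 the question is whether the second has a partner: it has one exactly if the
  -- path of `v` falls below its start. Otherwise both are unmatched and get joined.
  · cases hv : endHeight 0 v with
    | some n =>
      exact ⟨_, u, v, rfl, hl _ _, fun Z => pairing_shiftOp_up_free t s Z u v n hv hδ,
        by simp [hv]⟩
    | none =>
      obtain ⟨w, v', rfl, hw⟩ := exists_excursion_of_endHeight_eq_none 0 v hv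
      refine ⟨1, u, w ++ false :: v', rfl, by simpa using hδ, fun Z => ?_, ?_⟩
      · rw [pairing_shiftOp_up_bound t s Z u w v' hw hδ, one_mul]
      · exact Or.inr (Or.inr (Or.inr (Or.inr (Or.inl ⟨w, v', rfl, hw, rfl⟩))))
  · exact ⟨_, u, v, rfl, hl _ _, fun Z => pairing_shiftOp_peak t s Z u v hδ, by simp⟩
  · refine ⟨1, u, v, rfl, hl _ _, fun Z => ?_, by simp⟩
    rw [pairing_shiftOp_valley t s Z u v hδ, one_mul]
  · rcases pairing_shiftOp_down t s u v hδ with ⟨u', w, rfl, hw, h⟩ | h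
    · refine ⟨1, u' ++ true :: w, v, by simp, by simpa using hδ, fun Z => ?_, ?_⟩
      · rw [h]; simp
      · exact Or.inr (Or.inr (Or.inr (Or.inl ⟨u', w, rfl, hw, by simp⟩)))
    · exact ⟨0, u, v, rfl, hl _ _, fun Z => by rw [h, zero_mul], Or.inl rfl⟩

theorem eq_of_pairing {Z Z' : StringModule A N}
    (h : ∀ δ : List Bool, δ.length = N → pairing t s δ Z = pairing t s δ Z') : Z = Z' := by
  refine sub_eq_zero.1 (eq_zero_of_pairing t s _ fun δ hδ => ?_)
  rw [map_sub, h δ hδ, sub_self]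

/-! ### Relations of the one-boundary Temperley–Lieb algebra -/

variable (Z : StringModule A N)

theorem shiftOp_shiftOp (k : ℕ) (hk : k + 1 < N) :
    shiftOp t s k (shiftOp t s k Z) = -((t : A) + (t⁻¹ : Aˣ)) • shiftOp t s k Z := by
  refine eq_of_pairing t s fun δ hδ => ?_
  obtain ⟨c, u, v, rfl, hl, h, -⟩ := pairing_shiftOp_cases t s δ hδ k hk
  rw [h, pairing_shiftOp_peak t s Z u v hl, map_smul, h, smul_eq_mul]
  ring

theorem shiftOp_shiftOp_last (k : ℕ) (hk : k + 1 = N) :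
    shiftOp t s k (shiftOp t s k Z) = -((s : A) + (s⁻¹ : Aˣ)) • shiftOp t s k Z := by
  refine eq_of_pairing t s fun δ hδ => ?_
  rcases List.eq_nil_or_concat δ with rfl | ⟨u, a, rfl⟩
  · simp at hδ; omega
  rw [List.concat_eq_append] at *
  obtain rfl : u.length = k := by simp at hδ; omega
  have hl : ∀ a, (u ++ [a]).length = N := by simpa using hδ
  rw [map_smul, smul_eq_mul]
  cases a
  · rw [pairing_shiftOp_last_false t s _ u hδ]
  · rw [pairing_shiftOp_last_true t s _ u hδ, pairing_shiftOp_last_false t s _ u (hl _),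
      pairing_shiftOp_last_true t s _ u hδ]

/-- On link patterns, the first operator creates a peak at `k`, the second moves it to `k + 1`, and
the third moves it back. -/
theorem shiftOp_succ_sandwich (k : ℕ) (hk : k + 2 < N) :
    shiftOp t s k (shiftOp t s (k + 1) (shiftOp t s k Z)) = shiftOp t s k Z := by
  refine eq_of_pairing t s fun δ hδ => ?_
  obtain ⟨c, u, v, rfl, hl, h, -⟩ := pairing_shiftOp_cases t s δ hδ k (by omega)
  rw [h, h]
  congr 1
  obtain ⟨b, v, rfl⟩ := List.exists_cons_of_ne_nil (l := v) (by rintro rfl; simp at hl; omega)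
  cases b
  · have h1 := pairing_shiftOp_valley t s (shiftOp t s u.length Z) (u ++ [false]) v
      (by simpa using hl)
    simp only [List.length_append, List.length_singleton, List.append_assoc, List.cons_append,
      List.nil_append] at h1
    rw [h1]
    exact pairing_shiftOp_up_bound t s Z u [] v rfl (by simpa using hl)
  · have h1 := pairing_shiftOp_down_bound t s (shiftOp t s u.length Z) u [] v rfl
      (by simpa using hl)
    simp only [List.nil_append, List.length_nil, add_zero] at h1
    rw [h1]
    exact pairing_shiftOp_valley t s Z u (true :: v) (by simpa using hl)

theorem shiftOp_pred_sandwich (k : ℕ) (hk : k + 2 < N) :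
    shiftOp t s (k + 1) (shiftOp t s k (shiftOp t s (k + 1) Z)) = shiftOp t s (k + 1) Z := by
  refine eq_of_pairing t s fun δ hδ => ?_
  obtain ⟨c, u, v, hu, hl, h, -⟩ := pairing_shiftOp_cases t s δ hδ (k + 1) (by omega)
  rw [h, h]
  congr 1
  rcases List.eq_nil_or_concat u with rfl | ⟨u, b, rfl⟩
  · simp at hu
  rw [List.concat_eq_append] at *
  obtain rfl : u.length = k := by simpa using hu
  simp only [List.append_assoc, List.cons_append, List.nil_append] at hl ⊢
  cases b
  · refine (pairing_shiftOp_up_bound t s _ u [] v rfl (by simpa using hl)).trans ?_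
    have h1 := pairing_shiftOp_valley t s Z (u ++ [false]) v (by simpa using hl)
    simpa using h1
  · rw [pairing_shiftOp_valley t s _ u (true :: v) (by simpa using hl)]
    have h1 := pairing_shiftOp_down_bound t s Z u [] v rfl (by simpa using hl)
    simpa using h1

/-- The operator at the last node opens the final peak into two unmatched letters 1; joining them
again costs `joinWeight` with no letter to the right. -/
theorem shiftOp_last_sandwich (k : ℕ) (hk : k + 2 = N) :
    shiftOp t s k (shiftOp t s (k + 1) (shiftOp t s k Z)) =
      ((t : A) * (s⁻¹ : Aˣ) + (t⁻¹ : Aˣ) * s) • shiftOp t s k Z := by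
  refine eq_of_pairing t s fun δ hδ => ?_
  obtain ⟨c, u, v, rfl, hl, h, -⟩ := pairing_shiftOp_cases t s δ hδ k (by omega)
  obtain rfl : v = [] := by
    rw [← List.length_eq_zero_iff]; simp at hl; omega
  rw [h, map_smul, h, smul_eq_mul]
  have h1 := pairing_shiftOp_last_true t s (shiftOp t s u.length Z) (u ++ [false])
    (by simpa using hl)
  simp only [List.length_append, List.length_singleton, List.append_assoc, List.cons_append,
    List.nil_append] at h1
  rw [h1, pairing_shiftOp_up_free t s Z u [] 0 rfl (by simpa using hl)]
  simp only [joinWeight, Even.zero, if_true]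
  ring

theorem shiftOp_comm (i j : ℕ) (h : i + 1 < j) :
    shiftOp t s i (shiftOp t s j Z) = shiftOp t s j (shiftOp t s i Z) := by
  by_cases hj : j < N
  · have hi : i < N := by omega
    have := genOp_commute t s (⟨i, hi⟩ : Fin N) ⟨j, hj⟩ h
    have := LinearMap.congr_fun this Z
    simp only [Module.End.mul_apply] at this
    simp only [shiftOp, hi, hj, dite_true, LinearMap.sub_apply, LinearMap.smul_apply,
      Module.End.one_apply, map_sub, map_smul, this]
    module
  · simp [shiftOp, hj]

end


/-! ### Deformed integers and the scalars of the factors -/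

theorem tPar_pow_val (n : ℕ) : ((tPar ^ n : LaurentRingˣ) : LaurentRing) =
    AddMonoidAlgebra.single ((n : ℤ), (0 : ℤ)) 1 := by
  induction n with
  | zero => rfl
  | succ n ih =>
    rw [pow_succ, Units.val_mul, ih]
    simp [tPar, monomialUnit, AddMonoidAlgebra.single_mul_single]

theorem tK_pow_ne_one (n : ℕ) (hn : 0 < n) : (tK : RatField) ^ n ≠ 1 := by
  intro h
  have h1 : algebraMap LaurentRing RatField (tPar ^ n : LaurentRingˣ) =
      algebraMap LaurentRing RatField 1 := by
    rw [map_one, ← h]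
    simp [tK]
  have h2 := IsFractionRing.injective LaurentRing RatField h1
  rw [tPar_pow_val, AddMonoidAlgebra.one_def] at h2
  have h3 := (Finsupp.single_eq_single_iff _ _ _ _).1
    (show Finsupp.single ((n : ℤ), (0 : ℤ)) (1 : ℂ) = Finsupp.single 0 1 from
      congrArg AddMonoidAlgebra.coeff h2)
  simp at h3
  omega

theorem tK_ne_zero : (tK : RatField) ≠ 0 := tK.ne_zero

theorem tK_sub_inv_ne_zero : (tK : RatField) - (tK : RatField)⁻¹ ≠ 0 := by
  intro h
  apply tK_pow_ne_one 2 (by norm_num)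
  have h0 := tK_ne_zero
  field_simp at h
  linear_combination h

theorem qInt_mul (p : ℕ) :
    qInt p * ((tK : RatField) - (tK : RatField)⁻¹) = (tK : RatField) ^ p - (tK : RatField)⁻¹ ^ p :=
  div_mul_cancel₀ _ tK_sub_inv_ne_zero

theorem qInt_ne_zero (p : ℕ) (hp : 0 < p) : qInt p ≠ 0 := by
  intro h
  have h1 := qInt_mul p
  rw [h, zero_mul] at h1
  apply tK_pow_ne_one (p + p) (by omega)
  have h0 : (tK : RatField)⁻¹ ^ p * (tK : RatField) ^ p = 1 := by
    rw [← mul_pow, inv_mul_cancel₀ tK_ne_zero, one_pow]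
  rw [pow_add]
  linear_combination h0 - h1 * (tK : RatField) ^ p

theorem qInt_zero : qInt 0 = 0 := by simp [qInt]

theorem qInt_one : qInt 1 = 1 := by
  simp only [qInt, pow_one]
  exact div_self tK_sub_inv_ne_zero

theorem qInt_add_two (p : ℕ) :
    qInt (p + 2) = ((tK : RatField) + (tK : RatField)⁻¹) * qInt (p + 1) - qInt p := by
  apply mul_right_cancel₀ tK_sub_inv_ne_zero
  rw [sub_mul, mul_assoc, qInt_mul, qInt_mul, qInt_mul]
  have h0 := mul_inv_cancel₀ tK_ne_zero
  generalize (tK : RatField)⁻¹ = y at *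
  linear_combination -((tK : RatField) ^ p - y ^ p) * h0

theorem qInt_succ (p : ℕ) :
    qInt (p + 1) = (tK : RatField) * qInt p + (tK : RatField)⁻¹ ^ p := by
  apply mul_right_cancel₀ tK_sub_inv_ne_zero
  rw [add_mul, mul_assoc, qInt_mul, qInt_mul]
  have h0 := mul_inv_cancel₀ tK_ne_zero
  generalize (tK : RatField)⁻¹ = y at *
  ring

/-- The sum of the parameter of the last node and of its inverse. -/
abbrev tauK : RatField := (tNK : RatField) + (tNK : RatField)⁻¹

/-- The weight of the product of three generators at the last node. -/
abbrev kappaK : RatField :=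
  (tK : RatField) * (tNK : RatField)⁻¹ + (tK : RatField)⁻¹ * (tNK : RatField)

/-- The numerator of the scalar in `T_N(p)`. -/
def lastNum (p : ℕ) : RatField :=
  qInt ((p + 1) / 2) * ((tNK : RatField) * (tK : RatField) ^ (p / 2) +
    (tNK : RatField)⁻¹ * (tK : RatField)⁻¹ ^ (p / 2))

/-- This recursion explains the scalar in `T_N(p)`: it produces the cancellations in
`shiftOp_facOp_last` and `pairing_interval_up`. The floor and the ceiling force a separate
computation for each parity. -/
theorem lastNum_add_two (p : ℕ) :
    lastNum (p + 2) = lastNum p + qInt (p + 2) * tauK - qInt (p + 1) * kappaK := by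
  have h0 := mul_inv_cancel₀ tK_ne_zero
  apply mul_right_cancel₀ tK_sub_inv_ne_zero
  unfold lastNum tauK kappaK
  rcases Nat.even_or_odd' p with ⟨m, rfl | rfl⟩
  · have e1 : (2 * m + 2) / 2 = m + 1 := by omega
    have e2 : (2 * m + 2 + 1) / 2 = m + 1 := by omega
    have e3 : 2 * m / 2 = m := by omega
    have e4 : (2 * m + 1) / 2 = m := by omega
    rw [e1, e2, e3, e4]
    have a1 := qInt_mul (m + 1)
    have a2 := qInt_mul m
    have a3 := qInt_mul (2 * m + 2)
    have a4 := qInt_mul (2 * m + 1)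
    generalize (tK : RatField)⁻¹ = y at *
    generalize (tK : RatField) = x at *
    generalize (tNK : RatField)⁻¹ = w at *
    generalize (tNK : RatField) = z at *
    linear_combination (z * x ^ (m + 1) + w * y ^ (m + 1)) * a1 - (z * x ^ m + w * y ^ m) * a2
      - (z + w) * a3 + (x * w + y * z) * a4
      + (z * (x ^ m * x ^ m - y ^ m * x ^ m) - w * (y ^ m * y ^ m - y ^ m * x ^ m)) * h0
  · have e1 : (2 * m + 1 + 2) / 2 = m + 1 := by omega
    have e2 : (2 * m + 1 + 2 + 1) / 2 = m + 2 := by omega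
    have e3 : (2 * m + 1) / 2 = m := by omega
    have e4 : (2 * m + 1 + 1) / 2 = m + 1 := by omega
    rw [e1, e2, e3, e4]
    have a1 := qInt_mul (m + 2)
    have a2 := qInt_mul (m + 1)
    have a3 := qInt_mul (2 * m + 1 + 2)
    have a4 := qInt_mul (2 * m + 1 + 1)
    generalize (tK : RatField)⁻¹ = y at *
    generalize (tK : RatField) = x at *
    generalize (tNK : RatField)⁻¹ = w at *
    generalize (tNK : RatField) = z at *
    linear_combination (z * x ^ (m + 1) + w * y ^ (m + 1)) * a1 - (z * x ^ m + w * y ^ m) * a2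
      - (z + w) * a3 + (x * w + y * z) * a4
      + (z * (x * x ^ m * x ^ m - y * y ^ m * x ^ m) - w * (y * y ^ m * y ^ m - x * y ^ m * x ^ m)) * h0

theorem lastNum_one : lastNum 1 = tauK := by simp [lastNum, qInt_one]

theorem lastNum_zero : lastNum 0 = 0 := by simp [lastNum, qInt_zero]

/-- The scalar by which the factor `T_k(p)` differs from the shifted generator. -/
def facScalar (N k p : ℕ) : RatField :=
  if k + 1 < N then qInt (p + 1) / qInt p else lastNum p / qInt p

/-- The factor `T_{k+1}(p)`, with a natural number as index. -/
def facOp {N : ℕ} (k p : ℕ) : Module.End RatField (StringModule RatField N) :=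
  if h : k < N then factorOp ⟨k, h⟩ p else 1

theorem facOp_apply {N : ℕ} (k p : ℕ) (hk : k < N) (hp : 0 < p) (Z : StringModule RatField N) :
    facOp k p Z = shiftOp tK tNK k Z + facScalar N k p • Z := by
  have hq := qInt_ne_zero p hp
  simp only [facOp, hk, dite_true, factorOp, shiftOp, facScalar]
  split_ifs with h
  · have e : qInt (p + 1) / qInt p = (tK : RatField) + (tK : RatField)⁻¹ ^ p / qInt p := by
      rw [qInt_succ]; field_simp
    rw [e, nodePar_of_lt _ _ _ (by simpa using h)]
    simp only [LinearMap.add_apply, LinearMap.sub_apply, LinearMap.smul_apply,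
      Module.End.one_apply, add_smul]
    abel
  · rw [nodePar_of_eq _ _ _ (by simp; omega)]
    simp only [LinearMap.add_apply, LinearMap.sub_apply, LinearMap.smul_apply,
      Module.End.one_apply]
    have e : lastNum p / qInt p = qInt ((p + 1) / 2) / qInt p *
        ((tNK : RatField) * (tK : RatField) ^ (p / 2) +
          (tNK : RatField)⁻¹ * (tK : RatField)⁻¹ ^ (p / 2)) := by
      unfold lastNum; ring
    rw [e]

/-- No condition on `k` or `p` is needed here. Commutation, supports and leading terms use only this
shape; for `k ≥ N` the conventions `facOp = 1` and `shiftOp = 0` agree with it, with `c = 1`. -/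
theorem exists_facOp_eq {N : ℕ} (k p : ℕ) : ∃ c : RatField,
    ∀ Z : StringModule RatField N, facOp k p Z = shiftOp tK tNK k Z + c • Z := by
  by_cases hk : k < N
  · simp only [facOp, hk, dite_true, factorOp, shiftOp]
    split_ifs with h
    · refine ⟨(tK : RatField) + (tK : RatField)⁻¹ ^ p / qInt p, fun Z => ?_⟩
      rw [nodePar_of_lt _ _ _ (by simpa using h)]
      simp only [LinearMap.add_apply, LinearMap.sub_apply, LinearMap.smul_apply,
        Module.End.one_apply, add_smul]
      abel
    · refine ⟨qInt ((p + 1) / 2) / qInt p *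
        ((tNK : RatField) * (tK : RatField) ^ (p / 2) +
          (tNK : RatField)⁻¹ * (tK : RatField)⁻¹ ^ (p / 2)), fun Z => ?_⟩
      rw [nodePar_of_eq _ _ _ (by simp; omega)]
      simp only [LinearMap.add_apply, LinearMap.sub_apply, LinearMap.smul_apply,
        Module.End.one_apply]
  · refine ⟨1, fun Z => ?_⟩
    simp [facOp, shiftOp, hk]

/-- Two nodes that are not neighbours. -/
abbrev Far (i j : ℕ) : Prop := i + 1 < j ∨ j + 1 < i

/-! ### Annihilation by products of one, two and three factors -/

section

variable {N : ℕ} (Z : StringModule RatField N)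

theorem shiftOp_comm_of_far (i j : ℕ) (h : Far i j) :
    shiftOp tK tNK i (shiftOp tK tNK j Z) = shiftOp tK tNK j (shiftOp tK tNK i Z) := by
  rcases h with h | h
  · exact shiftOp_comm _ _ _ _ _ h
  · exact (shiftOp_comm _ _ _ _ _ h).symm

theorem shiftOp_facOp_comm (i j p : ℕ) (h : Far i j) :
    shiftOp tK tNK i (facOp j p Z) = facOp j p (shiftOp tK tNK i Z) := by
  obtain ⟨c, hc⟩ := exists_facOp_eq (N := N) j p
  rw [hc, hc, map_add, map_smul, shiftOp_comm_of_far Z i j h]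

theorem facOp_comm (i j p q : ℕ) (h : Far i j) :
    facOp i p (facOp j q Z) = facOp j q (facOp i p Z) := by
  obtain ⟨c, hc⟩ := exists_facOp_eq (N := N) i p
  rw [hc, hc, map_add, map_smul, shiftOp_facOp_comm Z i j q h]

theorem shiftOp_facOp_one (k : ℕ) (hk : k + 1 < N) :
    shiftOp tK tNK k (facOp k 1 Z) = 0 := by
  rw [facOp_apply k 1 (by omega) one_pos, map_add, map_smul, shiftOp_shiftOp _ _ _ k hk]
  have e : facScalar N k 1 = (tK : RatField) + ((tK⁻¹ : RatFieldˣ) : RatField) := by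
    have := qInt_add_two 0
    simp only [qInt_one, qInt_zero, zero_add] at this
    simp [facScalar, hk, qInt_one, this]
  rw [e, ← add_smul, neg_add_cancel, zero_smul]

/-- With `a = [p+1]/[p]` and `b = [p+2]/[p+1]`, the Temperley–Lieb relations reduce this to `1 - a
(t + t⁻¹) + a b = 0`, which is the recursion of the deformed integers. It is why contents grow by
one along a row. -/
theorem shiftOp_facOp_facOp (i j p : ℕ) (hp : 0 < p) (hi : i + 1 < N) (hj : j + 1 < N)
    (hij : j = i + 1 ∨ i = j + 1) (h : shiftOp tK tNK j Z = 0) :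
    shiftOp tK tNK i (facOp j p (facOp i (p + 1) Z)) = 0 := by
  have hs : shiftOp tK tNK i (shiftOp tK tNK j (shiftOp tK tNK i Z)) = shiftOp tK tNK i Z := by
    rcases hij with rfl | rfl
    · exact shiftOp_succ_sandwich _ _ _ i (by omega)
    · exact shiftOp_pred_sandwich _ _ _ j (by omega)
  rw [facOp_apply i (p + 1) (by omega) (by omega), facOp_apply j p (by omega) hp]
  simp only [map_add, map_smul, h, smul_zero, add_zero, hs, shiftOp_shiftOp _ _ _ i hi, smul_add,
    smul_smul, ← add_smul]
  have e : (1 + facScalar N j p * -((tK : RatField) + ((tK⁻¹ : RatFieldˣ) : RatField)) +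
      facScalar N j p * facScalar N i (p + 1)) = 0 := by
    have := qInt_add_two p
    have h1 := qInt_ne_zero p hp
    have h2 := qInt_ne_zero (p + 1) (by omega)
    simp only [facScalar, hi, hj, if_true, Units.val_inv_eq_inv_val, this]
    field_simp
    ring
  nth_rw 1 [← one_smul RatField (shiftOp tK tNK i Z)]
  rw [← add_smul, ← add_assoc, e, zero_smul]

/-- The boundary counterpart of `shiftOp_facOp_facOp`. Since `E_k Z = 0`, every term is a multiple
of `E_k E_{k+1} Z`, and the total scalar vanishes by the recursions of `qInt` and `lastNum`. -/
theorem shiftOp_facOp_last (k q : ℕ) (hq : 0 < q) (hk : k + 2 = N)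
    (h : shiftOp tK tNK k Z = 0) :
    shiftOp tK tNK k (facOp (k + 1) q (facOp k (q + 1) (facOp (k + 1) (q + 2) Z))) = 0 := by
  have hs := shiftOp_last_sandwich tK tNK (shiftOp tK tNK (k + 1) Z) k hk
  rw [facOp_apply (k + 1) (q + 2) (by omega) (by omega), facOp_apply k (q + 1) (by omega) (by omega),
    facOp_apply (k + 1) q (by omega) hq]
  simp only [map_add, map_smul, h, smul_zero, add_zero, hs,
    shiftOp_shiftOp _ _ _ k (show k + 1 < N by omega),
    shiftOp_shiftOp_last _ _ _ (k + 1) (show k + 1 + 1 = N by omega), smul_add]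
  have h1 := qInt_ne_zero q hq
  have h2 := qInt_ne_zero (q + 1) (by omega)
  have h3 := qInt_ne_zero (q + 2) (by omega)
  have e : kappaK - facScalar N k (q + 1) * tauK +
      facScalar N k (q + 1) * facScalar N (k + 1) (q + 2) +
      facScalar N (k + 1) q * (facScalar N k (q + 1) - ((tK : RatField) + (tK : RatField)⁻¹)) = 0 := by
    have h4 := qInt_add_two q
    have h5 := lastNum_add_two q
    have e1 : facScalar N k (q + 1) = qInt (q + 2) / qInt (q + 1) := by
      simp [facScalar, show k + 1 < N by omega]
    have e2 : ∀ p, facScalar N (k + 1) p = lastNum p / qInt p := by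
      simp [facScalar, show ¬ k + 1 + 1 < N by omega]
    rw [e1, e2, e2, h5]
    have h6 : qInt (q + 2) / qInt (q + 1) - ((tK : RatField) + (tK : RatField)⁻¹) =
        - qInt q / qInt (q + 1) := by
      rw [h4]; field_simp; ring
    rw [h6]
    generalize kappaK = κ
    field_simp
    ring
  generalize shiftOp tK tNK k (shiftOp tK tNK (k + 1) Z) = V
  simp only [smul_smul, ← add_smul]
  rw [← zero_smul RatField V]
  congr 1
  rw [← e, Units.val_inv_eq_inv_val, Units.val_inv_eq_inv_val]
  unfold kappaK tauK
  ring

end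

/-! ### Products of factors -/

/-- The action of a product of factors `T_k(p)`, given as a list of pairs `(k, p)`. -/
def act {N : ℕ} (L : List (ℕ × ℕ)) (Z : StringModule RatField N) : StringModule RatField N :=
  L.foldr (fun b Z => facOp b.1 b.2 Z) Z

/-- The factors with contents `ps` at consecutive nodes, starting at `k`. -/
def row (k : ℕ) : List ℕ → List (ℕ × ℕ)
  | [] => []
  | p :: ps => (k, p) :: row (k + 1) ps

section

variable {N : ℕ} (Z : StringModule RatField N)

@[simp] theorem act_nil : act [] Z = Z := rfl

@[simp] theorem act_cons (b : ℕ × ℕ) (L : List (ℕ × ℕ)) :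
    act (b :: L) Z = facOp b.1 b.2 (act L Z) := rfl

theorem act_append (L M : List (ℕ × ℕ)) : act (L ++ M) Z = act L (act M Z) := by
  simp [act, List.foldr_append]

theorem facOp_act_comm (k p : ℕ) (L : List (ℕ × ℕ)) (h : ∀ b ∈ L, Far k b.1) :
    facOp k p (act L Z) = act L (facOp k p Z) := by
  induction L with
  | nil => rfl
  | cons b L ih =>
    rw [act_cons, act_cons, facOp_comm _ _ _ _ _ (h b (by simp)),
      ih fun b hb => h b (by simp [hb])]

theorem act_comm (L M : List (ℕ × ℕ)) (h : ∀ a ∈ L, ∀ b ∈ M, Far a.1 b.1) :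
    act L (act M Z) = act M (act L Z) := by
  induction L with
  | nil => rfl
  | cons a L ih =>
    rw [act_cons, act_cons, ih fun a ha => h a (by simp [ha]),
      facOp_act_comm _ _ _ _ (h a (by simp))]

theorem shiftOp_act_comm (k : ℕ) (L : List (ℕ × ℕ)) (h : ∀ b ∈ L, Far k b.1) :
    shiftOp tK tNK k (act L Z) = act L (shiftOp tK tNK k Z) := by
  induction L with
  | nil => rfl
  | cons b L ih =>
    rw [act_cons, act_cons, shiftOp_facOp_comm _ _ _ _ (h b (by simp)),
      ih fun b hb => h b (by simp [hb])]

theorem act_zero (L : List (ℕ × ℕ)) : act L (0 : StringModule RatField N) = 0 := by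
  induction L with
  | nil => rfl
  | cons b L ih => rw [act_cons, ih, map_zero]

theorem shiftOp_act_eq_zero (k : ℕ) (L : List (ℕ × ℕ)) (h : ∀ b ∈ L, Far k b.1)
    (hZ : shiftOp tK tNK k Z = 0) : shiftOp tK tNK k (act L Z) = 0 := by
  rw [shiftOp_act_comm _ _ _ h, hZ, act_zero]

theorem mem_row (k : ℕ) (ps : List ℕ) (b : ℕ × ℕ) (h : b ∈ row k ps) :
    k ≤ b.1 ∧ b.1 < k + ps.length := by
  induction ps generalizing k with
  | nil => simp [row] at h
  | cons p ps ih =>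
    simp only [row, List.mem_cons] at h
    rcases h with rfl | h
    · simp
    · have := ih _ h
      simp only [List.length_cons]
      omega

theorem row_append (k : ℕ) (ps qs : List ℕ) :
    row k (ps ++ qs) = row k ps ++ row (k + ps.length) qs := by
  induction ps generalizing k with
  | nil => simp [row]
  | cons p ps ih => simp [row, ih, Nat.add_assoc, Nat.add_comm 1]

/-- Consecutive nodes with consecutive contents. -/
def interval (k p n : ℕ) : List (ℕ × ℕ) := row k (List.range' p n)

theorem mem_interval (k p n : ℕ) (b : ℕ × ℕ) (h : b ∈ interval k p n) :
    k ≤ b.1 ∧ b.1 < k + n := by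
  simpa using mem_row _ _ _ h

theorem interval_succ (k p n : ℕ) :
    interval k p (n + 1) = (k, p) :: interval (k + 1) (p + 1) n := by
  simp [interval, List.range'_succ, row]

theorem interval_zero (k p : ℕ) : interval k p 0 = [] := rfl

theorem interval_add (k p m n : ℕ) :
    interval k p (m + n) = interval k p m ++ interval (k + m) (p + m) n := by
  unfold interval
  rw [← List.range'_append_1, row_append]
  simp

/-- After an interval of factors, the nodes of the interval other than the first one vanish. -/
theorem shiftOp_interval (k p n i : ℕ) (hp : 0 < p) (hi : k < i) (hin : i < k + n) (hN : i + 1 < N)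
    (h : shiftOp tK tNK (i - 1) Z = 0) : shiftOp tK tNK i (act (interval k p n) Z) = 0 := by
  obtain ⟨m, rfl⟩ : ∃ m, i = k + m + 1 := ⟨i - k - 1, by omega⟩
  obtain ⟨r, rfl⟩ : ∃ r, n = m + (r + 1 + 1) := ⟨n - m - 2, by omega⟩
  -- The factors left of node `i - 1` commute with `E_i`, those right of node `i` commute with
  -- `E_{i-1}`; the two factors in the middle have consecutive contents.
  rw [interval_add, interval_succ, interval_succ, act_append, act_cons, act_cons]
  refine shiftOp_act_eq_zero _ _ _ (fun b hb => ?_) ?_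
  · have := mem_interval _ _ _ _ hb; right; omega
  · refine shiftOp_facOp_facOp _ _ _ _ (by omega) hN (by omega) (by omega) ?_
    refine shiftOp_act_eq_zero _ _ _ (fun b hb => ?_) (by simpa using h)
    have := mem_interval _ _ _ _ hb; left; omega

/-- `E_k` is killed by the leading factors of the two rows provided that `E_{k+1}` kills the rest,
which is the same statement one node further right. The chain ends at the node `k + n`. -/
theorem shiftOp_two_intervals (k p n : ℕ) (hp : 0 < p) (hN : k + n + 1 < N)
    (h : shiftOp tK tNK (k + n) Z = 0) :
    shiftOp tK tNK k (act (interval (k + 1) p n) (act (interval k (p + 1) n) Z)) = 0 := by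
  induction n generalizing k p with
  | zero => simpa [interval_zero] using h
  | succ n ih =>
    rw [interval_succ, interval_succ, act_cons, act_cons,
      ← facOp_act_comm _ _ _ _ (fun b hb => by
        have := mem_interval _ _ _ _ hb; left; simp only; omega)]
    refine shiftOp_facOp_facOp _ _ _ _ hp (by omega) (by omega) (by omega) ?_
    exact ih (k + 1) (p + 1) (by omega) (by omega) (by rw [← h]; congr 2; omega)

/-- Both rows now reach the last node, so the chain ends with three factors and
`shiftOp_facOp_last`. -/
theorem shiftOp_two_intervals_last (k p n : ℕ) (hp : 0 < p) (hN : k + n + 2 = N)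
    (h : shiftOp tK tNK (k + n) Z = 0) :
    shiftOp tK tNK k (act (interval (k + 1) p (n + 1)) (act (interval k (p + 1) (n + 2)) Z)) = 0 := by
  induction n generalizing k p with
  | zero =>
    simp only [interval_succ, interval_zero, act_cons, act_nil]
    exact shiftOp_facOp_last _ _ _ hp (by omega) (by simpa using h)
  | succ n ih =>
    rw [interval_succ, interval_succ _ _ (n + 2), act_cons, act_cons,
      ← facOp_act_comm _ _ _ _ (fun b hb => by
        have := mem_interval _ _ _ _ hb; left; simp only; omega)]
    refine shiftOp_facOp_facOp _ _ _ _ hp (by omega) (by omega) (by omega) ?_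
    exact ih (k + 1) (p + 1) (by omega) (by omega) (by rw [← h]; congr 2; omega)

/-- The factors that move `b` letters `2` to the left over `c` letters `1`. -/
def block (k c : ℕ) : ℕ → List (ℕ × ℕ)
  | 0 => []
  | b + 1 => block (k + 1) c b ++ interval k (b + 1) c

/-- The factors that create `b` letters `2` in front of `c` final letters `1`. -/
def finalBlock (k c : ℕ) : ℕ → List (ℕ × ℕ)
  | 0 => []
  | b + 1 => finalBlock (k + 1) c b ++ interval k (b + 1) (c + b + 1)

theorem mem_block (k c b : ℕ) (x : ℕ × ℕ) (h : x ∈ block k c b) :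
    k ≤ x.1 ∧ x.1 + 1 < k + b + c := by
  induction b generalizing k with
  | zero => simp [block] at h
  | succ b ih =>
    simp only [block, List.mem_append] at h
    rcases h with h | h
    · have := ih _ h; omega
    · have := mem_interval _ _ _ _ h; omega

theorem mem_finalBlock (k c b : ℕ) (x : ℕ × ℕ) (h : x ∈ finalBlock k c b) :
    k ≤ x.1 ∧ x.1 < k + b + c := by
  induction b generalizing k with
  | zero => simp [finalBlock] at h
  | succ b ih =>
    simp only [finalBlock, List.mem_append] at h
    rcases h with h | h
    · have := ih _ h; omega
    · have := mem_interval _ _ _ _ h; omega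

/-- The excepted node is the junction of `1^c` and `2^b`, the only `12` in the block before the
move. The node `k` is handled by the content `1` of a single row or by two adjacent rows, the other
nodes by the smaller block. -/
theorem shiftOp_block (k b c i : ℕ) (hb : 0 < b) (hc : 0 < c) (hN : k + b + c ≤ N)
    (hi : k ≤ i) (hi' : i + 1 < k + b + c)
    (h : ∀ j, k ≤ j → j + 1 < k + b + c → j + 1 ≠ k + c → shiftOp tK tNK j Z = 0) :
    shiftOp tK tNK i (act (block k c b) Z) = 0 := by
  induction b generalizing k Z with
  | zero => omega
  | succ b ih =>
    simp only [block, act_append]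
    -- Once the first row has acted, the hypothesis holds for the smaller block, whose junction is
    -- one node further right.
    have hW : ∀ j, k + 1 ≤ j → j + 1 < k + 1 + b + c → j + 1 ≠ k + 1 + c →
        shiftOp tK tNK j (act (interval k (b + 1) c) Z) = 0 := by
      intro j h1 h2 h3
      by_cases hj : j < k + c
      · exact shiftOp_interval _ _ _ _ _ (by omega) (by omega) hj (by omega)
          (h _ (by omega) (by omega) (by omega))
      · refine shiftOp_act_eq_zero _ _ _ (fun x hx => ?_) (h _ (by omega) (by omega) (by omega))
        have := mem_interval _ _ _ _ hx; right; omega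
    rcases Nat.eq_zero_or_pos b with rfl | hb'
    · simp only [block, act_nil]
      rcases Nat.eq_or_lt_of_le hi with rfl | hlt
      · obtain ⟨c, rfl⟩ : ∃ d, c = d + 1 := ⟨c - 1, by omega⟩
        rw [interval_succ, act_cons]
        exact shiftOp_facOp_one _ _ (by omega)
      · exact hW i (by omega) (by omega) (by omega)
    rcases Nat.eq_or_lt_of_le hi with rfl | hlt
    · obtain ⟨b, rfl⟩ : ∃ d, b = d + 1 := ⟨b - 1, by omega⟩
      simp only [block, act_append]
      refine shiftOp_act_eq_zero _ _ _ (fun x hx => ?_) ?_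
      · have := mem_block _ _ _ _ hx; left; omega
      · exact shiftOp_two_intervals _ _ _ _ (by omega) (by omega)
          (h _ (by omega) (by omega) (by omega))
    · exact ih _ (k + 1) hb' (by omega) (by omega) (by omega) hW

theorem shiftOp_finalBlock (k b c i : ℕ) (hb : 0 < b) (hN : k + b + c = N)
    (hi : k ≤ i) (hi' : i + 1 < N)
    (h : ∀ j, k ≤ j → j + 1 < N → shiftOp tK tNK j Z = 0) :
    shiftOp tK tNK i (act (finalBlock k c b) Z) = 0 := by
  induction b generalizing k Z with
  | zero => omega
  | succ b ih =>
    simp only [finalBlock, act_append]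
    have hW : ∀ j, k + 1 ≤ j → j + 1 < N →
        shiftOp tK tNK j (act (interval k (b + 1) (c + b + 1)) Z) = 0 := by
      intro j h1 h2
      exact shiftOp_interval _ _ _ _ _ (by omega) (by omega) (by omega) (by omega)
        (h _ (by omega) (by omega))
    rcases Nat.eq_zero_or_pos b with rfl | hb'
    · simp only [finalBlock, act_nil]
      rcases Nat.eq_or_lt_of_le hi with rfl | hlt
      · rw [interval_succ, act_cons]
        exact shiftOp_facOp_one _ _ (by omega)
      · exact hW i (by omega) (by omega)
    rcases Nat.eq_or_lt_of_le hi with rfl | hlt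
    · obtain ⟨b, rfl⟩ : ∃ d, b = d + 1 := ⟨b - 1, by omega⟩
      simp only [finalBlock, act_append]
      refine shiftOp_act_eq_zero _ _ _ (fun x hx => ?_) ?_
      · have := mem_finalBlock _ _ _ _ hx; left; omega
      · exact shiftOp_two_intervals_last _ _ _ _ (by omega) (by omega)
          (h _ (by omega) (by omega))
    · exact ih _ (k + 1) hb' (by omega) (by omega) hW

end


/-! ### Contents of boxes -/

/-- The contents of a row of boxes, given those of the next row. -/
def scan : ℕ → List ℕ → List ℕ
  | acc, [] => [acc + 1]
  | acc, x :: xs => (max acc x + 1) :: scan (max acc x + 1) xs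

/-- The contents of the first row of boxes of a string, with `0` at the empty places. -/
def rho : List Bool → List ℕ
  | [] => []
  | false :: a => 0 :: rho a
  | true :: a => scan 0 (rho a)

/-- The boxes of a string whose first letter has the number `s`, each given by its node and its
content, in the order of the factors of the product. -/
def boxes : ℕ → List Bool → List (ℕ × ℕ)
  | _, [] => []
  | s, false :: a => boxes (s + 1) a
  | s, true :: a => boxes (s + 1) a ++ row s (rho (true :: a))

theorem length_scan (acc : ℕ) (xs : List ℕ) : (scan acc xs).length = xs.length + 1 := by
  induction xs generalizing acc with
  | nil => rfl
  | cons x xs ih => simp [scan, ih]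

theorem length_rho (a : List Bool) : (rho a).length = a.length := by
  induction a with
  | nil => rfl
  | cons x a ih => cases x <;> simp [rho, length_scan, ih]

theorem le_of_mem_boxes (s : ℕ) (a : List Bool) (b : ℕ × ℕ) (h : b ∈ boxes s a) :
    s ≤ b.1 ∧ b.1 < s + a.length := by
  induction a generalizing s with
  | nil => simp [boxes] at h
  | cons x a ih =>
    cases x with
    | false => have := ih _ h; simp only [List.length_cons]; omega
    | true =>
      simp only [boxes, List.mem_append] at h
      rcases h with h | h
      · have := ih _ h; simp only [List.length_cons]; omega
      · simpa [length_rho] using mem_row _ _ _ h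

theorem boxes_replicate_false (s n : ℕ) (a : List Bool) :
    boxes s (List.replicate n false ++ a) = boxes (s + n) a := by
  induction n generalizing s with
  | zero => rfl
  | succ n ih =>
    rw [List.replicate_succ, List.cons_append, boxes, ih]
    congr 1; omega

theorem rho_replicate_false (n : ℕ) (a : List Bool) :
    rho (List.replicate n false ++ a) = List.replicate n 0 ++ rho a := by
  induction n with
  | zero => rfl
  | succ n ih => rw [List.replicate_succ, List.cons_append, rho, ih]; rfl

theorem scan_replicate (acc n : ℕ) (X : List ℕ) :
    scan acc (List.replicate n 0 ++ X) = List.range' (acc + 1) n ++ scan (acc + n) X := by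
  induction n generalizing acc with
  | zero => rfl
  | succ n ih =>
    rw [List.replicate_succ, List.cons_append, scan, Nat.max_zero, ih, List.range'_succ,
      Nat.add_right_comm acc 1 n]
    rfl

theorem scan_range'_of_le (acc p n : ℕ) (X : List ℕ) (h : p ≤ acc) :
    scan acc (List.range' p n ++ X) = List.range' (acc + 1) n ++ scan (acc + n) X := by
  induction n generalizing acc p with
  | zero => rfl
  | succ n ih =>
    rw [List.range'_succ, List.cons_append, scan, max_eq_left h, ih _ _ (by omega),
      List.range'_succ, Nat.add_right_comm acc 1 n]
    rfl

theorem scan_range'_of_ge (acc p n : ℕ) (X : List ℕ) (h : acc ≤ p) :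
    scan acc (List.range' p (n + 1) ++ X) =
      List.range' (p + 1) (n + 1) ++ scan (p + (n + 1)) X := by
  rw [List.range'_succ, List.cons_append, scan, max_eq_right h,
    scan_range'_of_le _ _ _ _ le_rfl, List.range'_succ, Nat.add_right_comm p 1 n]
  rfl

/-- The first entry of a list is at least `a`. -/
def HeadGE (a : ℕ) (X : List ℕ) : Prop := ∃ x xs, X = x :: xs ∧ a ≤ x

/-- A large head makes a row independent of what precedes it; this is how a block decouples from the
boxes to its right. -/
theorem HeadGE.scan_eq {a : ℕ} {X : List ℕ} (h : HeadGE a X) : scan a X = scan 0 X := by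
  obtain ⟨x, xs, rfl, h⟩ := h
  simp [scan, max_eq_right h]

theorem HeadGE.scan {a : ℕ} {X : List ℕ} (h : HeadGE a X) (acc : ℕ) :
    HeadGE (a + 1) (scan acc X) := by
  obtain ⟨x, xs, rfl, h⟩ := h
  exact ⟨_, _, rfl, by omega⟩

theorem headGE_rho_replicate (b : ℕ) (a : List Bool) :
    HeadGE (b + 1) (rho (List.replicate (b + 1) true ++ a)) := by
  induction b with
  | zero =>
    show HeadGE 1 (KLFactor.scan 0 (rho a))
    cases rho a with
    | nil => exact ⟨_, _, rfl, by omega⟩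
    | cons x xs => exact ⟨_, _, rfl, by omega⟩
  | succ b ih => exact ih.scan 0

theorem headGE_rho_append (b c : ℕ) (a : List Bool) (h : HeadGE c (rho a)) :
    HeadGE (c + b) (rho (List.replicate b true ++ a)) := by
  induction b with
  | zero => exact h
  | succ b ih => exact ih.scan 0

/-- The contents over `1^c` increase to `b + c`, and the next content below is already that large by
`hypothesis h`, so the row continues as if the letters `1^c` were absent. -/
theorem rho_block (b c : ℕ) (hc : 0 < c) (a : List Bool) (h : HeadGE c (rho a)) :
    rho (List.replicate (b + 1) true ++ (List.replicate c false ++ a)) =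
      List.range' (b + 1) c ++ rho (List.replicate (b + 1) true ++ a) := by
  induction b with
  | zero =>
    show KLFactor.scan 0 (rho (List.replicate c false ++ a)) = _ ++ KLFactor.scan 0 (rho a)
    rw [rho_replicate_false, scan_replicate, zero_add, zero_add, h.scan_eq]
  | succ b ih =>
    rw [List.replicate_succ, List.cons_append, rho, ih]
    obtain ⟨d, rfl⟩ : ∃ d, c = d + 1 := ⟨c - 1, by omega⟩
    rw [scan_range'_of_ge _ _ _ _ (Nat.zero_le _)]
    congr 1
    have := headGE_rho_append (b + 1) _ a h
    rw [Nat.add_comm (b + 1), this.scan_eq]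
    rfl

theorem rho_finalBlock (b c : ℕ) :
    rho (List.replicate (b + 1) true ++ List.replicate c false) =
      List.range' (b + 1) (c + b + 1) := by
  have e0 : ∀ p n, List.range' p n ++ [p + n] = List.range' p (n + 1) := by
    intro p n; rw [List.range'_concat]; simp
  induction b with
  | zero =>
    show KLFactor.scan 0 (rho (List.replicate c false)) = _
    have := rho_replicate_false c []
    rw [List.append_nil] at this
    rw [this, scan_replicate]
    show List.range' 1 c ++ [0 + c + 1] = _
    rw [show 0 + c + 1 = 1 + c by omega, e0]
  | succ b ih =>
    rw [List.replicate_succ, List.cons_append, rho, ih]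
    have := scan_range'_of_ge 0 (b + 1) (c + b) [] (Nat.zero_le _)
    rw [List.append_nil] at this
    rw [this]
    show List.range' _ _ ++ [b + 1 + (c + b + 1) + 1] = _
    rw [show b + 1 + (c + b + 1) + 1 = b + 1 + 1 + (c + b + 1) by omega, e0]
    rfl

/-! ### Peeling off a block of boxes -/

/-- Strings whose first rows have the same influence on the preceding rows. -/
def SameScan (A B : List Bool) : Prop := ∀ acc, scan acc (rho A) = scan acc (rho B)

theorem SameScan.cons {A B : List Bool} (h : SameScan A B) (x : Bool) :
    SameScan (x :: A) (x :: B) := by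
  intro acc
  cases x with
  | false => simp only [rho, scan, h (max acc 0 + 1)]
  | true => simp only [rho, h 0]

theorem SameScan.append {A B : List Bool} (h : SameScan A B) (η : List Bool) :
    SameScan (η ++ A) (η ++ B) := by
  induction η with
  | nil => exact h
  | cons x η ih => exact ih.cons x

theorem SameScan.boxes {A B : List Bool} (h : SameScan A B) (s : ℕ) (η : List Bool) :
    ∃ L, boxes s (η ++ A) = boxes (s + η.length) A ++ L ∧
      boxes s (η ++ B) = boxes (s + η.length) B ++ L := by
  induction η generalizing s with
  | nil => exact ⟨[], by simp, by simp⟩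
  | cons x η ih =>
    obtain ⟨L, h1, h2⟩ := ih (s + 1)
    have e : s + 1 + η.length = s + (x :: η).length := by simp; omega
    rw [e] at h1 h2
    cases x with
    | false => exact ⟨L, h1, h2⟩
    | true =>
      refine ⟨L ++ row s (KLFactor.scan 0 (rho (η ++ A))), ?_, ?_⟩
      · rw [List.cons_append, KLFactor.boxes, h1, List.append_assoc]; rfl
      · rw [List.cons_append, KLFactor.boxes, h2, List.append_assoc, (h.append η) 0]; rfl

/-- After `b` letters 1 the running content is at least `b ≥ p`, so contents `p, p + 1, …` in the
next row never win the maximum and have the same effect as empty places. -/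
theorem sameScan_of_rho (b n : ℕ) (A B : List Bool) (R : List ℕ) (p : ℕ) (hp : p ≤ b)
    (hA : rho A = List.range' p n ++ R) (hB : rho B = List.replicate n 0 ++ R) :
    SameScan (List.replicate b false ++ A) (List.replicate b false ++ B) := by
  intro acc
  rw [rho_replicate_false, rho_replicate_false, hA, hB, scan_replicate, scan_replicate,
    scan_range'_of_le _ _ _ _ (by omega), scan_replicate]

/-- The condition on the part of a string in front of a block of `b` letters `2`. -/
def GoodPrefix (b : ℕ) (σ : List Bool) : Prop :=
  (∃ a, σ = List.replicate a false) ∨ ∃ σ', σ = σ' ++ List.replicate b false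

theorem GoodPrefix.exists_boxes {b : ℕ} {σ : List Bool} (h : GoodPrefix b σ) {A B : List Bool}
    (hs : SameScan (List.replicate b false ++ A) (List.replicate b false ++ B)) :
    ∃ L, boxes 0 (σ ++ A) = boxes σ.length A ++ L ∧ boxes 0 (σ ++ B) = boxes σ.length B ++ L := by
  rcases h with ⟨a, rfl⟩ | ⟨σ', rfl⟩
  · exact ⟨[], by simp [boxes_replicate_false], by simp [boxes_replicate_false]⟩
  · obtain ⟨L, h1, h2⟩ := hs.boxes 0 σ'
    refine ⟨L, ?_, ?_⟩
    · rw [List.append_assoc, h1, boxes_replicate_false]; simp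
    · rw [List.append_assoc, h2, boxes_replicate_false]; simp

/-- The rows of the block can be separated from the remaining boxes: the nodes of factors that have
to pass each other differ by at least two. -/
theorem act_boxes_block {N : ℕ} (Z : StringModule RatField N) (s b c : ℕ) (hc : 0 < c)
    (a : List Bool) (h : HeadGE c (rho a)) :
    act (boxes s (List.replicate b true ++ (List.replicate c false ++ a))) Z =
      act (block s c b) (act (boxes (s + c) (List.replicate b true ++ a)) Z) := by
  induction b generalizing s Z with
  | zero => simp [block, boxes_replicate_false]
  | succ b ih =>
    have h1 := rho_block b c hc a h
    simp only [List.replicate_succ, List.cons_append] at h1 ⊢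
    simp only [boxes, block, act_append]
    rw [ih, h1, row_append, act_append]
    congr 1
    rw [show s + 1 + c = s + c + 1 by omega]
    simp only [List.length_range']
    refine act_comm _ _ _ fun x hx y hy => ?_
    have := le_of_mem_boxes _ _ _ hx
    have := mem_interval _ _ _ _ hy
    right; omega

theorem boxes_finalBlock (s b c : ℕ) :
    boxes s (List.replicate b true ++ List.replicate c false) = finalBlock s c b := by
  induction b generalizing s with
  | zero => have := boxes_replicate_false s c []; simpa [boxes, finalBlock] using this
  | succ b ih =>
    have h1 := rho_finalBlock b c
    simp only [List.replicate_succ, List.cons_append] at h1 ⊢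
    simp only [boxes, finalBlock, ih, h1, interval]

/-- The condition on `σ` keeps the contents of all rows starting in `σ` unchanged when the block is
removed; that on `τ` keeps the rows of the block independent of `τ`. -/
theorem act_boxes_peel {N : ℕ} (Z : StringModule RatField N) (σ τ : List Bool) (b c : ℕ)
    (hb : 0 < b) (hc : 0 < c) (hσ : GoodPrefix b σ) (hτ : HeadGE c (rho τ)) :
    act (boxes 0 (σ ++ (List.replicate b true ++ (List.replicate c false ++ τ)))) Z =
      act (block σ.length c b)
        (act (boxes 0 (σ ++ (List.replicate c false ++ (List.replicate b true ++ τ)))) Z) := by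
  obtain ⟨d, rfl⟩ : ∃ d, b = d + 1 := ⟨b - 1, by omega⟩
  obtain ⟨L, h1, h2⟩ := hσ.exists_boxes (sameScan_of_rho (d + 1) c _ _
    (rho (List.replicate (d + 1) true ++ τ)) (d + 1) le_rfl (rho_block d c hc τ hτ)
    (rho_replicate_false c _))
  rw [h1, h2, act_append, act_append, act_boxes_block _ _ _ _ hc _ hτ, boxes_replicate_false]

theorem act_boxes_peel_last {N : ℕ} (Z : StringModule RatField N) (σ : List Bool) (b c : ℕ)
    (hb : 0 < b) (hσ : GoodPrefix b σ) :
    act (boxes 0 (σ ++ (List.replicate b true ++ List.replicate c false))) Z =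
      act (finalBlock σ.length c b)
        (act (boxes 0 (σ ++ List.replicate (c + b) false)) Z) := by
  obtain ⟨d, rfl⟩ : ∃ d, b = d + 1 := ⟨b - 1, by omega⟩
  have e := rho_replicate_false (c + (d + 1)) []
  obtain ⟨L, h1, h2⟩ := hσ.exists_boxes (sameScan_of_rho (d + 1) (c + (d + 1))
    (List.replicate (d + 1) true ++ List.replicate c false) (List.replicate (c + (d + 1)) false)
    [] (d + 1) le_rfl (by rw [rho_finalBlock, List.append_nil]; rfl) (by simpa [rho] using e))
  have h3 := boxes_replicate_false σ.length (c + (d + 1)) []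
  rw [List.append_nil] at h3
  rw [h1, h2, h3, act_append, act_append, boxes_finalBlock]
  rfl

theorem exists_replicate_append (x : Bool) (l : List Bool) :
    ∃ c l', l = List.replicate c x ++ l' ∧ l'.head? ≠ some x := by
  induction l with
  | nil => exact ⟨0, [], rfl, by simp⟩
  | cons y l ih =>
    by_cases h : y = x
    · obtain ⟨c, l', h1, h2⟩ := ih
      exact ⟨c + 1, l', by rw [h, h1]; rfl, h2⟩
    · exact ⟨0, y :: l, rfl, by simpa using h⟩

/-- Walk through the runs of letters 2 from the left. Stop at a run followed by a gap of letters 1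
that is no longer than the next run, or by no further run. -/
theorem exists_peel_aux (n : ℕ) (σ : List Bool) (b : ℕ) (hb : 0 < b) (hσ : GoodPrefix b σ)
    (rest : List Bool) (hn : rest.length ≤ n) (hrest : rest.head? ≠ some true) :
    ∃ (σ' : List Bool) (b' c : ℕ), 0 < b' ∧ GoodPrefix b' σ' ∧
      (σ ++ (List.replicate b true ++ rest) =
          σ' ++ (List.replicate b' true ++ List.replicate c false) ∨
        0 < c ∧ ∃ τ, σ ++ (List.replicate b true ++ rest) =
          σ' ++ (List.replicate b' true ++ (List.replicate c false ++
            (List.replicate c true ++ τ)))) := by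
  induction n generalizing σ b rest with
  | zero =>
    obtain rfl : rest = [] := by simpa using hn
    exact ⟨σ, b, 0, hb, hσ, Or.inl (by simp)⟩
  | succ n ih =>
    obtain ⟨c, l, rfl, hl⟩ := exists_replicate_append false rest
    obtain ⟨b', l', rfl, hl'⟩ := exists_replicate_append true l
    rcases Nat.eq_zero_or_pos b' with rfl | hb'
    · have : l' = [] := by
        cases l' with
        | nil => rfl
        | cons y l' => cases y <;> simp at hl hl'
      subst this
      exact ⟨σ, b, c, hb, hσ, Or.inl (by simp)⟩
    have hc : 0 < c := by
      rcases Nat.eq_zero_or_pos c with rfl | hc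
      · obtain ⟨d, rfl⟩ : ∃ d, b' = d + 1 := ⟨b' - 1, by omega⟩
        simp [List.replicate_succ] at hrest
      · exact hc
    -- If the gap is longer than the next run, that run has `b'` letters 1 directly in front of it,
    -- which is the prefix condition for continuing with it.
    by_cases h : c ≤ b'
    · refine ⟨σ, b, c, hb, hσ, Or.inr ⟨hc, List.replicate (b' - c) true ++ l', ?_⟩⟩
      rw [← List.append_assoc (List.replicate c true), ← List.replicate_add, Nat.add_sub_cancel' h]
    · have hg : GoodPrefix b' (σ ++ (List.replicate b true ++ List.replicate c false)) := by
        refine Or.inr ⟨σ ++ (List.replicate b true ++ List.replicate (c - b') false), ?_⟩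
        rw [show c = c - b' + b' by omega, List.replicate_add, Nat.add_sub_cancel]
        simp [List.append_assoc]
      obtain ⟨σ', b'', c', h1, h2, h3⟩ := ih _ b' hb' hg l' (by simp at hn; omega) hl'
      refine ⟨σ', b'', c', h1, h2, ?_⟩
      simpa only [List.append_assoc] using h3

theorem exists_peel (α : List Bool) :
    (∃ n, α = List.replicate n false) ∨ ∃ (σ : List Bool) (b c : ℕ), 0 < b ∧ GoodPrefix b σ ∧
      (α = σ ++ (List.replicate b true ++ List.replicate c false) ∨
        0 < c ∧ ∃ τ, α = σ ++ (List.replicate b true ++ (List.replicate c false ++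
            (List.replicate c true ++ τ)))) := by
  obtain ⟨c, l, rfl, hl⟩ := exists_replicate_append false α
  obtain ⟨b, l', rfl, hl'⟩ := exists_replicate_append true l
  rcases Nat.eq_zero_or_pos b with rfl | hb
  · left
    refine ⟨c, ?_⟩
    cases l' with
    | nil => simp
    | cons y l' => cases y <;> simp at hl hl'
  · exact Or.inr (exists_peel_aux _ _ b hb (Or.inl ⟨c, rfl⟩) l' le_rfl hl')

/-! ### Ascending paths -/

/-- A path of strings from `γ` to `γ'`, in which the nodes of the list act from right to left,
each of them exchanging letters `1 2` or replacing a final letter `1`. -/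
inductive AscPath : List ℕ → List Bool → List Bool → Prop
  | nil (γ : List Bool) : AscPath [] γ γ
  | swap {l : List ℕ} {γ u v : List Bool} (h : AscPath l γ (u ++ false :: true :: v)) :
      AscPath (u.length :: l) γ (u ++ true :: false :: v)
  | flip {l : List ℕ} {γ u : List Bool} (h : AscPath l γ (u ++ [false])) :
      AscPath (u.length :: l) γ (u ++ [true])

theorem AscPath.trans {l m : List ℕ} {γ γ' γ'' : List Bool} (h : AscPath l γ' γ'')
    (h' : AscPath m γ γ') : AscPath (l ++ m) γ γ'' := by
  induction h with
  | nil => exact h'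
  | swap _ ih => exact (ih h').swap
  | flip _ ih => exact (ih h').flip

theorem AscPath.length_eq {l : List ℕ} {γ γ' : List Bool} (h : AscPath l γ γ') :
    γ'.length = γ.length := by
  induction h with
  | nil => rfl
  | swap _ ih => simpa using ih
  | flip _ ih => simpa using ih

theorem ascPath_row (u : List Bool) (n : ℕ) (ps : List ℕ) (h : ps.length = n + 1) :
    AscPath ((row u.length ps).map Prod.fst) (u ++ List.replicate (n + 1) false)
      (u ++ true :: List.replicate n false) := by
  induction n generalizing u ps with
  | zero =>
    match ps, h with
    | [p], _ => exact AscPath.flip (AscPath.nil _)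
  | succ n ih =>
    match ps, h with
    | p :: ps, h =>
      have := ih (u ++ [false]) ps (by simpa using h)
      simp only [List.length_append, List.length_singleton, List.append_assoc,
        List.singleton_append] at this
      exact AscPath.swap this

theorem ascPath_boxes (u a : List Bool) :
    AscPath ((boxes u.length a).map Prod.fst) (u ++ List.replicate a.length false) (u ++ a) := by
  induction a generalizing u with
  | nil => exact AscPath.nil _
  | cons x a ih =>
    have h := ih (u ++ [x])
    simp only [List.length_append, List.length_singleton, List.append_assoc,
        List.singleton_append] at h
    cases x with
    | false => exact h
    | true =>
      rw [boxes, List.map_append]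
      exact h.trans (ascPath_row u a.length _ (by simp [length_rho]))


/-! ### Supports with respect to link patterns -/

section

variable {N : ℕ}

/-- The vector all of whose link pattern coefficients outside `S` vanish. -/
def SupportedOn (S : List Bool → Prop) (Z : StringModule RatField N) : Prop :=
  ∀ δ : List Bool, δ.length = N → pairing tK tNK δ Z ≠ 0 → S δ

theorem SupportedOn.facOp {S S' : List Bool → Prop} {Z : StringModule RatField N} (k p : ℕ)
    (hZ : SupportedOn S Z) (hE : SupportedOn S' (shiftOp tK tNK k Z)) (h : ∀ δ, S δ → S' δ) :
    SupportedOn S' (facOp k p Z) := by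
  intro δ hδ hne
  obtain ⟨c, hc⟩ := exists_facOp_eq (N := N) k p
  rw [hc, map_add, map_smul] at hne
  by_cases h1 : pairing tK tNK δ Z = 0
  · rw [h1, smul_zero, add_zero] at hne
    exact hE δ hδ hne
  · exact h _ (hZ δ hδ h1)

theorem exists_middle {σ x τ u v : List Bool} {y : List Bool} (h : u ++ (y ++ v) = σ ++ (x ++ τ))
    (h1 : σ.length ≤ u.length) (h2 : u.length + y.length ≤ σ.length + x.length) :
    ∃ x1 x2, u = σ ++ x1 ∧ x = x1 ++ (y ++ x2) ∧ v = x2 ++ τ := by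
  obtain ⟨x1, rfl⟩ : σ <+: u := List.prefix_of_prefix_length_le (List.prefix_append _ _)
    (h ▸ List.prefix_append _ _) h1
  rw [List.append_assoc, List.append_cancel_left_eq, ← List.append_assoc] at h
  obtain ⟨x2, rfl⟩ : x1 ++ y <+: x := List.prefix_of_prefix_length_le
    (h ▸ List.prefix_append (x1 ++ y) v) (List.prefix_append _ _) (by simp at h2 ⊢; omega)
  rw [List.append_assoc _ x2, List.append_cancel_left_eq] at h
  exact ⟨x1, x2, rfl, by simp, h⟩

/-- The strings that arise from a fixed string by a change of the letters between `σ` and `τ`,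
where the number of letters `2` satisfies a condition. -/
def Between (σ τ : List Bool) (n : ℕ) (P : ℕ → Prop) (δ : List Bool) : Prop :=
  ∃ x : List Bool, δ = σ ++ (x ++ τ) ∧ x.length = n ∧ P (x.count true)

/-- A letter 2 in `σ` excludes the first form of the prefix, so `w` ends in `1^b`; a suffix of a
balanced word has at least as many letters 2 as letters 1. -/
theorem le_count_of_goodPrefix {b : ℕ} {σ u w x : List Bool} (hσ : GoodPrefix b σ)
    (h : σ = u ++ true :: w) (hw : endHeight 0 (w ++ x) = some 0) : b ≤ x.count true := by
  rcases hσ with ⟨a, rfl⟩ | ⟨σ', rfl⟩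
  · have : true ∈ List.replicate a false := by rw [h]; simp
    simp at this
  · obtain ⟨w', rfl⟩ : ∃ w', w = w' ++ List.replicate b false := by
      obtain ⟨r, h1, h2⟩ | ⟨r, h1, h2⟩ := List.append_eq_append_iff.1 h
      · cases r with
        | nil =>
          exfalso
          have : true ∈ List.replicate b false := by rw [List.nil_append] at h2; rw [h2]; simp
          simp at this
        | cons y r =>
          exfalso
          have : true ∈ List.replicate b false := by rw [h2]; simp
          simp at this
      · cases r with
        | nil =>
          exfalso
          have : true ∈ List.replicate b false := by rw [List.nil_append] at h2; rw [← h2]; simp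
          simp at this
        | cons y r =>
          simp only [List.cons_append, List.cons.injEq] at h2
          exact ⟨r, h2.2⟩
    rw [List.append_assoc] at hw
    have := count_le_of_endHeight_suffix _ _ hw
    simp [List.count_replicate] at this
    omega

theorem le_count_of_endHeight_replicate {c : ℕ} {x w : List Bool}
    (h : endHeight 0 (x ++ (List.replicate c true ++ w)) ≠ none) : c ≤ x.count false := by
  rw [← List.append_assoc] at h
  have := count_le_of_endHeight_append _ _ h
  simp [List.count_replicate] at this
  omega

/-- `E_k` changes a link pattern by reconnecting arcs or unmatched letters at the node. The bounds
on the letters between `σ` and `τ` leave too few of them to balance `1^b` at the end of `σ` or `2^c`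
at the start of `τ`, so the reconnection stays inside. With `τ` empty, two unmatched letters 1 may
also be joined, which changes the count by one. -/
theorem SupportedOn.shiftOp_between {σ τ : List Bool} {n b c : ℕ} {P : ℕ → Prop}
    {Z : StringModule RatField N} (hZ : SupportedOn (Between σ τ n P) Z) (k : ℕ)
    (hk : σ.length ≤ k) (hk' : k + 2 ≤ σ.length + n) (hN : σ.length + n + τ.length = N)
    (hσ : GoodPrefix b σ) (hb : ∀ m, P m → m ≤ b)
    (hτ : ((∃ τ', τ = List.replicate c true ++ τ') ∧ ∀ m, P m → n ≤ m + c) ∨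
      (τ = [] ∧ ∀ m, P (m + 1) → P m)) :
    SupportedOn (Between σ τ n P) (shiftOp tK tNK k Z) := by
  intro δ hδ hne
  obtain ⟨d, u, v, rfl, hl, h, hcases⟩ := pairing_shiftOp_cases tK tNK δ hδ k (by omega)
  rw [h] at hne
  obtain ⟨x, hx, hxn, hP⟩ := hZ _ hl (right_ne_zero_of_mul hne)
  obtain ⟨x1, x2, rfl, rfl, rfl⟩ := exists_middle (y := [false, true]) hx hk (by simp; omega)
  have hcf := List.count_false_add_count_true (x1 ++ ([false, true] ++ x2))
  simp only [List.count_append, List.length_append, List.count_cons, List.length_cons] at hxn hP hcf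
  simp [add_comm 1] at hP hcf hxn
  rcases hcases with h0 | rfl | rfl | ⟨u', w, hu, hw, rfl⟩ | ⟨w, v', hv, hw, rfl⟩ | ⟨hv, rfl⟩
  · exact absurd h0 (left_ne_zero_of_mul hne)
  · exact ⟨x1 ++ ([false, true] ++ x2), by simp, by simp; omega, by simpa [add_comm] using hP⟩
  · exact ⟨x1 ++ ([true, false] ++ x2), by simp, by simp; omega, by simpa [add_comm] using hP⟩
  · obtain ⟨r, h1, h2⟩ | ⟨r, h1, h2⟩ := List.append_eq_append_iff.1 hu
    · subst h1 h2
      refine ⟨r ++ false :: (w ++ true :: true :: x2), by simp, by simp at hxn ⊢; omega, ?_⟩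
      convert hP using 1
      simp
      omega
    · cases r with
      | nil =>
        simp only [List.append_nil, List.nil_append] at h1 h2
        subst h1 h2
        refine ⟨false :: (w ++ true :: true :: x2), by simp, by simp at hxn ⊢; omega, ?_⟩
        convert hP using 1
        simp
        omega
      -- The changed partner would be in `σ`, so `x1` would contain `b` letters 2 in addition to the
      -- one at the peak.
      | cons y r =>
        exfalso
        simp only [List.cons_append, List.cons.injEq] at h2
        obtain ⟨rfl, rfl⟩ := h2
        have h3 := le_count_of_goodPrefix hσ h1 hw
        have := hb _ hP
        omega
  · obtain ⟨r, h1, h2⟩ | ⟨r, h1, h2⟩ := List.append_eq_append_iff.1 hv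
    · rcases hτ with ⟨⟨τ', h3⟩, hc⟩ | ⟨h3, -⟩
      -- The changed partner would be in `τ`, behind its `c` letters 2, so `x2` would contain `c`
      -- letters 1 in addition to the one at the peak.
      · exfalso
        obtain ⟨r', rfl⟩ : ∃ r', r = List.replicate c true ++ r' := by
          rw [h3] at h2
          obtain ⟨q, h4, h5⟩ | ⟨q, h4, h5⟩ := List.append_eq_append_iff.1 h2
          · exact ⟨q, h4⟩
          · cases q with
            | nil => exact ⟨[], by simpa using h4.symm⟩
            | cons y q =>
              simp only [List.cons_append, List.cons.injEq] at h5
              have : false ∈ List.replicate c true := by rw [h4, ← h5.1]; simp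
              simp at this
        subst h1
        have h6 := le_count_of_endHeight_replicate (by rw [hw]; simp)
        have := hc _ hP
        omega
      · exfalso
        rw [h3] at h2
        simp at h2
    · cases r with
      | nil =>
        exfalso
        simp only [List.append_nil, List.nil_append] at h1 h2
        rcases hτ with ⟨⟨τ', h3⟩, hc⟩ | ⟨h3, -⟩
        · have hc0 : c = 0 := by
            rcases Nat.eq_zero_or_pos c with h0 | h0
            · exact h0
            · obtain ⟨e, rfl⟩ : ∃ e, c = e + 1 := ⟨c - 1, by omega⟩
              rw [h3] at h2
              simp [List.replicate_succ] at h2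
          have := hc _ hP
          omega
        · simp [h3] at h2
      | cons y r =>
        simp only [List.cons_append, List.cons.injEq] at h2
        obtain ⟨rfl, rfl⟩ := h2
        subst h1
        refine ⟨x1 ++ false :: false :: (w ++ true :: r), by simp, by simp at hxn ⊢; omega, ?_⟩
        convert hP using 1
        simp
        omega
  · rcases hτ with ⟨⟨τ', h3⟩, hc⟩ | ⟨h3, hc⟩
    -- A path that survives the letters `2^c` again needs `c` letters 1 in `x2`.
    · exfalso
      rw [h3] at hv
      have h6 := le_count_of_endHeight_replicate hv
      have := hc _ hP
      omega
    · refine ⟨x1 ++ ([false, false] ++ x2), by simp, by simp; omega, ?_⟩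
      simp
      exact hc _ hP

/-- The coefficients of a vector on the vectors of the link patterns are those of the element of
the dual basis that corresponds to `α`. -/
def IsDual (α : List Bool) (Z : StringModule RatField N) : Prop :=
  ∀ δ : List Bool, δ.length = N → pairing tK tNK δ Z = if δ = α then 1 else 0

/-- Composing any form with `E_k` gives a multiple of a form with a peak at `k`, and `α` has no such
peak. -/
theorem IsDual.shiftOp_eq_zero {α : List Bool} {Z : StringModule RatField N} (h : IsDual α Z)
    (k : ℕ) (hk : k + 1 < N)
    (hα : ∀ u v, α = u ++ false :: true :: v → u.length ≠ k) : shiftOp tK tNK k Z = 0 := by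
  refine eq_zero_of_pairing tK tNK _ fun δ hδ => ?_
  obtain ⟨d, u, v, hu, hl, e, -⟩ := pairing_shiftOp_cases tK tNK δ hδ k hk
  rw [e, h _ hl, if_neg fun h' => hα u v h'.symm hu, mul_zero]

theorem IsDual.supportedOn {α : List Bool} {Z : StringModule RatField N} (h : IsDual α Z)
    {S : List Bool → Prop} (hS : S α) : SupportedOn S Z := by
  intro δ hδ hne
  rw [h δ hδ] at hne
  by_cases e : δ = α
  · rwa [e]
  · simp [e] at hne

theorem SupportedOn.act {S : List Bool → Prop} {Z : StringModule RatField N}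
    (hZ : SupportedOn S Z) (L : List (ℕ × ℕ))
    (h : ∀ b ∈ L, ∀ Z : StringModule RatField N, SupportedOn S Z →
      SupportedOn S (shiftOp tK tNK b.1 Z)) : SupportedOn S (act L Z) := by
  induction L with
  | nil => exact hZ
  | cons b L ih =>
    have := ih fun b hb => h b (by simp [hb])
    exact this.facOp _ _ (h b (by simp) _ this) fun _ h => h

/-- A string without `1 2` is sorted. -/
theorem eq_replicate_of_forall_ne (x : List Bool)
    (h : ∀ u v, x ≠ u ++ false :: true :: v) :
    x = List.replicate (x.count true) true ++ List.replicate (x.count false) false := by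
  induction x with
  | nil => rfl
  | cons a x ih =>
    have := ih fun u v e => h (a :: u) v (by rw [e]; rfl)
    cases a with
    | true =>
      simp only [List.count_cons]
      simp [List.replicate_succ]
      exact this
    | false =>
      have h0 : x.count true = 0 := by
        rcases Nat.eq_zero_or_pos (x.count true) with h0 | h0
        · exact h0
        · exfalso
          obtain ⟨e, he⟩ : ∃ e, x.count true = e + 1 := ⟨x.count true - 1, by omega⟩
          rw [he, List.replicate_succ] at this
          exact h [] _ (by rw [this]; rfl)
      rw [h0] at this
      simp only [List.count_cons]
      simp [h0, List.replicate_succ]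
      exact this

/-- If `x` contains `12`, its form is the form with `21` there composed with some `E_k`, and `E_k`
annihilates `y`. -/
theorem pairing_eq_zero_of_between {σ τ x : List Bool} {y : StringModule RatField N}
    (hl : (σ ++ (x ++ τ)).length = N)
    (hE : ∀ k, σ.length ≤ k → k + 1 < σ.length + x.length → shiftOp tK tNK k y = 0)
    (hx : x ≠ List.replicate (x.count true) true ++ List.replicate (x.count false) false) :
    pairing tK tNK (σ ++ (x ++ τ)) y = 0 := by
  by_contra hne
  refine hx (eq_replicate_of_forall_ne x ?_)
  rintro u v rfl
  apply hne
  have h1 := pairing_shiftOp_valley tK tNK y (σ ++ u) (v ++ τ) (by simpa using hl)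
  rw [hE _ (by simp) (by simp; omega), map_zero] at h1
  simpa using h1.symm

end


section

variable {N : ℕ}

/-! ### Leading coefficients -/

/-- The span of the basis vectors of the strings of area less than `n`. -/
def areaLT (N n : ℕ) : Submodule RatField (StringModule RatField N) :=
  Submodule.span RatField {x | ∃ l : List Bool, l.length = N ∧ area l < n ∧ x = basisVec RatField N l}

theorem areaLT_mono {m n : ℕ} (h : m ≤ n) : areaLT N m ≤ areaLT N n := by
  refine Submodule.span_mono ?_
  rintro x ⟨l, h1, h2, rfl⟩
  exact ⟨l, h1, by omega, rfl⟩

theorem basisVec_mem_areaLT {l : List Bool} {n : ℕ} (hl : l.length = N) (h : area l < n) :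
    basisVec RatField N l ∈ areaLT N n := Submodule.subset_span ⟨l, hl, h, rfl⟩

theorem shiftOp_mem_areaLT (k n : ℕ) (Z : StringModule RatField N) (hZ : Z ∈ areaLT N n) :
    shiftOp tK tNK k Z ∈ areaLT N (n + 1) := by
  suffices h : areaLT N n ≤ (areaLT N (n + 1)).comap (shiftOp tK tNK k) from h hZ
  refine Submodule.span_le.2 ?_
  rintro x ⟨l, h1, h2, rfl⟩
  rw [SetLike.mem_coe, Submodule.mem_comap]
  rcases lt_trichotomy (k + 1) N with hk | hk | hk
  · obtain ⟨u, a, b, v, rfl, rfl⟩ : ∃ u a b v, l = u ++ a :: b :: v ∧ u.length = k :=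
      ⟨l.take k, l[k], l[k + 1], l.drop (k + 2), by simp, by simp; omega⟩
    rw [shiftOp_basisVec_swap _ _ _ _ _ _ h1]
    have h3 : basisVec RatField N (u ++ a :: b :: v) ∈ areaLT N (n + 1) :=
      basisVec_mem_areaLT h1 (by omega)
    have h4 : basisVec RatField N (u ++ b :: a :: v) ∈ areaLT N (n + 1) := by
      refine basisVec_mem_areaLT (by simpa using h1) ?_
      revert h2
      rw [area_append, area_append]
      cases a <;> cases b <;> simp [area] <;> omega
    split_ifs
    · exact Submodule.zero_mem _
    · exact Submodule.sub_mem _ h4 (Submodule.smul_mem _ _ h3)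
    · exact Submodule.sub_mem _ h4 (Submodule.smul_mem _ _ h3)
  · obtain ⟨u, a, rfl, rfl⟩ : ∃ u a, l = u ++ [a] ∧ u.length = k := by
      refine ⟨l.take k, l[k], ?_, by simp; omega⟩
      rw [List.take_append_getElem, List.take_of_length_le (by omega)]
    rw [shiftOp_basisVec_flip _ _ _ _ h1]
    have h3 : basisVec RatField N (u ++ [a]) ∈ areaLT N (n + 1) :=
      basisVec_mem_areaLT h1 (by omega)
    have h4 : ∀ b, basisVec RatField N (u ++ [b]) ∈ areaLT N (n + 1) := by
      intro b
      refine basisVec_mem_areaLT (by simpa using h1) ?_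
      revert h2
      rw [area_append, area_append]
      cases a <;> cases b <;> simp [area] <;> omega
    split_ifs
    · exact Submodule.sub_mem _ (h4 _) (Submodule.smul_mem _ _ h3)
    · exact Submodule.sub_mem _ (h4 _) (Submodule.smul_mem _ _ h3)
  · have : shiftOp (N := N) tK tNK k = 0 := by
      rw [shiftOp, dif_neg (by omega)]
    rw [this]
    exact Submodule.zero_mem _

theorem facOp_mem_areaLT (k p n : ℕ) (Z : StringModule RatField N) (hZ : Z ∈ areaLT N n) :
    facOp k p Z ∈ areaLT N (n + 1) := by
  obtain ⟨c, hc⟩ := exists_facOp_eq (N := N) k p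
  rw [hc]
  exact Submodule.add_mem _ (shiftOp_mem_areaLT _ _ _ hZ)
    (Submodule.smul_mem _ _ (areaLT_mono (Nat.le_succ n) hZ))

theorem pairing_of_mem_areaLT (γ : List Bool) (Z : StringModule RatField N)
    (hZ : Z ∈ areaLT N (area γ)) : pairing tK tNK γ Z = 0 := by
  suffices h : areaLT N (area γ) ≤ LinearMap.ker (pairing tK tNK γ) from h hZ
  refine Submodule.span_le.2 ?_
  rintro x ⟨l, h1, h2, rfl⟩
  rw [SetLike.mem_coe, LinearMap.mem_ker, pairing_basisVec _ _ _ _ h1]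
  by_contra hne
  have := (area_le_of_linkCoeff_ne_zero _ _ _ _ _ hne).2
  simp at this
  omega

/-- Along an ascending path, the product of factors has the leading coefficient `1`. -/
theorem act_sub_mem_areaLT {l : List ℕ} {γ γ' : List Bool} (h : AscPath l γ γ')
    (hγ : γ.length = N) (L : List (ℕ × ℕ)) (hL : L.map Prod.fst = l) :
    act L (basisVec RatField N γ) - basisVec RatField N γ' ∈ areaLT N (area γ') := by
  induction h generalizing L with
  | nil γ =>
    obtain rfl : L = [] := by simpa using hL
    simp
  | @swap l γ u v h ih =>
    match L, hL with
    | (k, p) :: L, hL =>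
      simp only [List.map_cons, List.cons.injEq] at hL
      obtain ⟨rfl, hL⟩ := hL
      have h1 := facOp_mem_areaLT u.length p _ _ (ih hγ L hL)
      have hl : (u ++ false :: true :: v).length = N := h.length_eq.trans hγ
      have ha : area (u ++ true :: false :: v) = area (u ++ false :: true :: v) + 1 := by
        rw [area_append, area_append]; simp [area]; omega
      obtain ⟨c, hc⟩ := exists_facOp_eq (N := N) u.length p
      have h2 := hc (basisVec RatField N (u ++ false :: true :: v))
      rw [shiftOp_basisVec_swap _ _ _ _ _ _ hl, if_neg (by simp), if_pos rfl] at h2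
      rw [map_sub, h2, ← ha] at h1
      rw [act_cons]
      have h3 := Submodule.smul_mem _ (c - (tK : RatField))
        (basisVec_mem_areaLT (n := area (u ++ true :: false :: v)) hl (by omega))
      have := Submodule.add_mem _ h1 h3
      rw [sub_smul] at this
      convert this using 1
      abel
  | @flip l γ u h ih =>
    match L, hL with
    | (k, p) :: L, hL =>
      simp only [List.map_cons, List.cons.injEq] at hL
      obtain ⟨rfl, hL⟩ := hL
      have h1 := facOp_mem_areaLT u.length p _ _ (ih hγ L hL)
      have hl : (u ++ [false]).length = N := h.length_eq.trans hγ
      have ha : area (u ++ [true]) = area (u ++ [false]) + 1 := by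
        rw [area_append, area_append]; simp [area]
      obtain ⟨c, hc⟩ := exists_facOp_eq (N := N) u.length p
      have h2 := hc (basisVec RatField N (u ++ [false]))
      rw [shiftOp_basisVec_flip _ _ _ _ hl, if_pos rfl] at h2
      rw [map_sub, h2, ← ha] at h1
      rw [act_cons]
      have h3 := Submodule.smul_mem _ (c - (tNK : RatField))
        (basisVec_mem_areaLT (n := area (u ++ [true])) hl (by omega))
      have := Submodule.add_mem _ h1 h3
      rw [sub_smul] at this
      convert this using 1
      abel

/-- The product of the factors of a string applied to `m_{1…1}`. -/
def factorProd (N : ℕ) (α : List Bool) : StringModule RatField N :=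
  act (boxes 0 α) (basisVec RatField N (List.replicate N false))

/-- The product is `m_α` plus terms of smaller area, and the form of `α` vanishes on the latter. -/
theorem pairing_factorProd_self (α : List Bool) (hα : α.length = N) :
    pairing tK tNK α (factorProd N α) = 1 := by
  have h1 := ascPath_boxes [] α
  rw [hα, List.nil_append, List.nil_append, List.length_nil] at h1
  have h2 := pairing_of_mem_areaLT _ _ (act_sub_mem_areaLT (N := N) h1 (by simp) (boxes 0 α) rfl)
  rw [map_sub, pairing_basisVec _ _ _ _ hα, linkCoeff_self _ _ _ _ (by simp), sub_eq_zero] at h2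
  exact h2

/-! ### The last rows -/

section

variable (Z : StringModule RatField N)

/-- Only the `E` part of each factor contributes: the scalar part pairs a peak with a vector killed
at that node. The 2 thus moves to the right end and becomes a 1. -/
theorem pairing_interval_valley (u : List Bool) (m p : ℕ) (hN : u.length + m + 2 = N)
    (h : ∀ j, u.length ≤ j → j + 1 < N → shiftOp tK tNK j Z = 0) :
    pairing tK tNK (u ++ false :: true :: List.replicate m false)
        (act (interval (u.length + 1) p (m + 1)) Z) =
      pairing tK tNK (u ++ List.replicate (m + 2) false) Z := by
  have key : ∀ (v : List Bool) (W : StringModule RatField N),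
      (u ++ false :: true :: v).length = N → shiftOp tK tNK u.length W = 0 →
      pairing tK tNK (u ++ false :: true :: v) W = 0 := by
    intro v W hl hW
    have := pairing_shiftOp_valley tK tNK W u v (by simpa using hl)
    rw [hW, map_zero] at this
    exact this.symm
  rw [interval_succ, act_cons]
  obtain ⟨c, hc⟩ := exists_facOp_eq (N := N) (u.length + 1) p
  have h0 : shiftOp tK tNK u.length (act (interval (u.length + 1 + 1) (p + 1) m) Z) = 0 := by
    refine shiftOp_act_eq_zero _ _ _ (fun b hb => ?_) (h _ le_rfl (by omega))
    have := mem_interval _ _ _ _ hb; left; omega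
  rw [hc, map_add, map_smul, key _ _ (by simp; omega) h0, smul_zero, add_zero]
  cases m with
  | zero =>
    have := pairing_shiftOp_last_true tK tNK Z (u ++ [false]) (by simp; omega)
    simpa [interval_zero] using this
  | succ m =>
    have h1 := pairing_shiftOp_valley tK tNK
      (act (interval (u.length + 1 + 1) (p + 1) (m + 1)) Z) (u ++ [false]) (List.replicate m false)
      (by simp; omega)
    have h2 := pairing_interval_valley (u ++ [false]) m (p + 1) (by simp; omega)
      (fun j h1 h2 => h j (by simp at h1; omega) h2)
    simp only [List.length_append, List.length_singleton, List.append_assoc,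
      List.singleton_append] at h1 h2
    rw [← List.replicate_succ] at h1
    rw [h1, h2]
    rfl

theorem endHeight_replicate_false (h m : ℕ) :
    endHeight h (List.replicate m false) = some (h + m) := by
  induction m generalizing h with
  | zero => rfl
  | succ m ih => rw [List.replicate_succ, endHeight, ih]; congr 1; omega

/-- The first factor either joins the first two letters 1, with a weight depending on the parity of
`m`, or acts by its scalar. The two contributions combine by `lastNum_add_two`. For `q = 0` the
factor on the right is `0` in both parities. -/
theorem pairing_interval_up (u : List Bool) (m q : ℕ) (hN : u.length + m + 1 = N)
    (h : ∀ j, u.length ≤ j → j + 1 < N → shiftOp tK tNK j Z = 0) :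
    qInt (q + 1) * pairing tK tNK (u ++ List.replicate (m + 1) false)
        (act (interval u.length (q + 1) (m + 1)) Z) =
      (if Even m then lastNum (q + 1) - qInt (q + 1) * tauK else lastNum q) *
        pairing tK tNK (u ++ List.replicate (m + 1) false) Z := by
  induction m generalizing u q with
  | zero =>
    have h1 := pairing_shiftOp_last_false tK tNK Z u (by simp; omega)
    have hq := qInt_ne_zero (q + 1) (by omega)
    rw [interval_succ, act_cons, facOp_apply _ _ (by omega) (by omega)]
    simp only [interval_zero, act_nil, map_add, map_smul, smul_eq_mul]
    rw [show List.replicate (0 + 1) false = [false] from rfl, h1, facScalar, if_neg (by omega),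
      if_pos (by simp), Units.val_inv_eq_inv_val]
    field_simp
    ring
  | succ m ih =>
    have h1 := ih (u ++ [false]) (q + 1) (by simp; omega)
      (fun j h1 h2 => h j (by simp at h1; omega) h2)
    have h2 := pairing_shiftOp_up_free tK tNK (act (interval (u.length + 1) (q + 1 + 1) (m + 1)) Z) u
      (List.replicate m false) m (by rw [endHeight_replicate_false, zero_add]) (by simp; omega)
    rw [pairing_interval_valley Z u m (q + 1 + 1) (by omega) h] at h2
    simp only [List.length_append, List.length_singleton, List.append_assoc,
      List.singleton_append] at h1 h2
    rw [← List.replicate_succ] at h1 h2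
    rw [← List.replicate_succ] at h2
    have hq := qInt_ne_zero (q + 1) (by omega)
    rw [interval_succ, act_cons, facOp_apply _ _ (by omega) (by omega), map_add, map_smul, h2,
      facScalar, if_pos (by omega), smul_eq_mul]
    have h3 := lastNum_add_two q
    have e : qInt (q + 1) * (joinWeight tK tNK m * pairing tK tNK (u ++ List.replicate (m + 2) false) Z +
        qInt (q + 1 + 1) / qInt (q + 1) * pairing tK tNK (u ++ List.replicate (m + 1 + 1) false)
          (act (interval (u.length + 1) (q + 1 + 1) (m + 1)) Z)) =
        qInt (q + 1) * (joinWeight tK tNK m * pairing tK tNK (u ++ List.replicate (m + 2) false) Z) +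
        qInt (q + 1 + 1) * pairing tK tNK (u ++ List.replicate (m + 1 + 1) false)
          (act (interval (u.length + 1) (q + 1 + 1) (m + 1)) Z) := by
      field_simp
    rw [e, h1]
    unfold joinWeight
    simp only [Units.val_inv_eq_inv_val]
    rcases Nat.even_or_odd m with hm | hm
    · have hm' : ¬ Even (m + 1) := by simpa [Nat.even_add_one] using hm
      simp only [hm, hm', if_true, if_false]
      rw [show q + 1 + 1 = q + 2 from rfl, h3]
      unfold kappaK
      ring
    · have hm' : Even (m + 1) := hm.add_one
      simp only [hm', Nat.not_even_iff_odd.2 hm, if_true, if_false]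
      unfold tauK
      ring

/-- The row that acts last has contents starting at `1`, so `pairing_interval_up` applies to it with
`q = 0`. -/
theorem exists_finalBlock_eq (s b c : ℕ) (hN : s + (b + 1) + c = N) :
    ∃ L, finalBlock s c (b + 1) = interval (s + b) 1 (c + 1) ++ L ∧
      ∀ Z : StringModule RatField N, (∀ j, s ≤ j → j + 1 < N → shiftOp tK tNK j Z = 0) →
        ∀ j, s + b ≤ j → j + 1 < N → shiftOp tK tNK j (act L Z) = 0 := by
  induction b generalizing s with
  | zero => exact ⟨[], by simp [finalBlock], fun Z h => h⟩
  | succ b ih =>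
    obtain ⟨L, h1, h2⟩ := ih (s + 1) (by omega)
    refine ⟨L ++ interval s (b + 1 + 1) (c + (b + 1) + 1), ?_, ?_⟩
    · rw [finalBlock, h1, List.append_assoc, show s + 1 + b = s + (b + 1) by omega]
    · intro Z hZ j hj hj'
      rw [act_append]
      refine h2 _ (fun i hi hi' => ?_) j (by omega) hj'
      exact shiftOp_interval _ _ _ _ _ (by omega) (by omega) (by omega) hi' (hZ _ (by omega) (by omega))

theorem pairing_finalBlock_eq_zero (s b c : ℕ) (u : List Bool) (hN : s + (b + 1) + c = N)
    (hu : u.length = s + b) (h : ∀ j, s ≤ j → j + 1 < N → shiftOp tK tNK j Z = 0) :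
    pairing tK tNK (u ++ List.replicate (c + 1) false) (act (finalBlock s c (b + 1)) Z) = 0 := by
  obtain ⟨L, h1, h2⟩ := exists_finalBlock_eq s b c hN
  have h3 := pairing_interval_up (act L Z) u c 0 (by omega) (by rw [hu]; exact h2 Z h)
  rw [h1, act_append, ← hu]
  rw [zero_add, qInt_one, one_mul, lastNum_one, lastNum_zero, one_mul, sub_self, ite_self,
    zero_mul] at h3
  exact h3

theorem SupportedOn.mono {S S' : List Bool → Prop} {Z : StringModule RatField N}
    (hZ : SupportedOn S Z) (h : ∀ δ, S δ → S' δ) : SupportedOn S' Z :=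
  fun δ hδ hne => h _ (hZ δ hδ hne)

theorem Between.mono {σ τ : List Bool} {n : ℕ} {P P' : ℕ → Prop} (h : ∀ m, P m → P' m)
    (δ : List Bool) : Between σ τ n P δ → Between σ τ n P' δ := by
  rintro ⟨x, h1, h2, h3⟩
  exact ⟨x, h1, h2, h _ h3⟩

theorem SupportedOn.shiftOp_last {σ : List Bool} {n j : ℕ} {Z : StringModule RatField N}
    (hZ : SupportedOn (Between σ [] n (· ≤ j)) Z) (hn : 0 < n) (hN : σ.length + n = N) :
    SupportedOn (Between σ [] n (· ≤ j + 1)) (shiftOp tK tNK (N - 1) Z) := by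
  intro δ hδ hne
  rcases List.eq_nil_or_concat δ with rfl | ⟨u, a, rfl⟩
  · simp at hδ; omega
  rw [List.concat_eq_append] at *
  have hu : N - 1 = u.length := by simp at hδ; omega
  rw [hu] at hne
  have hf : pairing tK tNK (u ++ [false]) Z ≠ 0 := by
    cases a with
    | true =>
      rwa [pairing_shiftOp_last_true _ _ _ _ hδ] at hne
    | false =>
      rw [pairing_shiftOp_last_false _ _ _ _ hδ] at hne
      exact right_ne_zero_of_mul hne
  obtain ⟨x, hx, hxn, hxj⟩ := hZ _ (by simpa using hδ) hf
  rw [List.append_nil] at hx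
  obtain ⟨x1, x2, rfl, rfl, hx2⟩ := exists_middle (σ := σ) (x := x) (τ := []) (y := [false])
    (v := []) (by simpa using hx) (by omega) (by simp; omega)
  obtain rfl : x2 = [] := by simpa using hx2.symm
  refine ⟨x1 ++ [a], by simp, by simpa using hxn, ?_⟩
  simp only [List.append_nil, List.count_append] at hxj ⊢
  have : List.count true [a] ≤ 1 := by cases a <;> simp
  omega

/-- Only the factor at the last node, the first of the row to act, can increase the bound on the
number of letters 2. -/
theorem SupportedOn.interval_last {σ : List Bool} {n b j : ℕ} {Z : StringModule RatField N}
    (hZ : SupportedOn (Between σ [] n (· ≤ j)) Z) (hN : σ.length + n = N) (hσ : GoodPrefix b σ)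
    (hj : j + 1 ≤ b) (k p r : ℕ) (hk : σ.length ≤ k) (hkN : k + r + 1 = N) :
    SupportedOn (Between σ [] n (· ≤ j + 1)) (KLFactor.act (interval k p (r + 1)) Z) := by
  induction r generalizing k p with
  | zero =>
    rw [interval_succ, act_cons, interval_zero, act_nil]
    refine hZ.facOp _ _ ?_ (Between.mono fun m h => by omega)
    have := hZ.shiftOp_last (by omega) hN
    rwa [show N - 1 = k by omega] at this
  | succ r ih =>
    have h1 := ih (k + 1) (p + 1) (by omega) (by omega)
    rw [interval_succ, act_cons]
    refine h1.facOp _ _ ?_ fun _ h => h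
    exact h1.shiftOp_between (c := 0) k hk (by omega) (by simpa using hN) hσ
      (fun m hm => by omega) (Or.inr ⟨rfl, fun m hm => by omega⟩)

theorem SupportedOn.finalBlock {σ : List Bool} {n b j : ℕ} {Z : StringModule RatField N}
    (hZ : SupportedOn (Between σ [] n (· ≤ j)) Z) (hN : σ.length + n = N) (hσ : GoodPrefix b σ)
    (k b' c : ℕ) (hj : j + b' ≤ b) (hk : σ.length ≤ k) (hkN : k + b' + c = N) :
    SupportedOn (Between σ [] n (· ≤ j + b')) (KLFactor.act (finalBlock k c b') Z) := by
  induction b' generalizing k j Z with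
  | zero => exact hZ
  | succ b' ih =>
    rw [KLFactor.finalBlock, act_append]
    have h1 := hZ.interval_last hN hσ (by omega) k (b' + 1) (c + b') hk (by omega)
    have h2 := ih h1 (k + 1) (by omega) (by omega) (by omega)
    refine h2.mono (Between.mono fun m h => by omega)

end

/-! ### The factorized elements are the dual basis -/

theorem isDual_of_forall {α : List Bool} {y : StringModule RatField N}
    (h1 : pairing tK tNK α y = 1)
    (h : ∀ δ : List Bool, δ.length = N → pairing tK tNK δ y ≠ 0 → δ = α) : IsDual α y := by
  intro δ hδ
  split_ifs with e
  · rw [e, h1]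
  · by_contra hne
    exact e (h δ hδ hne)

theorem IsDual.block {σ τ : List Bool} {b c : ℕ} {Z : StringModule RatField N} (hb : 0 < b)
    (hc : 0 < c) (hσ : GoodPrefix b σ) (hτ : ∃ τ', τ = List.replicate c true ++ τ')
    (hN : (σ ++ (List.replicate b true ++ (List.replicate c false ++ τ))).length = N)
    (hZ : IsDual (σ ++ (List.replicate c false ++ (List.replicate b true ++ τ))) Z)
    (δ : List Bool) (hδ : δ.length = N)
    (hne : pairing tK tNK δ (act (KLFactor.block σ.length c b) Z) ≠ 0) :
    δ = σ ++ (List.replicate b true ++ (List.replicate c false ++ τ)) := by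
  simp only [List.length_append, List.length_replicate] at hN
  have hS : SupportedOn (Between σ τ (b + c) (· = b)) (act (KLFactor.block σ.length c b) Z) := by
    refine SupportedOn.act ?_ _ fun x hx W hW => ?_
    · refine hZ.supportedOn ⟨List.replicate c false ++ List.replicate b true, by simp, ?_, ?_⟩
      · simp; omega
      · simp [List.count_replicate]
    · have := mem_block _ _ _ _ hx
      exact hW.shiftOp_between _ this.1 (by omega) (by omega) hσ (fun m hm => hm.le)
        (Or.inl ⟨hτ, fun m hm => by omega⟩)
  obtain ⟨x, rfl, hx, hxb⟩ := hS δ hδ hne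
  have hE : ∀ k, σ.length ≤ k → k + 1 < σ.length + x.length →
      shiftOp tK tNK k (act (KLFactor.block σ.length c b) Z) = 0 := by
    intro k h1 h2
    -- Away from the junction the smaller string has no `12` inside the block, so duality
    -- annihilates its vector there.
    refine shiftOp_block _ _ _ _ _ hb hc (by omega) h1 (by omega) fun j hj hj' hjc => ?_
    refine hZ.shiftOp_eq_zero _ (by omega) fun u v huv hu => ?_
    have h3 : u.length + 1 < (σ ++ (List.replicate c false ++ (List.replicate b true ++ τ))).length := by
      rw [huv]; simp
    have h4 : (σ ++ (List.replicate c false ++ (List.replicate b true ++ τ)))[u.length]? = some false := by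
      rw [huv]; simp
    have h5 : (σ ++ (List.replicate c false ++ (List.replicate b true ++ τ)))[u.length + 1]? = some true := by
      rw [huv]; simp
    rw [hu] at h4 h5
    rw [List.getElem?_append_right (by omega)] at h4 h5
    rcases Nat.lt_or_ge (j + 1) (σ.length + c) with h6 | h6
    · rw [List.getElem?_append_left (by simp; omega), List.getElem?_replicate] at h5
      simp at h5
    · rw [List.getElem?_append_right (by simp; omega),
        List.getElem?_append_left (by simp; omega), List.getElem?_replicate] at h4
      simp at h4
  have hs : x = List.replicate (x.count true) true ++ List.replicate (x.count false) false := by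
    by_contra hx'
    exact hne (pairing_eq_zero_of_between (by simpa using hδ) hE hx')
  have := List.count_false_add_count_true x
  rw [hxb, show x.count false = c by omega] at hs
  rw [hs]
  simp

theorem IsDual.finalBlock {σ : List Bool} {b c : ℕ} {Z : StringModule RatField N} (hb : 0 < b)
    (hσ : GoodPrefix b σ)
    (hN : (σ ++ (List.replicate b true ++ List.replicate c false)).length = N)
    (hZ : IsDual (σ ++ List.replicate (c + b) false) Z)
    (δ : List Bool) (hδ : δ.length = N)
    (hne : pairing tK tNK δ (act (KLFactor.finalBlock σ.length c b) Z) ≠ 0) :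
    δ = σ ++ (List.replicate b true ++ List.replicate c false) := by
  simp only [List.length_append, List.length_replicate] at hN
  have hS : SupportedOn (Between σ [] (b + c) (· ≤ b))
      (act (KLFactor.finalBlock σ.length c b) Z) := by
    have h0 : SupportedOn (Between σ [] (b + c) (· ≤ 0)) Z := by
      refine hZ.supportedOn ⟨List.replicate (c + b) false, by simp, ?_, ?_⟩
      · simp; omega
      · simp [List.count_replicate]
    have := h0.finalBlock (by omega) hσ σ.length b c (by omega) le_rfl (by omega)
    exact this.mono (Between.mono fun m h => by omega)
  obtain ⟨x, rfl, hx, hxb⟩ := hS δ hδ hne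
  have hE0 : ∀ j, σ.length ≤ j → j + 1 < N → shiftOp tK tNK j Z = 0 := by
    intro j hj hj'
    refine hZ.shiftOp_eq_zero _ hj' fun u v huv hu => ?_
    have h5 : (σ ++ List.replicate (c + b) false)[u.length + 1]? = some true := by
      rw [huv]; simp
    rw [List.getElem?_append_right (by omega), List.getElem?_replicate] at h5
    simp at h5
  have hs : x = List.replicate (x.count true) true ++ List.replicate (x.count false) false := by
    by_contra hx'
    exact hne (pairing_eq_zero_of_between (by simpa using hδ)
      (fun k h1 h2 => shiftOp_finalBlock _ _ _ _ _ hb (by omega) h1 (by omega) hE0) hx')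
  have hcount := List.count_false_add_count_true x
  rcases Nat.eq_or_lt_of_le hxb with hxb | hxb
  · rw [hxb, show x.count false = c by omega] at hs
    rw [hs]
    simp
  · exfalso
    apply hne
    -- With fewer than `b` letters 2 the sorted string ends in at least `c + 1` letters 1, and such
    -- pairings vanish by `pairing_finalBlock_eq_zero`.
    obtain ⟨d, hd⟩ : ∃ d, x.count false = d + (c + 1) := ⟨x.count false - (c + 1), by omega⟩
    rw [hd, List.replicate_add] at hs
    obtain ⟨e, rfl⟩ : ∃ e, b = e + 1 := ⟨b - 1, by omega⟩
    have := pairing_finalBlock_eq_zero Z σ.length e c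
      (σ ++ (List.replicate (x.count true) true ++ List.replicate d false)) (by omega)
      (by simp; omega) hE0
    rw [hs, List.append_nil]
    simpa using this

/-- Induction on the area: peeling gives a block applied to the vector of a smaller string. Support
and annihilation leave only `α`, and its coefficient is known to be `1`. -/
theorem isDual_factorProd (α : List Bool) (hα : α.length = N) : IsDual α (factorProd N α) := by
  induction hn : area α using Nat.strong_induction_on generalizing α with
  | _ n ih =>
    subst hn
    refine isDual_of_forall (pairing_factorProd_self α hα) fun δ hδ hne => ?_
    rcases exists_peel α with ⟨m, rfl⟩ | ⟨σ, b, c, hb, hσ, rfl | ⟨hc, τ, rfl⟩⟩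
    · obtain rfl : m = N := by simpa using hα
      have hbox : boxes 0 (List.replicate m false) = [] := by
        simpa [boxes] using boxes_replicate_false 0 m []
      rw [factorProd, hbox, act_nil, pairing_basisVec _ _ _ _ (by simp)] at hne
      by_contra h'
      have := area_lt_of_linkCoeff_ne_zero _ _ _ _ _ (by simp) hne (fun e => h' e.symm)
      rw [area_replicate_false] at this
      omega
    · rw [factorProd, act_boxes_peel_last _ _ _ _ hb hσ] at hne
      refine IsDual.finalBlock hb hσ hα (ih _ ?_ _ ?_ rfl) δ hδ hne
      · obtain ⟨d, rfl⟩ : ∃ d, b = d + 1 := ⟨b - 1, by omega⟩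
        simp only [List.replicate_succ, area_append, area_replicate_false, area, List.cons_append]
        simp
        ring_nf
        omega
      · simpa [add_comm] using hα
    · have hτ : HeadGE c (rho (List.replicate c true ++ τ)) := by
        obtain ⟨d, rfl⟩ : ∃ d, c = d + 1 := ⟨c - 1, by omega⟩
        exact headGE_rho_replicate d τ
      rw [factorProd, act_boxes_peel _ _ _ _ _ hb hc hσ hτ] at hne
      refine IsDual.block hb hc hσ ⟨τ, rfl⟩ hα (ih _ ?_ _ ?_ rfl) δ hδ hne
      · simp only [area_append, area_replicate_false, List.length_append,
          List.length_replicate]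
        have : 0 < b * c := Nat.mul_pos hb hc
        simp [List.count_replicate]
        nlinarith
      · simp at hα ⊢; omega

end


/-! ### The ordered list of the boxes of a string -/

/-- The content of the box of the row number `c + 1` at the node `k`, or `0`. -/
def boxContent : List Bool → ℕ → ℕ → ℕ
  | [], _, _ => 0
  | false :: _, _, 0 => 0
  | false :: a, c, k + 1 => boxContent a c k
  | true :: a, 0, k => (rho (true :: a)).getD k 0
  | true :: _, _ + 1, 0 => 0
  | true :: a, c + 1, k + 1 => boxContent a c k

/-- The number of letters `2` among the first `k + 1` letters. -/
def countUpTo (l : List Bool) (k : ℕ) : ℕ := (l.take (k + 1)).count true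

theorem boxContent_zero (l : List Bool) (k : ℕ) : boxContent l 0 k = (rho l).getD k 0 := by
  induction l generalizing k with
  | nil => simp [boxContent, rho]
  | cons a l ih =>
    cases a with
    | false => cases k <;> simp [boxContent, rho, ih]
    | true => cases k <;> rfl

theorem scan_getD (acc : ℕ) (X : List ℕ) (k : ℕ) (hk : k ≤ X.length) :
    (scan acc X).getD k 0 =
      max (if k = 0 then acc else (scan acc X).getD (k - 1) 0) (X.getD k 0) + 1 := by
  induction X generalizing acc k with
  | nil =>
    obtain rfl : k = 0 := by simpa using hk
    simp [scan]
  | cons x X ih =>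
    cases k with
    | zero => simp [scan]
    | succ k =>
      have := ih (max acc x + 1) k (by simpa using hk)
      simp only [scan, List.getD_cons_succ, this]
      cases k <;> simp

/-- The recursion of `r_{i,j}` in row coordinates: `(i-1, j-1)` is the previous box of the same row,
`(i+1, j-1)` the box of the next row at the next node. -/
theorem boxContent_eq (l : List Bool) (c k : ℕ) :
    boxContent l c k = if k < l.length ∧ c < countUpTo l k then
      max (if k = 0 then 0 else boxContent l c (k - 1)) (boxContent l (c + 1) (k + 1)) + 1
      else 0 := by
  induction l generalizing c k with
  | nil => simp [boxContent]
  | cons a l ih =>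
    cases a with
    | false =>
      cases k with
      | zero => simp [boxContent, countUpTo]
      | succ k =>
        have h : countUpTo (false :: l) (k + 1) = countUpTo l k := by simp [countUpTo]
        rw [h, boxContent, ih]
        cases k <;> simp [boxContent]
    | true =>
      cases c with
      | zero =>
        have h : 0 < countUpTo (true :: l) k := by simp [countUpTo]
        cases Nat.lt_or_ge k (l.length + 1) with
        | inl hk =>
          rw [if_pos ⟨by simpa using hk, h⟩]
          have := scan_getD 0 (rho l) k (by rw [length_rho]; omega)
          simp only [boxContent, rho, boxContent_zero]
          exact this
        | inr hk =>
          rw [if_neg (by simp; omega), boxContent_zero]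
          exact List.getD_eq_default _ _ (by rw [length_rho]; simpa using hk)
      | succ c =>
        cases k with
        | zero => simp [boxContent, countUpTo]
        | succ k =>
          have h : countUpTo (true :: l) (k + 1) = countUpTo l k + 1 := by simp [countUpTo]
          rw [h, boxContent, ih]
          cases k <;> simp [boxContent]

theorem row_eq_map (s : ℕ) (ps : List ℕ) :
    row s ps = (List.range ps.length).map fun k => (s + k, ps.getD k 0) := by
  induction ps generalizing s with
  | nil => rfl
  | cons p ps ih =>
    rw [row, ih, List.length_cons, List.range_succ_eq_map, List.map_cons, List.map_map]
    simp only [List.getD_cons_zero, add_zero, List.cons.injEq, true_and]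
    refine List.map_congr_left fun k _ => ?_
    simp only [Function.comp, Nat.succ_eq_add_one, List.getD_cons_succ]
    congr 1; omega

/-- The boxes of the row number `c + 1`. -/
def boxRow (s : ℕ) (l : List Bool) (c : ℕ) : List (ℕ × ℕ) :=
  ((List.range l.length).filter fun k => c < countUpTo l k).map fun k => (s + k, boxContent l c k)

theorem boxRow_shift (s : ℕ) (x : Bool) (l : List Bool) (c c' : ℕ)
    (h0 : ¬ c' < countUpTo (x :: l) 0)
    (h : ∀ k, c' < countUpTo (x :: l) (k + 1) ↔ c < countUpTo l k)
    (h' : ∀ k, boxContent (x :: l) c' (k + 1) = boxContent l c k) :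
    boxRow s (x :: l) c' = boxRow (s + 1) l c := by
  unfold boxRow
  rw [List.length_cons, List.range_succ_eq_map, List.filter_cons_of_neg (by simpa using h0),
    List.filter_map, List.map_map]
  have : ((fun k => decide (c' < countUpTo (x :: l) k)) ∘ Nat.succ) =
      fun k => decide (c < countUpTo l k) := by
    funext k
    simp [h]
  rw [this]
  refine List.map_congr_left fun k _ => ?_
  simp only [Function.comp, Nat.succ_eq_add_one, h']
  congr 1; omega

/-- A leading 1 only shifts the nodes; a leading 2 adds a new first row, whose factors stand at the
right end and act first. -/
theorem flatMap_boxRow (s : ℕ) (l : List Bool) :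
    (List.range l.length).reverse.flatMap (boxRow s l) = boxes s l := by
  induction l generalizing s with
  | nil => rfl
  | cons x l ih =>
    cases x with
    | false =>
      rw [List.length_cons, List.range_succ, List.reverse_append, List.reverse_singleton,
        List.singleton_append, List.flatMap_cons, boxes, ← ih]
      have h1 : boxRow s (false :: l) l.length = [] := by
        unfold boxRow
        rw [List.map_eq_nil_iff, List.filter_eq_nil_iff]
        intro k _
        have : countUpTo (false :: l) k ≤ l.length := by
          simp only [countUpTo, List.take_succ_cons]
          rw [List.count_cons_of_ne (by simp)]
          exact List.count_le_length.trans (by simp)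
        simpa using this
      rw [h1, List.nil_append]
      congr 1
      funext c
      exact boxRow_shift s false l c c (by simp [countUpTo]) (fun k => by simp [countUpTo])
        (fun k => rfl)
    | true =>
      rw [List.length_cons, List.range_succ_eq_map, List.reverse_cons, List.flatMap_append,
        boxes, ← ih, ← List.map_reverse, List.flatMap_map]
      congr 1
      · congr 1
        funext c
        exact boxRow_shift s true l c (c + 1) (by simp [countUpTo]) (fun k => by simp [countUpTo])
          (fun k => rfl)
      · rw [List.flatMap_singleton, row_eq_map, length_rho]
        unfold boxRow
        rw [List.filter_eq_self.2 fun k _ => by simp [countUpTo]]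
        rfl

section

variable {N : ℕ} (α : BinString N)

theorem pathHeight_eq (k : ℕ) (hk : k < N) :
    pathHeight α ((k : ℤ) + 1) = (k : ℤ) + 1 - 2 * countUpTo (letters α) k := by
  have key : ∀ (N : ℕ) (f : Fin N → Bool) (m : ℕ), m ≤ N →
      (∑ i : Fin N, if ((i : ℕ) : ℤ) < (m : ℤ) then (if f i = false then (1 : ℤ) else -1) else 0) =
        m - 2 * (((List.ofFn f).take m).count true : ℕ) := by
    intro N
    induction N with
    | zero => intro f m hm; obtain rfl : m = 0 := by omega
              simp
    | succ N ih =>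
      intro f m hm
      cases m with
      | zero =>
        simp only [List.take_zero, List.count_nil]
        refine (Finset.sum_eq_zero fun i _ => ?_).trans (by simp)
        rw [if_neg (by simp)]
      | succ m =>
        rw [Fin.sum_univ_succ, List.ofFn_succ, List.take_succ_cons]
        have := ih (fun i => f i.succ) m (by omega)
        have e : (∑ i : Fin N, if ((i.succ : ℕ) : ℤ) < ((m + 1 : ℕ) : ℤ) then
            (if f i.succ = false then (1 : ℤ) else -1) else 0) =
            m - 2 * (((List.ofFn fun i => f i.succ).take m).count true : ℕ) := by
          rw [← this]
          refine Finset.sum_congr rfl fun i _ => ?_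
          simp
        rw [e]
        cases f 0 <;> simp <;> ring
  have := key N (fun i => decide (α i = 1)) (k + 1) (by omega)
  push_cast at this
  rw [countUpTo, letters, ← this, pathHeight]
  refine Finset.sum_congr rfl fun i _ => ?_
  have : α i = 0 ↔ ¬ α i = 1 := by
    generalize α i = a
    fin_cases a <;> simp
  simp [this]

theorem isBox_iff (k c : ℕ) : IsBox α ((k : ℤ) + 1) ((k : ℤ) - 2 * (c : ℤ)) ↔
    k < (letters α).length ∧ c < countUpTo (letters α) k := by
  rw [length_letters]
  constructor
  · rintro ⟨h1, -, h2, -, -⟩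
    have hk : k < N := by omega
    rw [pathHeight_eq α k hk] at h1
    omega
  · rintro ⟨hk, h1⟩
    have h2 : countUpTo (letters α) k ≤ k + 1 := by
      unfold countUpTo
      exact List.count_le_length.trans (by simp)
    refine ⟨?_, by omega, by omega, ?_, ?_⟩
    · rw [pathHeight_eq α k hk]; omega
    · rw [abs_le]; omega
    · exact ⟨(k : ℤ) - c, by ring⟩

theorem boxHeight_eq (k c : ℕ) :
    boxHeight α ((k : ℤ) + 1) ((k : ℤ) - 2 * (c : ℤ)) = boxContent (letters α) c k := by
  -- Both boxes in the recursion have second coordinate one smaller; adding `2 * N` keeps the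
  -- measure positive on boxes.
  induction hn : ((k : ℤ) - 2 * (c : ℤ) + 2 * N).toNat using Nat.strong_induction_on
    generalizing k c with
  | _ n ih =>
    subst hn
    rw [boxHeight, boxContent_eq]
    by_cases h : IsBox α ((k : ℤ) + 1) ((k : ℤ) - 2 * (c : ℤ))
    · have h' := (isBox_iff α k c).1 h
      rw [dif_pos h, if_pos h']
      have hk : k < N := by simpa [length_letters] using h'.1
      have h2 : countUpTo (letters α) k ≤ k + 1 := by
        unfold countUpTo
        exact List.count_le_length.trans (by simp)
      have e1 : boxHeight α ((k : ℤ) + 1 + 1) ((k : ℤ) - 2 * (c : ℤ) - 1) =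
          boxContent (letters α) (c + 1) (k + 1) := by
        have := ih _ (by push_cast; omega) (k + 1) (c + 1) rfl
        push_cast at this
        rw [← this]
        congr 1; ring
      rw [e1]
      congr 2
      cases k with
      | zero =>
        rw [if_pos rfl, boxHeight, dif_neg]
        rintro ⟨-, h0, -⟩
        simp at h0
      | succ k =>
        have := ih _ (by push_cast; omega) k c rfl
        rw [if_neg (by omega), Nat.add_sub_cancel, ← this]
        push_cast
        congr 1 <;> ring
    · rw [dif_neg h, if_neg (fun h' => h ((isBox_iff α k c).2 h'))]

theorem boxList_map :
    ((boxList α).map fun b => ((b.1 : ℕ), boxHeight α (((b.1 : ℕ) : ℤ) + 1) b.2)) =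
      boxes 0 (letters α) := by
  rw [← flatMap_boxRow, length_letters, boxList, List.filter_flatMap, List.map_flatMap,
    ← List.map_coe_finRange_eq_range, ← List.map_reverse, List.flatMap_map]
  congr 1
  funext c
  unfold boxRow
  rw [List.filter_map, List.map_map, length_letters, ← List.map_coe_finRange_eq_range,
    List.filter_map, List.map_map]
  have : (fun b : Fin N × ℤ =>
        @decide (IsBox α (((b.1 : ℕ) : ℤ) + 1) b.2) (Classical.propDecidable _)) ∘
        (fun k : Fin N => (k, ((k : ℕ) : ℤ) - 2 * ((c : ℕ) : ℤ))) =
      (fun k => decide ((c : ℕ) < countUpTo (letters α) k)) ∘ fun k : Fin N => (k : ℕ) := by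
    funext k
    simp [isBox_iff, length_letters]
  rw [this]
  refine List.map_congr_left fun k _ => ?_
  simp [boxHeight_eq]

theorem word_map : (word α).map (fun i : Fin N => (i : ℕ)) = (boxes 0 (letters α)).map Prod.fst := by
  rw [← boxList_map, word, List.map_map, List.map_map]
  rfl

theorem factorized_eq : factorized α = factorProd N (letters α) := by
  have key : ∀ (L : List (Fin N × ℤ)) (f : Fin N × ℤ → ℕ) (Z : StringModule RatField N),
      ((L.map fun b => factorOp b.1 (f b)).prod) Z =
        act (L.map fun b => ((b.1 : ℕ), f b)) Z := by
    intro L f Z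
    induction L with
    | nil => rfl
    | cons b L ih =>
      rw [List.map_cons, List.prod_cons, Module.End.mul_apply, ih, List.map_cons, act_cons]
      simp [facOp]
  rw [factorized, key, boxList_map, factorProd, basisVec, ofLetters_replicate]

end


/-! ### The negative part of the ground ring -/

/-- The Laurent monomials as a homomorphism. -/
def monomialHom : Multiplicative (ℤ × ℤ) →* LaurentRingˣ where
  toFun e := monomialUnit e.toAdd
  map_one' := rfl
  map_mul' a b := by
    ext1
    simp [monomialUnit, AddMonoidAlgebra.single_mul_single]

theorem tPar_zpow_mul (i j : ℤ) : tPar ^ i * tNPar ^ j = monomialUnit (i, j) := by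
  have h1 := map_zpow monomialHom (Multiplicative.ofAdd ((1, 0) : ℤ × ℤ)) i
  have h2 := map_zpow monomialHom (Multiplicative.ofAdd ((0, 1) : ℤ × ℤ)) j
  have h3 := map_mul monomialHom (Multiplicative.ofAdd ((1, 0) : ℤ × ℤ) ^ i)
    (Multiplicative.ofAdd ((0, 1) : ℤ × ℤ) ^ j)
  rw [h1, h2] at h3
  refine h3.symm.trans ?_
  show monomialUnit (i • ((1, 0) : ℤ × ℤ) + j • ((0, 1) : ℤ × ℤ)) = _
  simp

theorem negSpan_monomial (i j : ℤ) (h : i < 0 ∨ (i = 0 ∧ j < 0)) :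
    ((tPar ^ i * tNPar ^ j : LaurentRingˣ) : LaurentRing) ∈ negSpan :=
  AddSubgroup.subset_closure ⟨i, j, h, rfl⟩

theorem coeff_of_mem_negSpan {x : LaurentRing} (hx : x ∈ negSpan) (i j : ℤ)
    (h : x.coeff (i, j) ≠ 0) : i < 0 ∨ (i = 0 ∧ j < 0) := by
  induction hx using AddSubgroup.closure_induction with
  | mem x hx =>
    obtain ⟨a, b, hab, rfl⟩ := hx
    rw [tPar_zpow_mul] at h
    have e : (a, b) = (i, j) := by
      by_contra hne
      exact h (Finsupp.single_eq_of_ne (Ne.symm hne))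
    simp only [Prod.mk.injEq] at e
    rw [← e.1, ← e.2]
    exact hab
  | zero => simp at h
  | add x y _ _ hx hy =>
    by_cases h1 : x.coeff (i, j) = 0
    · by_cases h2 : y.coeff (i, j) = 0
      · simp [AddMonoidAlgebra.coeff_add, h1, h2] at h
      · exact hy h2
    · exact hx h1
  | neg x _ hx => exact hx (by simpa [AddMonoidAlgebra.coeff_neg] using h)

/-- The bar involution negates exponents, and no exponent is negative together with its opposite. -/
theorem eq_zero_of_mem_negSpan {x : LaurentRing} (hx : x ∈ negSpan) (hbar : barRing x = x) :
    x = 0 := by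
  by_contra hne
  obtain ⟨⟨i, j⟩, he⟩ := Finsupp.ne_iff.1 fun h => hne (AddMonoidAlgebra.coeff_eq_zero.1 h)
  have h1 := coeff_of_mem_negSpan hx i j (by simpa using he)
  have h2 : (barRing x).coeff (-i, -j) = x.coeff (i, j) := by
    have := AddMonoidAlgebra.coeff_domCongr (R := ℂ) (A := ℂ) (AddEquiv.neg (ℤ × ℤ)) x (-i, -j)
    refine this.trans ?_
    simp
  rw [hbar] at h2
  have h3 := coeff_of_mem_negSpan hx (-i) (-j) (by rw [h2]; simpa using he)
  omega

theorem negSpan_mul {x y : LaurentRing} (hx : x ∈ negSpan) (hy : y ∈ negSpan) :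
    x * y ∈ negSpan := by
  induction hx using AddSubgroup.closure_induction with
  | mem x hx =>
    obtain ⟨a, b, hab, rfl⟩ := hx
    induction hy using AddSubgroup.closure_induction with
    | mem y hy =>
      obtain ⟨c, d, hcd, rfl⟩ := hy
      rw [← Units.val_mul, tPar_zpow_mul, tPar_zpow_mul]
      have : monomialUnit (a, b) * monomialUnit (c, d) = monomialUnit (a + c, b + d) :=
        (map_mul monomialHom (Multiplicative.ofAdd (a, b)) (Multiplicative.ofAdd (c, d))).symm
      rw [this, ← tPar_zpow_mul]
      exact negSpan_monomial _ _ (by omega)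
    | zero => rw [mul_zero]; exact zero_mem _
    | add y z _ _ hy hz => rw [mul_add]; exact add_mem hy hz
    | neg y _ hy => rw [mul_neg]; exact neg_mem hy
  | zero => rw [zero_mul]; exact zero_mem _
  | add x z _ _ hx hz => rw [add_mul]; exact add_mem hx hz
  | neg x _ hx => rw [neg_mul]; exact neg_mem hx

theorem rayPar_mem_negSpan (b : Bool) : rayPar tPar tNPar b ∈ negSpan := by
  cases b with
  | false =>
    have := negSpan_monomial 0 (-1) (by omega)
    simp only [zpow_zero, one_mul, zpow_neg_one] at this
    exact neg_mem this
  | true =>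
    have := negSpan_monomial (-1) 1 (by omega)
    simpa [rayPar] using this

theorem tPar_inv_mem_negSpan : ((tPar⁻¹ : LaurentRingˣ) : LaurentRing) ∈ negSpan := by
  simpa using negSpan_monomial (-1) 0 (by omega)

theorem rayWeight_mem_negSpan (S : List Bool) (b : Bool) :
    rayWeight tPar tNPar b S ∈ negSpan ∨ (true ∉ S ∧ rayWeight tPar tNPar b S = 1) := by
  induction S generalizing b with
  | nil => exact Or.inr ⟨by simp, rfl⟩
  | cons f S ih =>
    cases f with
    | false => simpa [rayWeight] using ih (!b)
    | true =>
      left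
      simp only [rayWeight, if_true]
      rcases ih (!b) with h | ⟨-, h⟩
      · exact negSpan_mul (rayPar_mem_negSpan b) h
      · rw [h, mul_one]; exact rayPar_mem_negSpan b

/-- Every flip contributes `-t⁻¹`, `-t_N⁻¹` or `t⁻¹t_N`, all in `ℤ(Γ₋)`, which is closed under
products. For the last one it matters that `t` dominates `t_N`. -/
theorem linkCoeff_mem_negSpan_or (S δ γ : List Bool) :
    linkCoeff tPar tNPar S δ γ ∈ negSpan ∨
      (true ∉ S ∧ γ = δ ∧ linkCoeff tPar tNPar S δ γ = 1) := by
  induction δ generalizing S γ with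
  | nil =>
    cases γ with
    | nil =>
      rcases rayWeight_mem_negSpan S false with h | ⟨h1, h2⟩
      · left; simpa [linkCoeff] using h
      · right; exact ⟨h1, rfl, by simpa [linkCoeff] using h2⟩
    | cons g γ => left; simp [linkCoeff]
  | cons a δ ih =>
    cases γ with
    | nil => left; cases a <;> cases S <;> simp [linkCoeff]
    | cons g γ =>
      cases a with
      | false =>
        simp only [linkCoeff]
        rcases ih (g :: S) γ with h | ⟨h1, h2, h3⟩
        · exact Or.inl h
        · right
          simp only [List.mem_cons, not_or] at h1
          cases g
          · exact ⟨h1.2, by rw [h2], h3⟩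
          · simp at h1
      | true =>
        cases S with
        | nil =>
          cases g
          · left; simp [linkCoeff]
          · simp only [linkCoeff, if_true]
            rcases ih [] γ with h | ⟨h1, h2, h3⟩
            · exact Or.inl h
            · exact Or.inr ⟨h1, by rw [h2], h3⟩
        | cons f S =>
          cases f <;> cases g <;> simp only [linkCoeff, if_true, if_false, reduceCtorEq, one_mul,
            Bool.false_eq_true]
          · left; exact zero_mem _
          · rcases ih S γ with h | ⟨h1, h2, h3⟩
            · exact Or.inl h
            · exact Or.inr ⟨by simpa using h1, by rw [h2], h3⟩
          · left
            rw [neg_mul]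
            refine neg_mem ?_
            rcases ih S γ with h | ⟨h1, h2, h3⟩
            · exact negSpan_mul tPar_inv_mem_negSpan h
            · rw [h3, mul_one]; exact tPar_inv_mem_negSpan
          · left; exact zero_mem _

theorem linkCoeff_mem_negSpan (δ γ : List Bool) (h : δ ≠ γ) :
    linkCoeff tPar tNPar [] δ γ ∈ negSpan := by
  rcases linkCoeff_mem_negSpan_or [] δ γ with h1 | ⟨-, h1, -⟩
  · exact h1
  · exact absurd h1.symm h

/-! ### The dual basis over the Laurent polynomials -/

section

variable {N : ℕ}

theorem exists_dual (α : BinString N) : ∃ x : StringModule LaurentRing N,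
    (∀ δ : List Bool, δ.length = N →
      pairing tPar tNPar δ x = if δ = letters α then 1 else 0) ∧
    x α = 1 ∧ (∀ β, β ≠ α → x β ∈ negSpan) ∧
    ∀ β, β ≠ α → x β ≠ 0 → area (letters β) < area (letters α) := by
  induction hn : area (letters α) using Nat.strong_induction_on generalizing α with
  | _ n ih =>
    subst hn
    choose! f h1 h2 h3 h4 using fun (γ : BinString N)
      (hγ : area (letters γ) < area (letters α)) => ih _ hγ γ rfl
    set I : Finset (BinString N) := Finset.univ.filter fun γ => area (letters γ) < area (letters α)
    -- Inverting a unitriangular matrix: remove from `m_α` its pairings with the strings of smaller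
    -- area, using the dual vectors already found.
    refine ⟨basisVec LaurentRing N (letters α) -
      ∑ γ ∈ I, linkCoeff tPar tNPar [] (letters γ) (letters α) • f γ, ?_, ?_, ?_, ?_⟩
    · intro δ hδ
      rw [map_sub, map_sum, pairing_basisVec _ _ _ _ (length_letters α)]
      have e : ∀ γ ∈ I, pairing tPar tNPar δ
          (linkCoeff tPar tNPar [] (letters γ) (letters α) • f γ) =
          if letters γ = δ then linkCoeff tPar tNPar [] δ (letters α) else 0 := by
        intro γ hγ
        rw [map_smul, h1 γ (Finset.mem_filter.1 hγ).2 δ hδ, smul_eq_mul]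
        by_cases e : letters γ = δ
        · simp [e]
        · simp [e, Ne.symm e]
      rw [Finset.sum_congr rfl e]
      by_cases hlt : area δ < area (letters α)
      · rw [Finset.sum_eq_single (ofLetters N δ)]
        · rw [letters_ofLetters δ hδ, if_pos rfl, sub_self, if_neg]
          rintro rfl
          omega
        · intro γ _ hne
          rw [if_neg]
          rintro rfl
          exact hne (ofLetters_letters γ).symm
        · intro hI
          exfalso
          apply hI
          simp only [I, Finset.mem_filter, Finset.mem_univ, true_and, letters_ofLetters δ hδ, hlt]
      · rw [Finset.sum_eq_zero, sub_zero]
        · by_cases e : δ = letters α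
          · rw [if_pos e, e, linkCoeff_self _ _ _ _ (by simp)]
          · rw [if_neg e]
            by_contra hne
            exact hlt (area_lt_of_linkCoeff_ne_zero _ _ _ _ _ (by simp) hne (Ne.symm e))
        · intro γ hγ
          rw [if_neg]
          rintro rfl
          exact hlt (Finset.mem_filter.1 hγ).2
    all_goals
      have hb : ∀ β : BinString N, basisVec LaurentRing N (letters α) β = if α = β then 1 else 0 := by
        intro β
        rw [basisVec, ofLetters_letters, Finsupp.single_apply]
    · rw [Finsupp.sub_apply, Finsupp.finsetSum_apply, hb, if_pos rfl, Finset.sum_eq_zero, sub_zero]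
      intro γ hγ
      have hlt := (Finset.mem_filter.1 hγ).2
      rw [Finsupp.smul_apply, smul_eq_mul]
      by_contra hne
      have h0 : α ≠ γ := by rintro rfl; omega
      have := h4 γ hlt α h0 (right_ne_zero_of_mul hne)
      omega
    · intro β hβ
      rw [Finsupp.sub_apply, Finsupp.finsetSum_apply, hb, if_neg hβ.symm, zero_sub]
      refine neg_mem (sum_mem fun γ hγ => ?_)
      have hlt := (Finset.mem_filter.1 hγ).2
      have h5 := linkCoeff_mem_negSpan (letters γ) (letters α) (by intro e; rw [e] at hlt; omega)
      rw [Finsupp.smul_apply, smul_eq_mul]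
      by_cases e : β = γ
      · rw [e, h2 γ hlt, mul_one]; exact h5
      · exact negSpan_mul h5 (h3 γ hlt β e)
    · intro β hβ hne
      rw [Finsupp.sub_apply, Finsupp.finsetSum_apply, hb, if_neg hβ.symm, zero_sub,
        neg_ne_zero] at hne
      obtain ⟨γ, hγ, hne⟩ := Finset.exists_ne_zero_of_sum_ne_zero hne
      have hlt := (Finset.mem_filter.1 hγ).2
      rw [Finsupp.smul_apply, smul_eq_mul] at hne
      by_cases e : β = γ
      · rw [e]; exact hlt
      · exact (h4 γ hlt β e (right_ne_zero_of_mul hne)).trans hlt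

/-- The basis that is dual to the vectors of the link patterns. -/
def dualBasis (α : BinString N) : StringModule LaurentRing N := (exists_dual α).choose

theorem pairing_dualBasis (α : BinString N) (δ : List Bool) (hδ : δ.length = N) :
    pairing tPar tNPar δ (dualBasis α) = if δ = letters α then 1 else 0 :=
  (exists_dual α).choose_spec.1 δ hδ

theorem dualBasis_self (α : BinString N) : dualBasis α α = 1 := (exists_dual α).choose_spec.2.1

theorem dualBasis_mem (α β : BinString N) (h : α ≠ β) : dualBasis β α ∈ negSpan :=
  (exists_dual β).choose_spec.2.2.1 α h

theorem linkCoeff_map {A B : Type} [CommRing A] [CommRing B] (φ : A →+* B) (t s : Aˣ)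
    (S δ γ : List Bool) :
    linkCoeff (Units.map (φ : A →* B) t) (Units.map (φ : A →* B) s) S δ γ =
      φ (linkCoeff t s S δ γ) := by
  have hr : ∀ (S : List Bool) (b : Bool),
      rayWeight (Units.map (φ : A →* B) t) (Units.map (φ : A →* B) s) b S =
        φ (rayWeight t s b S) := by
    intro S
    induction S with
    | nil => intro b; simp [rayWeight]
    | cons f S ih => intro b; cases f <;> cases b <;> simp [rayWeight, rayPar, ih]
  induction δ generalizing S γ with
  | nil => cases γ <;> simp [linkCoeff, hr]
  | cons a δ ih =>
    cases γ with
    | nil => cases a <;> cases S <;> simp [linkCoeff]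
    | cons g γ =>
      cases a with
      | false => simp [linkCoeff, ih]
      | true =>
        cases S with
        | nil => cases g <;> simp [linkCoeff, ih]
        | cons f S => cases f <;> cases g <;> simp [linkCoeff, ih]

theorem pairing_extendScalars (δ : List Bool) (x : StringModule LaurentRing N) :
    pairing tK tNK δ (extendScalars x) =
      algebraMap LaurentRing RatField (pairing tPar tNPar δ x) := by
  rw [pairing_eq_sum, pairing_eq_sum, map_sum]
  refine Finset.sum_congr rfl fun γ _ => ?_
  rw [map_mul, ← linkCoeff_map]
  rfl

theorem factorized_eq_extendScalars (α : BinString N) :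
    factorized α = extendScalars (dualBasis α) := by
  refine eq_of_pairing tK tNK fun δ hδ => ?_
  rw [factorized_eq, isDual_factorProd _ (length_letters α) δ hδ, pairing_extendScalars,
    pairing_dualBasis α δ hδ]
  split_ifs <;> simp

theorem eq_sum_dualBasis (x : StringModule LaurentRing N) :
    x = ∑ γ : BinString N, pairing tPar tNPar (letters γ) x • dualBasis γ := by
  refine eq_of_pairing tPar tNPar fun δ hδ => ?_
  rw [map_sum, Finset.sum_eq_single (ofLetters N δ)]
  · rw [map_smul, pairing_dualBasis _ _ hδ, letters_ofLetters δ hδ]; simp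
  · intro γ _ hne
    rw [map_smul, pairing_dualBasis _ _ hδ, if_neg, smul_zero]
    rintro rfl
    exact hne (ofLetters_letters γ).symm
  · simp

theorem linearIndependent_dualBasis :
    LinearIndependent LaurentRing (dualBasis : BinString N → StringModule LaurentRing N) := by
  rw [Fintype.linearIndependent_iff]
  intro g hg α
  have h := congrArg (pairing tPar tNPar (letters α)) hg
  rw [map_sum, map_zero, Finset.sum_eq_single α] at h
  · simpa [pairing_dualBasis _ _ (length_letters α)] using h
  · intro γ _ hne
    rw [map_smul, pairing_dualBasis _ _ (length_letters α), if_neg, smul_zero]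
    exact fun e => hne (letters_injective e).symm
  · simp

theorem span_dualBasis :
    Submodule.span LaurentRing
      (Set.range (dualBasis : BinString N → StringModule LaurentRing N)) = ⊤ := by
  refine eq_top_iff.2 fun x _ => ?_
  rw [eq_sum_dualBasis x]
  exact Submodule.sum_mem _ fun γ _ =>
    Submodule.smul_mem _ _ (Submodule.subset_span ⟨γ, rfl⟩)

/-! ### The bar involution -/

theorem barRing_tPar : barRing (tPar : LaurentRing) = ((tPar⁻¹ : LaurentRingˣ) : LaurentRing) :=
  barRing_monomialUnit _

theorem barRing_tNPar : barRing (tNPar : LaurentRing) = ((tNPar⁻¹ : LaurentRingˣ) : LaurentRing) :=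
  barRing_monomialUnit _

theorem barRing_monomialUnit_inv (e : ℤ × ℤ) :
    barRing ((monomialUnit e)⁻¹ : LaurentRingˣ) = (monomialUnit e : LaurentRing) := by
  simp [barRing, monomialUnit, Units.inv_mk]

theorem barRing_tPar_inv :
    barRing ((tPar⁻¹ : LaurentRingˣ) : LaurentRing) = (tPar : LaurentRing) :=
  barRing_monomialUnit_inv _

theorem barRing_tNPar_inv :
    barRing ((tNPar⁻¹ : LaurentRingˣ) : LaurentRing) = (tNPar : LaurentRing) :=
  barRing_monomialUnit_inv _

theorem barRing_joinWeight (n : ℕ) :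
    barRing (joinWeight tPar tNPar n) = joinWeight tPar tNPar n := by
  unfold joinWeight
  split_ifs
  · simp only [map_add, map_mul, barRing_tPar, barRing_tNPar, barRing_tPar_inv, barRing_tNPar_inv]
    ring
  · simp only [map_add, map_neg, barRing_tNPar, barRing_tNPar_inv]
    ring

/-- Bar invariance of the scalar in each of the local relations; this is the source of the bar
invariance of the dual basis. -/
theorem exists_pairing_shiftOp (δ : List Bool) (hδ : δ.length = N) (k : ℕ) (hk : k < N) :
    ∃ (c : LaurentRing) (δ' : List Bool), δ'.length = N ∧ barRing c = c ∧
      ∀ Z : StringModule LaurentRing N,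
        pairing tPar tNPar δ (shiftOp tPar tNPar k Z) = c * pairing tPar tNPar δ' Z := by
  rcases Nat.lt_or_ge (k + 1) N with hk' | hk'
  · obtain ⟨u, a, b, v, rfl, rfl⟩ : ∃ u a b v, δ = u ++ a :: b :: v ∧ u.length = k := by
      refine ⟨δ.take k, δ[k], δ[k + 1], δ.drop (k + 2), ?_, by simp; omega⟩
      simp
    have hl : ∀ a b, (u ++ a :: b :: v).length = N := by intro a b; simpa using hδ
    cases a <;> cases b
    · cases hv : endHeight 0 v with
      | some n =>
        exact ⟨_, _, hl _ _, barRing_joinWeight n,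
          fun Z => pairing_shiftOp_up_free _ _ Z u v n hv hδ⟩
      | none =>
        obtain ⟨w, v', rfl, hw⟩ := exists_excursion_of_endHeight_eq_none 0 v hv
        refine ⟨1, u ++ false :: true :: (w ++ false :: v'), by simpa using hδ, map_one _,
          fun Z => ?_⟩
        rw [pairing_shiftOp_up_bound _ _ Z u w v' hw hδ, one_mul]
    · refine ⟨_, _, hl _ _, ?_, fun Z => pairing_shiftOp_peak _ _ Z u v hδ⟩
      simp only [map_add, map_neg, barRing_tPar, barRing_tPar_inv]
      ring
    · refine ⟨1, _, hl false true, map_one _, fun Z => ?_⟩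
      rw [pairing_shiftOp_valley _ _ Z u v hδ, one_mul]
    · rcases pairing_shiftOp_down tPar tNPar u v hδ with ⟨u', w, rfl, hw, h⟩ | h
      · refine ⟨1, u' ++ true :: (w ++ false :: true :: v), by simpa using hδ, map_one _,
          fun Z => ?_⟩
        rw [h, one_mul]
      · exact ⟨0, _, hδ, map_zero _, fun Z => by rw [h, zero_mul]⟩
  · rcases List.eq_nil_or_concat δ with rfl | ⟨u, a, rfl⟩
    · simp at hδ; omega
    rw [List.concat_eq_append] at *
    obtain rfl : u.length = k := by simp at hδ; omega
    cases a with
    | true =>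
      exact ⟨1, u ++ [false], by simpa using hδ, map_one _,
        fun Z => by rw [pairing_shiftOp_last_true _ _ _ _ hδ, one_mul]⟩
    | false =>
      refine ⟨_, _, hδ, ?_, fun Z => pairing_shiftOp_last_false _ _ Z u hδ⟩
      simp only [map_add, map_neg, barRing_tNPar, barRing_tNPar_inv]
      ring

/-- The semilinear involution that fixes the dual basis. -/
def dualBar (x : StringModule LaurentRing N) : StringModule LaurentRing N :=
  ∑ γ : BinString N, barRing (pairing tPar tNPar (letters γ) x) • dualBasis γ

theorem pairing_dualBar (δ : List Bool) (hδ : δ.length = N) (x : StringModule LaurentRing N) :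
    pairing tPar tNPar δ (dualBar x) = barRing (pairing tPar tNPar δ x) := by
  rw [dualBar, map_sum, Finset.sum_eq_single (ofLetters N δ)]
  · rw [map_smul, pairing_dualBasis _ _ hδ, letters_ofLetters δ hδ]; simp
  · intro γ _ hne
    rw [map_smul, pairing_dualBasis _ _ hδ, if_neg, smul_zero]
    rintro rfl
    exact hne (ofLetters_letters γ).symm
  · simp

theorem dualBar_shiftOp (k : ℕ) (hk : k < N) (x : StringModule LaurentRing N) :
    dualBar (shiftOp tPar tNPar k x) = shiftOp tPar tNPar k (dualBar x) := by
  refine eq_of_pairing tPar tNPar fun δ hδ => ?_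
  obtain ⟨c, δ', hδ', hc, h⟩ := exists_pairing_shiftOp δ hδ k hk
  rw [pairing_dualBar δ hδ, h, h, pairing_dualBar δ' hδ', map_mul, hc]

theorem dualBar_add (x y : StringModule LaurentRing N) :
    dualBar (x + y) = dualBar x + dualBar y := by
  simp [dualBar, add_smul, Finset.sum_add_distrib]

theorem dualBar_smul (c : LaurentRing) (x : StringModule LaurentRing N) :
    dualBar (c • x) = barRing c • dualBar x := by
  simp [dualBar, Finset.smul_sum, mul_smul]

/-- The string `1…1` has area `0`, so `m_{1…1}` pairs to zero with every other pattern. -/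
theorem dualBar_allOnes :
    dualBar (Finsupp.single (allOnes N) 1 : StringModule LaurentRing N) =
      Finsupp.single (allOnes N) 1 := by
  refine eq_of_pairing tPar tNPar fun δ hδ => ?_
  rw [pairing_dualBar δ hδ]
  have : (Finsupp.single (allOnes N) 1 : StringModule LaurentRing N) =
      basisVec LaurentRing N (List.replicate N false) := by
    rw [basisVec, ofLetters_replicate]
  rw [this, pairing_basisVec _ _ _ _ (by simp)]
  by_cases h : δ = List.replicate N false
  · rw [h, linkCoeff_self _ _ _ _ (by simp), map_one]
  · have h0 : linkCoeff tPar tNPar [] δ (List.replicate N false) = 0 := by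
      by_contra hne
      have := area_lt_of_linkCoeff_ne_zero _ _ _ _ _ (by simp) hne (Ne.symm h)
      rw [area_replicate_false] at this
      omega
    rw [h0, map_zero]

/-- `T_i = E_i + q_i` becomes `E_i + q_i⁻¹`, which is the inverse of `T_i`. -/
theorem dualBar_genOp (i : Fin N) (x : StringModule LaurentRing N) :
    dualBar (genOp tPar tNPar i x) =
      heckeAction N (((heckeUnit i)⁻¹ : (Hecke N)ˣ) : Hecke N) (dualBar x) := by
  have e : ∀ y : StringModule LaurentRing N, genOp tPar tNPar i y =
      shiftOp tPar tNPar i y + (nodePar tPar tNPar i : LaurentRing) • y := by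
    intro y
    simp [shiftOp]
  have e1 : (((heckeUnit i)⁻¹ : (Hecke N)ˣ) : Hecke N) = heckeGen i -
      algebraMap LaurentRing (Hecke N)
        ((nodePar tPar tNPar i : LaurentRing) - ((nodePar tPar tNPar i)⁻¹ : LaurentRingˣ)) := rfl
  rw [e, dualBar_add, dualBar_smul, dualBar_shiftOp _ i.2, (barRing_nodePar i).1, e1, map_sub,
    heckeAction_gen, AlgHom.commutes, LinearMap.sub_apply, e, Module.algebraMap_end_apply, sub_smul]
  abel

theorem prod_genOp_of_ascPath {A : Type} [CommRing A] (t s : Aˣ) {γ γ' : List Bool}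
    (ω : List (Fin N)) (h : AscPath (ω.map fun i : Fin N => (i : ℕ)) γ γ') (hγ : γ.length = N) :
    (ω.map (genOp t s)).prod (basisVec A N γ) = basisVec A N γ' := by
  induction hl : ω.map (fun i : Fin N => (i : ℕ)) generalizing ω γ' with
  | nil =>
    rw [hl] at h
    obtain rfl : ω = [] := by simpa using hl
    cases h
    simp
  | cons k l ih =>
    match ω, hl with
    | i :: ω, hl =>
      simp only [List.map_cons, List.cons.injEq] at hl
      rw [List.map_cons] at h
      rw [List.map_cons, List.prod_cons, Module.End.mul_apply]
      generalize hi : (i : ℕ) = j at h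
      cases h with
      | @swap _ _ u v h =>
        rw [ih ω h hl.2]
        have hlen := h.length_eq.trans hγ
        have hu : u.length < N := hi ▸ i.2
        rw [show i = ⟨u.length, hu⟩ from Fin.ext hi, genOp_basisVec_swap _ _ _ _ _ _ hlen]
        simp
      | @flip _ _ u h =>
        rw [ih ω h hl.2]
        have hlen := h.length_eq.trans hγ
        have hu : u.length < N := hi ▸ i.2
        rw [show i = ⟨u.length, hu⟩ from Fin.ext hi, genOp_basisVec_flip _ _ _ _ hlen]
        simp

theorem heckeAction_prod (ω : List (Fin N)) :
    heckeAction N ((ω.map heckeGen).prod) = (ω.map (genOp tPar tNPar)).prod := by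
  rw [map_list_prod, List.map_map]
  congr 2
  funext i
  exact heckeAction_gen i

theorem ascPath_word (α : BinString N) :
    AscPath ((word α).map fun i : Fin N => (i : ℕ)) (List.replicate N false) (letters α) := by
  have := ascPath_boxes [] (letters α)
  rw [length_letters] at this
  rw [word_map]
  exact this

theorem heckeAction_heckeWord (α : BinString N) :
    heckeAction N (heckeWord α) (Finsupp.single (allOnes N) 1) = Finsupp.single α 1 := by
  have := prod_genOp_of_ascPath tPar tNPar _ (ascPath_word α) (by simp)
  rw [← heckeAction_prod] at this
  rwa [basisVec, basisVec, ofLetters_replicate, ofLetters_letters] at this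

theorem dualBar_heckeWord (ω : List (Fin N)) :
    dualBar (heckeAction N ((ω.map heckeGen).prod) (Finsupp.single (allOnes N) 1)) =
      heckeAction N (barHecke N ((ω.map heckeGen).prod)) (Finsupp.single (allOnes N) 1) := by
  induction ω with
  | nil => simpa using dualBar_allOnes
  | cons i ω ih =>
    rw [List.map_cons, List.prod_cons, map_mul, map_mul, map_mul, Module.End.mul_apply,
      heckeAction_gen, dualBar_genOp, ih, barHecke_gen, Module.End.mul_apply]

theorem barModule_eq_dualBar (x : StringModule LaurentRing N) : barModule x = dualBar x := by
  have h1 : ∀ (α : BinString N) (c : LaurentRing), dualBar (Finsupp.single α c) =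
      barRing c • heckeAction N (barHecke N (heckeWord α)) (Finsupp.single (allOnes N) 1) := by
    intro α c
    have : (Finsupp.single α c : StringModule LaurentRing N) = c • Finsupp.single α 1 := by simp
    rw [this, dualBar_smul]
    congr 1
    rw [← heckeAction_heckeWord α]
    exact dualBar_heckeWord _
  have h2 : dualBar (∑ α : BinString N, Finsupp.single α (x α)) =
      ∑ α : BinString N, dualBar (Finsupp.single α (x α)) :=
    map_sum (AddMonoidHom.mk' (dualBar (N := N)) dualBar_add) _ _
  have h3 : ∑ α : BinString N, Finsupp.single α (x α) = x := Finsupp.univ_sum_single x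
  rw [h3] at h2
  rw [h2, barModule, Finsupp.sum_fintype _ _ (by simp)]
  exact Finset.sum_congr rfl fun α _ => (h1 α (x α)).symm

theorem barModule_dualBasis (α : BinString N) : barModule (dualBasis α) = dualBasis α := by
  rw [barModule_eq_dualBar]
  refine eq_of_pairing tPar tNPar fun δ hδ => ?_
  rw [pairing_dualBar δ hδ, pairing_dualBasis α δ hδ]
  split_ifs <;> simp

/-- The pairings of `C β` and of the dual vector differ by an element of `ℤ(Γ₋)`, since coefficients
and forms are both unitriangular modulo it. The difference is also bar invariant, hence `0`. -/
theorem eq_dualBasis_of_isKLBasis {C : BinString N → StringModule LaurentRing N}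
    (hC : IsKLBasis C) : C = dualBasis := by
  funext β
  refine eq_of_pairing tPar tNPar fun δ hδ => ?_
  rw [← sub_eq_zero]
  refine eq_zero_of_mem_negSpan ?_ ?_
  · obtain ⟨α, rfl⟩ : ∃ α : BinString N, letters α = δ := ⟨ofLetters N δ, letters_ofLetters δ hδ⟩
    rw [pairing_dualBasis β _ hδ, pairing_eq_sum]
    have h1 : ∀ γ, γ ≠ β → C β γ * linkCoeff tPar tNPar [] (letters α) (letters γ) ∈ negSpan := by
      intro γ hγ
      by_cases e : α = γ
      · rw [e, linkCoeff_self _ _ _ _ (by simp), mul_one]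
        exact hC.coeff_mem γ β hγ
      · exact negSpan_mul (hC.coeff_mem γ β hγ)
          (linkCoeff_mem_negSpan _ _ fun h => e (letters_injective h))
    rw [← Finset.add_sum_erase _ _ (Finset.mem_univ β), hC.coeff_self, one_mul, add_sub_right_comm]
    refine add_mem ?_ (sum_mem fun γ hγ => h1 γ (Finset.ne_of_mem_erase hγ))
    by_cases e : α = β
    · rw [e, linkCoeff_self _ _ _ _ (by simp), if_pos rfl, sub_self]
      exact zero_mem _
    · have e' : letters α ≠ letters β := fun h => e (letters_injective h)
      rw [if_neg e', sub_zero]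
      exact linkCoeff_mem_negSpan _ _ e'
  · have h1 := hC.bar_invariant β
    rw [barModule_eq_dualBar] at h1
    rw [map_sub, ← pairing_dualBar δ hδ, h1, pairing_dualBasis β δ hδ]
    split_ifs <;> simp

end


/-! ### Words in the Coxeter group -/

theorem area_eq_of_ascPath {l : List ℕ} {γ γ' : List Bool} (h : AscPath l γ γ') :
    area γ' = area γ + l.length := by
  induction h with
  | nil => simp
  | @swap l γ u v h ih =>
    have ha : area (u ++ true :: false :: v) = area (u ++ false :: true :: v) + 1 := by
      rw [area_append, area_append]; simp [area]; omega
    rw [ha, ih, List.length_cons]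
    omega
  | @flip l γ u h ih =>
    have ha : area (u ++ [true]) = area (u ++ [false]) + 1 := by
      rw [area_append, area_append]; simp [area]
    rw [ha, ih, List.length_cons]
    omega

theorem row_map_fst (s : ℕ) (ps : List ℕ) : (row s ps).map Prod.fst = List.range' s ps.length := by
  induction ps generalizing s with
  | nil => rfl
  | cons p ps ih => simp [row, ih, List.range'_succ]

/-- The nodes of the boxes of a string. -/
def nodes (s : ℕ) (a : List Bool) : List ℕ := (boxes s a).map Prod.fst

theorem nodes_true (s : ℕ) (a : List Bool) :
    nodes s (true :: a) = nodes (s + 1) a ++ List.range' s (a.length + 1) := by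
  rw [nodes, boxes, List.map_append, row_map_fst, length_rho]
  rfl

theorem nodes_false (s : ℕ) (a : List Bool) : nodes s (false :: a) = nodes (s + 1) a := rfl

theorem le_of_mem_nodes (s : ℕ) (a : List Bool) (k : ℕ) (h : k ∈ nodes s a) : s ≤ k := by
  obtain ⟨b, hb, rfl⟩ := List.mem_map.1 h
  exact (le_of_mem_boxes _ _ _ hb).1

theorem exists_nodes_append (s n : ℕ) (u : List Bool) :
    ∃ R, ∀ x : List Bool, x.length = n → nodes s (u ++ x) = nodes (s + u.length) x ++ R := by
  induction u generalizing s with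
  | nil => exact ⟨[], by simp⟩
  | cons a u ih =>
    obtain ⟨R, hR⟩ := ih (s + 1)
    have e : s + 1 + u.length = s + (a :: u).length := by simp; omega
    cases a with
    | false => exact ⟨R, fun x hx => by rw [List.cons_append, nodes_false, hR x hx, e]⟩
    | true =>
      refine ⟨R ++ List.range' s ((u.length + n) + 1), fun x hx => ?_⟩
      rw [List.cons_append, nodes_true, hR x hx, e, List.append_assoc, List.length_append, hx]

section

variable {G : Type} [Group G] (g : ℕ → G)

/-- Moving a 2 one place to the left lengthens its row by the node `u.length`, and this generator
commutes with those of the boxes of `v`, whose nodes are at least `u.length + 2`. -/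
theorem prod_nodes_swap (hg : ∀ i j, Far i j → g i * g j = g j * g i) (u v : List Bool) :
    ((nodes 0 (u ++ true :: false :: v)).map g).prod =
      g u.length * ((nodes 0 (u ++ false :: true :: v)).map g).prod := by
  obtain ⟨R, hR⟩ := exists_nodes_append 0 (v.length + 2) u
  rw [hR _ (by simp), hR _ (by simp), nodes_true, nodes_false, nodes_false, nodes_true,
    List.length_cons, List.range'_succ (s := 0 + u.length)]
  simp only [List.map_append, List.prod_append, zero_add, List.map_cons, List.prod_cons]
  have hc : ∀ L : List ℕ, (∀ k ∈ L, u.length + 2 ≤ k) →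
      (L.map g).prod * g u.length = g u.length * (L.map g).prod := by
    intro L hL
    induction L with
    | nil => simp
    | cons k L ih =>
      have h1 := hL k (by simp)
      rw [List.map_cons, List.prod_cons, mul_assoc, ih fun k hk => hL k (by simp [hk]),
        ← mul_assoc, ← mul_assoc, hg k u.length (by right; omega)]
  have h2 := hc (nodes (u.length + 1 + 1) v) fun k hk => le_of_mem_nodes _ _ _ hk
  simp only [← mul_assoc, h2]

theorem prod_nodes_flip (u : List Bool) :
    ((nodes 0 (u ++ [true])).map g).prod =
      g u.length * ((nodes 0 (u ++ [false])).map g).prod := by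
  obtain ⟨R, hR⟩ := exists_nodes_append 0 1 u
  rw [hR _ (by simp), hR _ (by simp), nodes_true, nodes_false]
  simp [nodes, boxes, List.range'_succ]

end

/-! ### Coefficients and subwords -/

section

variable {N : ℕ} {G : Type} [Group G] (g : ℕ → G)

/-- The span of the basis vectors of the strings whose group element is the product of a subword
of a word. -/
def subwordSpan (N : ℕ) (ω : List ℕ) : Submodule RatField (StringModule RatField N) :=
  Submodule.span RatField {x | ∃ l : List Bool, l.length = N ∧
    (∃ ω' : List ℕ, ω'.Sublist ω ∧ (ω'.map g).prod = ((nodes 0 l).map g).prod) ∧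
    x = basisVec RatField N l}

/-- A string appearing in the image is either the old one, for which `k` is omitted from the
subword, or the one moved by `s_k`, for which `k` is used. -/
theorem shiftOp_mem_subwordSpan (hg : ∀ i j, Far i j → g i * g j = g j * g i)
    (hg2 : ∀ i, g i * g i = 1) (k : ℕ) (ω : List ℕ)
    (Z : StringModule RatField N) (hZ : Z ∈ subwordSpan g N ω) :
    shiftOp tK tNK k Z ∈ subwordSpan g N (k :: ω) := by
  suffices h : subwordSpan g N ω ≤ (subwordSpan g N (k :: ω)).comap (shiftOp tK tNK k) from h hZ
  refine Submodule.span_le.2 ?_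
  rintro x ⟨l, h1, ⟨ω', h2, h3⟩, rfl⟩
  rw [SetLike.mem_coe, Submodule.mem_comap]
  have hself : basisVec RatField N l ∈ subwordSpan g N (k :: ω) :=
    Submodule.subset_span ⟨l, h1, ⟨ω', h2.cons _, h3⟩, rfl⟩
  have hstep : ∀ l' : List Bool, l'.length = N →
      ((nodes 0 l').map g).prod = g k * ((nodes 0 l).map g).prod →
      basisVec RatField N l' ∈ subwordSpan g N (k :: ω) := by
    intro l' hl' e
    exact Submodule.subset_span ⟨l', hl', ⟨k :: ω', h2.cons_cons _, by simp [h3, e]⟩, rfl⟩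
  rcases lt_trichotomy (k + 1) N with hk | hk | hk
  · obtain ⟨u, a, b, v, rfl, rfl⟩ : ∃ u a b v, l = u ++ a :: b :: v ∧ u.length = k :=
      ⟨l.take k, l[k], l[k + 1], l.drop (k + 2), by simp, by simp; omega⟩
    rw [shiftOp_basisVec_swap _ _ _ _ _ _ h1]
    have e := prod_nodes_swap g hg u v
    cases a <;> cases b
    · simp
    · simp only [reduceCtorEq, if_false, if_true]
      exact Submodule.sub_mem _ (hstep _ (by simpa using h1) e) (Submodule.smul_mem _ _ hself)
    · simp only [reduceCtorEq, if_false]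
      refine Submodule.sub_mem _ (hstep _ (by simpa using h1) ?_) (Submodule.smul_mem _ _ hself)
      rw [e, ← mul_assoc, hg2, one_mul]
    · simp
  · obtain ⟨u, a, rfl, rfl⟩ : ∃ u a, l = u ++ [a] ∧ u.length = k := by
      refine ⟨l.take k, l[k], ?_, by simp; omega⟩
      rw [List.take_append_getElem, List.take_of_length_le (by omega)]
    rw [shiftOp_basisVec_flip _ _ _ _ h1]
    have e := prod_nodes_flip g u
    cases a
    · simp only [if_true]
      exact Submodule.sub_mem _ (hstep _ (by simpa using h1) e) (Submodule.smul_mem _ _ hself)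
    · simp only [reduceCtorEq, if_false]
      refine Submodule.sub_mem _ (hstep _ (by simpa using h1) ?_) (Submodule.smul_mem _ _ hself)
      rw [e, ← mul_assoc, hg2, one_mul]
  · have : shiftOp (N := N) tK tNK k = 0 := by
      rw [shiftOp, dif_neg (by omega)]
    rw [this]
    exact Submodule.zero_mem _

theorem act_mem_subwordSpan (hg : ∀ i j, Far i j → g i * g j = g j * g i)
    (hg2 : ∀ i, g i * g i = 1) (L : List (ℕ × ℕ)) :
    act L (basisVec RatField N (List.replicate N false)) ∈
      subwordSpan g N (L.map Prod.fst) := by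
  induction L with
  | nil =>
    refine Submodule.subset_span ⟨_, by simp, ⟨[], List.Sublist.refl _, ?_⟩, rfl⟩
    have := boxes_replicate_false 0 N []
    rw [List.append_nil] at this
    rw [nodes, this]
    rfl
  | cons b L ih =>
    obtain ⟨c, hc⟩ := exists_facOp_eq (N := N) b.1 b.2
    rw [act_cons, hc, List.map_cons]
    refine Submodule.add_mem _ (shiftOp_mem_subwordSpan g hg hg2 _ _ _ ih)
      (Submodule.smul_mem _ _ ?_)
    refine Submodule.span_mono ?_ ih
    rintro x ⟨l, h1, ⟨ω', h2, h3⟩, rfl⟩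
    exact ⟨l, h1, ⟨ω', h2.cons _, h3⟩, rfl⟩

theorem exists_subword_of_mem {ω : List ℕ} {Z : StringModule RatField N}
    (hZ : Z ∈ subwordSpan g N ω) (γ : BinString N) (hγ : Z γ ≠ 0) :
    ∃ ω' : List ℕ, ω'.Sublist ω ∧ (ω'.map g).prod = ((nodes 0 (letters γ)).map g).prod := by
  by_contra hne
  apply hγ
  suffices h : subwordSpan g N ω ≤ LinearMap.ker (Finsupp.lapply γ) from h hZ
  refine Submodule.span_le.2 ?_
  rintro x ⟨l, h1, h2, rfl⟩
  rw [SetLike.mem_coe, LinearMap.mem_ker, Finsupp.lapply_apply, basisVec, Finsupp.single_apply,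
    if_neg]
  rintro rfl
  rw [letters_ofLetters l h1] at hne
  exact hne h2

end

/-! ### The Coxeter group of type `B_N` -/

section

variable {N : ℕ}

/-- The simple reflections, with natural numbers as indices. -/
def simpleNat (N k : ℕ) : (CoxeterMatrix.B N).Group :=
  if h : k < N then (coxB N).simple ⟨k, h⟩ else 1

theorem simpleNat_val (i : Fin N) : simpleNat N i = (coxB N).simple i := by simp [simpleNat]

theorem simpleNat_mul_self (k : ℕ) : simpleNat N k * simpleNat N k = 1 := by
  unfold simpleNat
  split_ifs
  · exact (coxB N).simple_mul_simple_self _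
  · exact one_mul 1

theorem simpleNat_comm (i j : ℕ) (h : Far i j) :
    simpleNat N i * simpleNat N j = simpleNat N j * simpleNat N i := by
  unfold simpleNat
  split_ifs with h1 h2
  · have h3 := (coxB N).simple_mul_simple_pow ⟨i, h1⟩ ⟨j, h2⟩
    have h4 : (CoxeterMatrix.B N).M ⟨i, h1⟩ ⟨j, h2⟩ = 2 := by
      simp only [CoxeterMatrix.B, Matrix.of_apply, Fin.mk.injEq]
      rw [if_neg (by omega), if_neg (by omega), if_neg (by omega)]
    rw [h4, pow_two] at h3
    have h5 : ((coxB N).simple ⟨i, h1⟩ * (coxB N).simple ⟨j, h2⟩)⁻¹ =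
        (coxB N).simple ⟨i, h1⟩ * (coxB N).simple ⟨j, h2⟩ := inv_eq_of_mul_eq_one_left h3
    rw [mul_inv_rev, (coxB N).inv_simple, (coxB N).inv_simple] at h5
    exact h5.symm
  · simp
  · simp
  · simp

theorem wordProd_eq (ω : List (Fin N)) :
    (coxB N).wordProd ω = ((ω.map fun i : Fin N => (i : ℕ)).map (simpleNat N)).prod := by
  rw [CoxeterSystem.wordProd, List.map_map]
  congr 2
  funext i
  exact (simpleNat_val i).symm

theorem wordProd_word (α : BinString N) :
    (coxB N).wordProd (word α) = ((nodes 0 (letters α)).map (simpleNat N)).prod := by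
  rw [wordProd_eq, word_map, nodes]

theorem exists_sublist_of_factorized (α β : BinString N) (h : factorized β α ≠ 0) :
    ∃ ω' : List (Fin N), ω'.Sublist (word β) ∧
      (coxB N).wordProd ω' = (coxB N).wordProd (word α) := by
  rw [factorized_eq, factorProd] at h
  obtain ⟨ω, h1, h2⟩ := exists_subword_of_mem (simpleNat N)
    (act_mem_subwordSpan (simpleNat N) simpleNat_comm simpleNat_mul_self _) α h
  rw [← word_map] at h1
  obtain ⟨ω', h3, rfl⟩ := List.sublist_map_iff.1 h1
  exact ⟨ω', h3, by rw [wordProd_eq, h2, wordProd_word]⟩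

/-- The action of a simple reflection on the strings, linearly extended. -/
abbrev stringOp (i : Fin N) : Module.End ℤ (StringModule ℤ N) := genOp 1 1 i

theorem stringOp_mul_self (i : Fin N) : stringOp i * stringOp i = 1 := by
  have h := genOp_quadratic (1 : ℤˣ) 1 i
  have e : nodePar (1 : ℤˣ) 1 i = 1 := by simp [nodePar]
  rw [e, inv_one, Units.val_one, map_one, sub_mul, mul_add, mul_add] at h
  simp only [mul_one, one_mul] at h
  rw [← sub_eq_zero, ← h]
  abel

theorem pow_three_of_braid {G : Type} [Monoid G] {a b : G} (ha : a * a = 1) (hb : b * b = 1)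
    (h : a * b * a = b * a * b) : (a * b) ^ 3 = 1 := by
  calc (a * b) ^ 3 = a * b * a * (b * a * b) := by simp only [pow_succ, pow_zero, one_mul, mul_assoc]
    _ = a * b * (a * a) * b * a := by rw [← h]; simp only [mul_assoc]
    _ = 1 := by rw [ha, mul_one, mul_assoc a, hb, mul_one, ha]

theorem pow_four_of_braid {G : Type} [Monoid G] {a b : G} (ha : a * a = 1) (hb : b * b = 1)
    (h : a * b * a * b = b * a * b * a) : (a * b) ^ 4 = 1 := by
  calc (a * b) ^ 4 = a * b * a * b * (a * b * a * b) := by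
        simp only [pow_succ, pow_zero, one_mul, mul_assoc]
    _ = a * b * a * (b * b) * a * b * a := by nth_rw 2 [h]; simp only [mul_assoc]
    _ = a * b * (a * a) * b * a := by rw [hb, mul_one]; simp only [mul_assoc]
    _ = 1 := by rw [ha, mul_one, mul_assoc a, hb, mul_one, ha]

/-- At `t = t_N = 1` the quadratic relations say that the generators are involutions, and the braid
relations become the Coxeter relations. -/
theorem stringOp_isLiftable : (CoxeterMatrix.B N).IsLiftable (stringOp (N := N)) := by
  have main : ∀ i j : Fin N, i < j →
      (stringOp i * stringOp j) ^ (CoxeterMatrix.B N).M i j = 1 ∧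
      (stringOp j * stringOp i) ^ (CoxeterMatrix.B N).M j i = 1 := by
    intro i j hij
    have hij' : (i : ℕ) < j := hij
    have hj := j.2
    rw [(CoxeterMatrix.B N).symmetric j i]
    simp only [CoxeterMatrix.B, Matrix.of_apply]
    rw [if_neg (ne_of_lt hij)]
    have hi2 := stringOp_mul_self i
    have hj2 := stringOp_mul_self j
    by_cases h1 : (i : ℕ) + 1 = j
    · by_cases h2 : (j : ℕ) + 1 = N
      · rw [if_pos (by omega)]
        have h := genOp_braidLast (1 : ℤˣ) 1 i j h1.symm h2
        exact ⟨pow_four_of_braid hi2 hj2 h, pow_four_of_braid hj2 hi2 h.symm⟩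
      · rw [if_neg (by omega), if_pos (by omega)]
        have h := genOp_braid (1 : ℤˣ) 1 i j h1.symm (by omega)
        exact ⟨pow_three_of_braid hi2 hj2 h, pow_three_of_braid hj2 hi2 h.symm⟩
    · rw [if_neg (by omega), if_neg (by omega)]
      have h := genOp_commute (1 : ℤˣ) 1 i j (by omega)
      have e : stringOp i * stringOp j * (stringOp i * stringOp j) = 1 := by
        nth_rw 1 [h]
        rw [mul_assoc, ← mul_assoc (stringOp i), hi2, one_mul, hj2]
      refine ⟨by rw [pow_two, e], ?_⟩
      rw [← h, pow_two, e]
  intro i j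
  rcases lt_trichotomy i j with h | rfl | h
  · exact (main i j h).1
  · rw [(CoxeterMatrix.B N).diagonal, pow_one, stringOp_mul_self]
  · exact (main j i h).2

theorem stringOp_basisVec (i : Fin N) (l : List Bool) (hl : l.length = N) :
    ∃ l' : List Bool, l'.length = N ∧ area l' ≤ area l + 1 ∧
      stringOp i (basisVec ℤ N l) = basisVec ℤ N l' := by
  have hi := i.2
  rcases Nat.lt_or_ge ((i : ℕ) + 1) N with hk | hk
  · obtain ⟨u, a, b, v, rfl, hu⟩ : ∃ u a b v, l = u ++ a :: b :: v ∧ u.length = (i : ℕ) :=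
      ⟨l.take i, l[(i : ℕ)], l[(i : ℕ) + 1], l.drop (i + 2), by simp, by simp; omega⟩
    refine ⟨u ++ b :: a :: v, by simpa using hl, ?_, ?_⟩
    · rw [area_append, area_append]
      cases a <;> cases b <;> simp [area] <;> omega
    · have hu' : u.length < N := by omega
      rw [show i = ⟨u.length, hu'⟩ from Fin.ext hu.symm, stringOp, genOp_basisVec_swap _ _ _ _ _ _ hl]
      cases a <;> cases b <;> simp
  · obtain ⟨u, a, rfl, hu⟩ : ∃ u a, l = u ++ [a] ∧ u.length = (i : ℕ) := by
      refine ⟨l.take i, l[(i : ℕ)], ?_, by simp; omega⟩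
      rw [List.take_append_getElem, List.take_of_length_le (by omega)]
    refine ⟨u ++ [!a], by simpa using hl, ?_, ?_⟩
    · rw [area_append, area_append]
      cases a
      · simp [area]
      · simp [area]; omega
    · have hu' : u.length < N := by omega
      rw [show i = ⟨u.length, hu'⟩ from Fin.ext hu.symm, stringOp, genOp_basisVec_flip _ _ _ _ hl]
      cases a <;> simp

theorem prod_stringOp (ω : List (Fin N)) :
    ∃ l : List Bool, l.length = N ∧ area l ≤ ω.length ∧
      (ω.map stringOp).prod (basisVec ℤ N (List.replicate N false)) = basisVec ℤ N l := by
  induction ω with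
  | nil => exact ⟨_, by simp, by simp [area_replicate_false], rfl⟩
  | cons i ω ih =>
    obtain ⟨l, h1, h2, h3⟩ := ih
    obtain ⟨l', h4, h5, h6⟩ := stringOp_basisVec i l h1
    refine ⟨l', h4, by simp; omega, ?_⟩
    rw [List.map_cons, List.prod_cons, Module.End.mul_apply, h3, h6]

/-- The group acts on strings. A reduced expression of the same element also takes `1…1` to `α`, and
a generator raises the area by at most one, so its length is at least the area of `α`, which is the
length of the word. -/
theorem isReduced_word (α : BinString N) : (coxB N).IsReduced (word α) := by
  refine le_antisymm ((coxB N).length_wordProd_le _) ?_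
  obtain ⟨ω, hω, hprod⟩ := (coxB N).exists_isReduced ((coxB N).wordProd (word α))
  have hlift : ∀ ω : List (Fin N), (coxB N).lift ⟨stringOp, stringOp_isLiftable⟩
      ((coxB N).wordProd ω) = (ω.map stringOp).prod := by
    intro ω
    rw [CoxeterSystem.wordProd, map_list_prod, List.map_map]
    refine congrArg List.prod (List.map_congr_left fun i _ => ?_)
    exact (coxB N).lift_apply_simple stringOp_isLiftable i
  obtain ⟨l, h1, h2, h3⟩ := prod_stringOp ω
  have h4 := prod_genOp_of_ascPath (1 : ℤˣ) 1 _ (ascPath_word α) (by simp)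
  have h5 : (ω.map stringOp).prod = ((word α).map stringOp).prod := by
    rw [← hlift, ← hlift, hprod]
  rw [h5] at h3
  have h6 : basisVec ℤ N (letters α) = basisVec ℤ N l := h4.symm.trans h3
  have h7 : letters α = l := by
    have := Finsupp.single_left_injective (one_ne_zero) h6
    rw [← letters_ofLetters l h1, ← this, ofLetters_letters]
  have h8 := area_eq_of_ascPath (ascPath_word α)
  rw [area_replicate_false, zero_add, List.length_map, h7] at h8
  rw [hprod, hω.eq]
  omega

theorem stringLE_of_dualBasis_ne_zero (α β : BinString N) (h : dualBasis β α ≠ 0) :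
    stringLE α β := by
  refine ⟨word β, isReduced_word β, rfl, exists_sublist_of_factorized α β ?_⟩
  rw [factorized_eq_extendScalars]
  intro h0
  apply h
  exact IsFractionRing.injective LaurentRing RatField (h0.trans (map_zero _).symm)

theorem isKLBasis_dualBasis : IsKLBasis (dualBasis : BinString N → StringModule LaurentRing N) where
  linearIndependent := linearIndependent_dualBasis
  span_eq_top := span_dualBasis
  bar_invariant := barModule_dualBasis
  support_le := stringLE_of_dualBasis_ne_zero
  coeff_self := dualBasis_self
  coeff_mem := dualBasis_mem

end

end KLFactor
end

theorem mainTheorem7 (N : ℕ) :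
    ∃ C : KLFactor.BinString N → KLFactor.StringModule KLFactor.LaurentRing N,
      KLFactor.IsKLBasis C ∧
      (∀ C' : KLFactor.BinString N → KLFactor.StringModule KLFactor.LaurentRing N,
        KLFactor.IsKLBasis C' → C' = C) ∧
      ∀ α : KLFactor.BinString N, KLFactor.factorized α = KLFactor.extendScalars (C α) :=
  ⟨KLFactor.dualBasis, KLFactor.isKLBasis_dualBasis,
    fun _ h => KLFactor.eq_dualBasis_of_isKLBasis h, KLFactor.factorized_eq_extendScalars⟩
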